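/- For an integer $k\ge 1$ and $z=(z_1,\dots,z_{2k})\in\mathbb{C}^{2k}$ near the origin put $$A(z_1,\dots,z_{2k})=\prod_p\Bigl[\prod_{i,j=1}^k\bigl(1-p^{-1-z_i+z_{k+j}}\bigr)\int_0^1\prod_{j=1}^k\Bigl(1-\frac{e^{2\pi i\theta}}{p^{1/2+z_j}}\Bigr)^{-1}\Bigl(1-\frac{e^{-2\pi i\theta}}{p^{1/2-z_{k+j}}}\Bigr)^{-1}d\theta\Bigr],$$ the outer product being over all primes, and put $$a_k=\prod_p(1-1/p)^{k^2}F(k,k;1;1/p),\qquad B_k=\sum_p\Bigl(\frac{k\log p}{p-1}-k\,\frac{F(k+1,k+1;2;1/p)}{F(k,k;1;1/p)}\,\frac{\log p}{p}\Bigr),$$ where $F$ is the Gauss hypergeometric function. For $\alpha\in\mathbb{Z}_{\ge 0}^{2k}$ let $|\alpha|=\alpha_1+\cdots+\alpha_{2k}$ and let $m(\alpha)$ be the number of nonzero entries of $\alpha$. For every $k\ge 1$ we have $a_k>0$, the series $B_k$ converges absolutely, and in a neighbourhood of the origin the product $A$ converges, is nonzero, and (with the principal logarithm) has an absolutely convergent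 Taylor expansion $$\log A(z_1,\dots,z_{2k})=\log a_k+B_k\sum_{i=1}^k(z_i-z_{k+i})+\sum_{|\alpha|>1}a_\alpha z_1^{\alpha_1}\cdots z_{2k}^{\alpha_{2k}}.$$ There is an absolute constant $\lambda_2>0$ such that, as $k\to\infty$ and uniformly in $\alpha\in\mathbb{Z}_{\ge0}^{2k}$ with $|\alpha|>1$, with absolute implied constants, $$a_\alpha\ll\lambda_2^{|\alpha|}(\log k)^{|\alpha|}k+\lambda_2^{|\alpha|}\,|\alpha|!\,(\log k)^{|\alpha|-1}k\qquad\text{if } m(\alpha)=1,$$ $$a_\alpha\ll\lambda_2^{|\alpha|}m(\alpha)^{|\alpha|}(\log k)^{|\alpha|}+\lambda_2^{|\alpha|}\,|\alpha|!\,(\log k)^{|\alpha|-1}k^{2-m(\alpha)}\qquad\text{if } m(\alpha)>1,$$ and, more simply but slightly less precisely, in all cases $$a_\alpha\ll\lambda_2^{|\alpha|}(\log k)^{|\alpha|}\bigl[m(\alpha)^{|\alpha|}k^{2-\min\{m(\alpha),2\}}+|\alpha|!\,k^{2-m(\alpha)}\bigr].$$ -/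

import Mathlib

open Filter Topology

namespace ZetaMoment

noncomputable section

/-- The local factor at the prime `p` of the arithmetic factor. The variables
`z_1, …, z_k` are `z (Sum.inl i)` and `z_{k+1}, …, z_{2k}` are `z (Sum.inr j)`. -/
def localFactor (k : ℕ) (p : ℕ) (z : Fin k ⊕ Fin k → ℂ) : ℂ :=
  (∏ i : Fin k, ∏ j : Fin k, (1 - (p : ℂ) ^ (-1 - z (Sum.inl i) + z (Sum.inr j)))) *
    ∫ θ in (0 : ℝ)..1, ∏ j : Fin k,
      (1 - Complex.exp (2 * Real.pi * Complex.I * θ) /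
          (p : ℂ) ^ (1 / 2 + z (Sum.inl j)))⁻¹ *
      (1 - Complex.exp (-(2 * Real.pi * Complex.I * θ)) /
          (p : ℂ) ^ (1 / 2 - z (Sum.inr j)))⁻¹

/-- The arithmetic factor `A(z_1, …, z_{2k})`, an Euler product. -/
def arithFactor (k : ℕ) (z : Fin k ⊕ Fin k → ℂ) : ℂ :=
  ∏' p : Nat.Primes, localFactor k p z

/-- `a_k = ∏_p (1 - 1/p)^{k²} F(k, k; 1; 1/p)`. -/
def aConst (k : ℕ) : ℝ :=
  ∏' p : Nat.Primes,
    (1 - 1 / ((p : ℕ) : ℝ)) ^ (k ^ 2) *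
      ordinaryHypergeometric (k : ℝ) (k : ℝ) (1 : ℝ) (1 / ((p : ℕ) : ℝ))

/-- The term at the prime `p` of the series `B_k`. -/
def bTerm (k : ℕ) (p : ℕ) : ℝ :=
  k * Real.log p / ((p : ℝ) - 1) -
    k * (ordinaryHypergeometric ((k : ℝ) + 1) ((k : ℝ) + 1) (2 : ℝ) (1 / (p : ℝ)) /
      ordinaryHypergeometric (k : ℝ) (k : ℝ) (1 : ℝ) (1 / (p : ℝ))) *
      (Real.log p / p)

/-- The coefficient `B_k` of the linear term of `log A`. -/
def bConst (k : ℕ) : ℝ := ∑' p : Nat.Primes, bTerm k p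

/-- The weight `|α|` of a tuple. -/
def weight {ι : Type*} [Fintype ι] (α : ι → ℕ) : ℕ := ∑ i, α i

/-- The number `m(α)` of nonzero entries of a tuple. -/
def numNonzero {ι : Type*} [Fintype ι] (α : ι → ℕ) : ℕ :=
  (Finset.univ.filter fun i => α i ≠ 0).card

/-- `log A(z) = log a_k + B_k ∑ᵢ (z_i - z_{k+i}) + ∑_{|α| > 1} a_α z^α` near the origin: the
constants are given by convergent expressions, the Euler product converges and does not vanish
near the origin, and the power series converges (absolutely) there to the principal logarithm. -/
def IsTaylorExpansion (k : ℕ) (a : (Fin k ⊕ Fin k → ℕ) → ℂ) : Prop :=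
  0 < aConst k ∧ (Summable fun p : Nat.Primes => bTerm k p) ∧
  ∀ᶠ z : Fin k ⊕ Fin k → ℂ in 𝓝 0,
    (Multipliable fun p : Nat.Primes => localFactor k p z) ∧
    arithFactor k z ≠ 0 ∧
    HasSum (fun α : {α : Fin k ⊕ Fin k → ℕ // 1 < weight α} => a α.1 * ∏ i, z i ^ α.1 i)
      (Complex.log (arithFactor k z) - (Real.log (aConst k) : ℂ) -
        (bConst k : ℂ) * ∑ i : Fin k, (z (Sum.inl i) - z (Sum.inr i)))

end

end ZetaMoment

/-! Put L = log k + 16 and f = log(A/a_k). The theorem reduces to two bounds with an absolute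
constant C on the ℓ¹-ball ∑|z_s| < δ = 1/(400L): |f| ≤ Ck, and |f(z) - ∑_j f(z_j e_j)| ≤ C for the
part of f that mixes variables (`exists_log_arithFactor`). To estimate a_α, set the variables
outside the support of α to zero and apply Cauchy's inequality on the polydisc of radius δ/(2m), m =
m(α), which lies in the ℓ¹-ball. If m > 1, the mixed part has the same coefficient as f, so its
better bound applies (`exists_coeff_bounds`). This gives Ck(800L)^|α| and C(800mL)^|α|; the
factorial terms of the statement are not needed.

The two bounds are proved prime by prime. With r = p^{-1/2}, the local factor is ∏(1 - x_i x_{k+j})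
· J(x), where x_s = r(1+ζ_s), 1+ζ_s = p^{±z_s} and J is the circle integral. Write σ = ∑|ζ_s|. A
bounded holomorphic function on an ℓ¹-ball of radius R that vanishes at 0 is O(σ/R), and its mixed
part is O((σ/R)²) (`schwarz_mixed`).

For p ≤ e^{2L}, the integrand of J is positive at the centre, so J changes by a relative amount at
most 1/2 when x moves by 1/20 in ℓ¹, whatever k is. Hence log(J/J(centre)) is O(rσ) with mixed part
O(r²σ²). The pair product contributes O(kr²σ), with mixed part O(r²σ²) (`exists_log_scaledFactor`).
Since σ ≪ log p / L, Mertens' bound and ∑ p^{-1/2} ≪ √(e^{2L}) ≪ k suffice.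

For p > e^{2L}, the quadratic terms of the pair product and of J cancel, so the local factor is 1 +
O((∑|x_s|)⁴). On a ball of radius R = k e^{log p/L}, much larger than the actual σ < e^{log p/L},
Schwarz gains 1/k for the size and 1/k² for the mixed part (`exists_log_scaledFactor_of_large`). The
tail ∑ p^{-3/2} ≪ 1/k then closes both sums.

The constants a_k and B_k come from Parseval: the central value of J and its first derivative are
hypergeometric series. The notion `CurveHolomorphicOn` is chosen because it passes through integrals
and infinite sums by one-variable theorems, yet is enough for the iterated Cauchy formula. -/

namespace ZetaMoment

noncomputable section

open MeasureTheory Metric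

/-! ### Cauchy's formula and power series on polydiscs. -/

/-- Continuity together with holomorphy along every holomorphic curve. -/
def CurveHolomorphicOn {ι : Type*} (f : (ι → ℂ) → ℂ) (U : Set (ι → ℂ)) : Prop :=
  ContinuousOn f U ∧ ∀ (γ : ℂ → ι → ℂ) (V : Set ℂ), IsOpen V → DifferentiableOn ℂ γ V →
    Set.MapsTo γ V U → DifferentiableOn ℂ (fun t => f (γ t)) V

/-- A finite product of absolutely convergent series is the sum over all tuples of indices. -/
theorem hasSum_prod_pi {ι : Type*} [Fintype ι] {g : ι → ℕ → ℂ} {G : ι → ℂ}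
    (hs : ∀ i, Summable fun n => ‖g i n‖) (h : ∀ i, HasSum (g i) (G i)) :
    (Summable fun α : ι → ℕ => ‖∏ i, g i (α i)‖) ∧
      HasSum (fun α : ι → ℕ => ∏ i, g i (α i)) (∏ i, G i) := by
  classical
  have hsum : Summable fun α : ι → ℕ => ‖∏ i, g i (α i)‖ := by
    refine summable_of_sum_le (c := ∏ i, ∑' n, ‖g i n‖) (fun _ => norm_nonneg _) fun u => ?_
    obtain ⟨N, hN⟩ : ∃ N : ℕ, ∀ α ∈ u, ∀ i, α i < N := by
      refine ⟨(u.sup fun α => ∑ i, α i) + 1, fun α hα i => Nat.lt_succ_of_le ?_⟩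
      exact (Finset.single_le_sum (fun _ _ => Nat.zero_le _) (Finset.mem_univ i)).trans
        (Finset.le_sup (f := fun α : ι → ℕ => ∑ i, α i) hα)
    calc ∑ α ∈ u, ‖∏ i, g i (α i)‖
        ≤ ∑ α ∈ Fintype.piFinset fun _ : ι => Finset.range N, ‖∏ i, g i (α i)‖ := by
          refine Finset.sum_le_sum_of_subset_of_nonneg (fun α hα => ?_) fun _ _ _ => norm_nonneg _
          exact Fintype.mem_piFinset.2 fun i => Finset.mem_range.2 (hN α hα i)
      _ = ∏ i, ∑ n ∈ Finset.range N, ‖g i n‖ := by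
          rw [Finset.prod_univ_sum]
          exact Finset.sum_congr rfl fun α _ => norm_prod _ _
      _ ≤ _ := Finset.prod_le_prod (fun _ _ => Finset.sum_nonneg fun _ _ => norm_nonneg _)
          fun i _ => (hs i).sum_le_tsum _ fun _ _ => norm_nonneg _
  refine ⟨hsum, ?_⟩
  have h1 := hsum.of_norm.hasSum
  -- Boxes are cofinal among finite sets of tuples, and over a box finite distributivity turns the
  -- partial sum into a product of partial sums.
  have htend : Tendsto (fun N : ℕ => Fintype.piFinset fun _ : ι => Finset.range N) atTop atTop := by
    refine tendsto_atTop_finset_of_monotone (fun a b hab => ?_) fun α => ?_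
    · exact Fintype.piFinset_subset _ _ fun _ => Finset.range_mono hab
    · refine ⟨(∑ i, α i) + 1, Fintype.mem_piFinset.2 fun i => Finset.mem_range.2 ?_⟩
      exact Nat.lt_succ_of_le (Finset.single_le_sum (fun _ _ => Nat.zero_le _) (Finset.mem_univ i))
  have h2 := h1.comp htend
  have h3 : Tendsto (fun N : ℕ => ∏ i, ∑ n ∈ Finset.range N, g i n) atTop (𝓝 (∏ i, G i)) :=
    tendsto_finsetProd _ fun i _ => (h i).tendsto_sum_nat
  have h4 := tendsto_nhds_unique (h2.congr fun N => by
    simp only [Function.comp]; rw [Finset.prod_univ_sum]) h3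
  rwa [h4] at h1

/-- The uniform probability measure on a period. -/
def circleMeasure : Measure ℝ :=
  ENNReal.ofReal (2 * Real.pi)⁻¹ • volume.restrict (Set.Ioc 0 (2 * Real.pi))

instance : IsProbabilityMeasure circleMeasure := by
  constructor
  have : (0 : ℝ) < 2 * Real.pi := Real.two_pi_pos
  simp only [circleMeasure, Measure.smul_apply, Measure.restrict_apply MeasurableSet.univ,
    Set.univ_inter, Real.volume_Ioc, sub_zero, smul_eq_mul]
  rw [← ENNReal.ofReal_mul (by positivity), inv_mul_cancel₀ this.ne', ENNReal.ofReal_one]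

theorem integral_circleMeasure (g : ℝ → ℂ) :
    ∫ θ, g θ ∂circleMeasure = (2 * Real.pi)⁻¹ • ∫ θ in (0 : ℝ)..2 * Real.pi, g θ := by
  rw [circleMeasure, integral_smul_measure, intervalIntegral.integral_of_le Real.two_pi_pos.le,
    ENNReal.toReal_ofReal (by positivity)]

theorem cauchy_integral_circleMeasure {f : ℂ → ℂ} {ρ : ℝ} (hρ : 0 < ρ)
    (hf : DiffContOnCl ℂ f (ball 0 ρ)) {w : ℂ} (hw : ‖w‖ < ρ) :
    ∫ θ, f (circleMap 0 ρ θ) * (circleMap 0 ρ θ / (circleMap 0 ρ θ - w)) ∂circleMeasure = f w := by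
  rw [integral_circleMeasure]
  have h := DiffContOnCl.circleAverage_smul_div (c := 0) (R := ρ) (w := w) (f := f)
    (by rwa [abs_of_pos hρ]) (by simpa [abs_of_pos hρ] using hw)
  rw [← h, Real.circleAverage_def]
  congr 2
  ext θ
  simp [mul_comm]

/-- Independent coordinates: redrawing one of them does not change the joint law. This isolates a
single angle, so that the polydisc formula follows from the disc by induction. -/
theorem measurePreserving_update {ι : Type*} [Fintype ι] [DecidableEq ι] (μ : Measure ℝ)
    [IsProbabilityMeasure μ] (a : ι) :
    MeasurePreserving (fun q : (ι → ℝ) × ℝ => Function.update q.1 a q.2)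
      ((Measure.pi fun _ : ι => μ).prod μ) (Measure.pi fun _ : ι => μ) := by
  have hm : Measurable fun q : (ι → ℝ) × ℝ => Function.update q.1 a q.2 := by
    refine measurable_pi_lambda _ fun i => ?_
    by_cases h : i = a
    · subst h; simpa using measurable_snd
    · simp only [Function.update_of_ne h]
      exact (measurable_pi_apply i).comp measurable_fst
  refine ⟨hm, (Measure.pi_eq fun s hs => ?_).symm⟩
  rw [Measure.map_apply hm (MeasurableSet.univ_pi hs)]
  have : (fun q : (ι → ℝ) × ℝ => Function.update q.1 a q.2) ⁻¹' Set.univ.pi s =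
      (Set.univ.pi (Function.update s a Set.univ)) ×ˢ s a := by
    ext ⟨x, y⟩
    simp only [Set.mem_preimage, Set.mem_pi, Set.mem_univ, true_implies, Set.mem_prod]
    constructor
    · intro h
      refine ⟨fun i => ?_, by simpa using h a⟩
      by_cases hi : i = a
      · subst hi; simp
      · simpa [hi] using h i
    · rintro ⟨h1, h2⟩ i
      by_cases hi : i = a
      · subst hi; simpa using h2
      · simpa [hi] using h1 i
  rw [this, Measure.prod_prod, Measure.pi_pi,
    ← Finset.mul_prod_erase _ _ (Finset.mem_univ a), ← Finset.mul_prod_erase Finset.univ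
      (fun i => μ (s i)) (Finset.mem_univ a)]
  simp only [Function.update_self, measure_univ, one_mul]
  rw [mul_comm]
  congr 1
  refine Finset.prod_congr rfl fun i hi => ?_
  rw [Function.update_of_ne (Finset.ne_of_mem_erase hi)]

/-- Cauchy's integral formula on a polydisc, for the variables in a given finite set. -/
theorem cauchy_formula_polydisc {ι : Type*} [Fintype ι] [DecidableEq ι] {f : (ι → ℂ) → ℂ}
    {U : Set (ι → ℂ)} {ρ M : ℝ} (hρ : 0 < ρ) (hf : CurveHolomorphicOn f U)
    (hU : closedBall 0 ρ ⊆ U) (hM : ∀ z ∈ closedBall (0 : ι → ℂ) ρ, ‖f z‖ ≤ M)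
    {z : ι → ℂ} (hz : ∀ i, ‖z i‖ < ρ) (s : Finset ι) :
    f z = ∫ θ : ι → ℝ, f (fun i => if i ∈ s then circleMap 0 ρ (θ i) else z i) *
      ∏ i ∈ s, (circleMap 0 ρ (θ i) / (circleMap 0 ρ (θ i) - z i))
      ∂(Measure.pi fun _ => circleMeasure) := by
  induction s using Finset.induction_on with
  | empty => simp
  | insert a s ha ih =>
    set Ψ : (ι → ℝ) → ℂ := fun θ =>
      f (fun i => if i ∈ insert a s then circleMap 0 ρ (θ i) else z i) *
        ∏ i ∈ insert a s, (circleMap 0 ρ (θ i) / (circleMap 0 ρ (θ i) - z i)) with hΨ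
    have hball : ∀ (t : Finset ι) (θ : ι → ℝ),
        (fun i => if i ∈ t then circleMap 0 ρ (θ i) else z i) ∈ closedBall (0 : ι → ℂ) ρ := by
      intro t θ
      rw [mem_closedBall_zero_iff, pi_norm_le_iff_of_nonneg hρ.le]
      intro i
      split_ifs
      · simp [abs_of_pos hρ]
      · exact (hz i).le
    have hne : ∀ i (φ : ℝ), circleMap 0 ρ φ - z i ≠ 0 := by
      intro i φ h
      have := hz i
      rw [← sub_eq_zero.1 h] at this
      simp [abs_of_pos hρ] at this
    have hΨc : Continuous Ψ := by
      refine Continuous.mul ?_ ?_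
      · refine hf.1.comp_continuous ?_ fun θ => hU (hball _ θ)
        refine continuous_pi fun i => ?_
        by_cases hi : i ∈ insert a s
        · simp only [hi, if_true]; exact (continuous_circleMap 0 ρ).comp (continuous_apply i)
        · simp only [hi, if_false]; exact continuous_const
      · refine continuous_finsetProd _ fun i _ => ?_
        have := (continuous_circleMap 0 ρ).comp (continuous_apply (A := fun _ : ι => ℝ) i)
        exact this.div (this.sub continuous_const) fun θ => hne i _
    have hΨb : ∀ θ, ‖Ψ θ‖ ≤ M * ∏ i ∈ insert a s, (ρ / (ρ - ‖z i‖)) := by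
      intro θ
      rw [hΨ, norm_mul, norm_prod]
      refine mul_le_mul (hM _ (hball _ θ)) ?_ (Finset.prod_nonneg fun _ _ => norm_nonneg _)
        ((norm_nonneg _).trans (hM _ (hball ∅ θ)))
      refine Finset.prod_le_prod (fun _ _ => norm_nonneg _) fun i _ => ?_
      have h1 : ‖circleMap 0 ρ (θ i)‖ = ρ := by simp [abs_of_pos hρ]
      rw [norm_div, h1]
      have := hz i
      refine div_le_div_of_nonneg_left hρ.le (by linarith) ?_
      have := norm_sub_norm_le (circleMap 0 ρ (θ i)) (z i)
      rwa [h1] at this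
    have hmp := measurePreserving_update (ι := ι) circleMeasure a
    have hint : Integrable (fun q : (ι → ℝ) × ℝ => Ψ (Function.update q.1 a q.2))
        ((Measure.pi fun _ : ι => circleMeasure).prod circleMeasure) := by
      refine Integrable.of_bound (C := M * ∏ i ∈ insert a s, (ρ / (ρ - ‖z i‖))) ?_
        (Eventually.of_forall fun q => hΨb _)
      exact (hΨc.measurable.comp hmp.measurable).aestronglyMeasurable
    have hΨint : ∫ θ, Ψ θ ∂(Measure.pi fun _ => circleMeasure) =
        ∫ θ, ∫ φ, Ψ (Function.update θ a φ) ∂circleMeasure ∂(Measure.pi fun _ => circleMeasure) := by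
      rw [← integral_prod _ hint]
      conv_lhs => rw [← hmp.map_eq]
      rw [integral_map hmp.measurable.aemeasurable hΨc.aestronglyMeasurable]
    rw [hΨint, ih]
    congr 1
    ext θ
    set y : ι → ℂ := fun i => if i ∈ s then circleMap 0 ρ (θ i) else z i with hy
    have hya : y a = z a := by simp [hy, ha]
    have hup : ∀ t : ℂ, ‖t‖ ≤ ρ → Function.update y a t ∈ closedBall (0 : ι → ℂ) ρ := by
      intro t ht
      rw [mem_closedBall_zero_iff, pi_norm_le_iff_of_nonneg hρ.le]
      intro i
      by_cases hi : i = a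
      · subst hi; simpa using ht
      · rw [Function.update_of_ne hi]
        exact (pi_norm_le_iff_of_nonneg hρ.le).1 (mem_closedBall_zero_iff.1 (hball s θ)) i
    have hdiffγ : Differentiable ℂ fun t : ℂ => Function.update y a t := by
      refine differentiable_pi.2 fun i => ?_
      by_cases hi : i = a
      · subst hi; simp
      · simp only [Function.update_of_ne hi]; exact differentiable_const _
    have hd : DiffContOnCl ℂ (fun t => f (Function.update y a t)) (ball 0 ρ) := by
      constructor
      · refine hf.2 _ _ isOpen_ball hdiffγ.differentiableOn fun t ht => hU (hup t ?_)
        exact (mem_ball_zero_iff.1 ht).le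
      · rw [closure_ball _ hρ.ne']
        exact hf.1.comp hdiffγ.continuous.continuousOn fun t ht =>
          hU (hup t (mem_closedBall_zero_iff.1 ht))
    -- The average over the fresh angle in coordinate `a` is the one-variable Cauchy formula on the
    -- slice through `y`.
    have hc := cauchy_integral_circleMeasure hρ hd (hz a)
    have hyz : Function.update y a (z a) = y := by rw [← hya]; exact Function.update_eq_self a y
    simp only [hyz] at hc
    rw [← hc, ← integral_mul_const]
    congr 1
    ext φ
    simp only [hΨ]
    rw [Finset.prod_insert ha, Function.update_self, ← mul_assoc]
    congr 1
    · congr 2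
      ext i
      by_cases hi : i = a
      · subst hi; simp
      · simp [hi, hy, Finset.mem_insert]
    · refine Finset.prod_congr rfl fun i hi => ?_
      rw [Function.update_of_ne (ne_of_mem_of_not_mem hi ha)]

/-- Power series expansion on a polydisc with Cauchy's estimates. -/
theorem exists_hasSum_of_curveHolomorphicOn {ι : Type*} [Fintype ι] {f : (ι → ℂ) → ℂ}
    {U : Set (ι → ℂ)} {ρ M : ℝ} (hρ : 0 < ρ) (hf : CurveHolomorphicOn f U)
    (hU : closedBall 0 ρ ⊆ U) (hM : ∀ z ∈ closedBall (0 : ι → ℂ) ρ, ‖f z‖ ≤ M) :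
    ∃ c : (ι → ℕ) → ℂ, (∀ α, ‖c α‖ ≤ M / ρ ^ weight α) ∧
      ∀ z : ι → ℂ, (∀ i, ‖z i‖ < ρ) → HasSum (fun α => c α * ∏ i, z i ^ α i) (f z) := by
  classical
  set μ : Measure (ι → ℝ) := Measure.pi fun _ => circleMeasure with hμ
  set w : (ι → ℝ) → ι → ℂ := fun θ i => circleMap 0 ρ (θ i) with hw
  have hwn : ∀ θ i, ‖w θ i‖ = ρ := fun θ i => by simp [hw, abs_of_pos hρ]
  have hw0 : ∀ θ i, w θ i ≠ 0 := fun θ i => norm_pos_iff.1 ((hwn θ i).symm ▸ hρ)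
  have hwc : Continuous w :=
    continuous_pi fun i => (continuous_circleMap 0 ρ).comp (continuous_apply i)
  have hwb : ∀ θ, w θ ∈ closedBall (0 : ι → ℂ) ρ := fun θ => by
    rw [mem_closedBall_zero_iff, pi_norm_le_iff_of_nonneg hρ.le]
    exact fun i => (hwn θ i).le
  have hfc : Continuous fun θ => f (w θ) := hf.1.comp_continuous hwc fun θ => hU (hwb θ)
  have hM0 : 0 ≤ M := (norm_nonneg _).trans (hM 0 (mem_closedBall_self hρ.le))
  -- The witness is Cauchy's coefficient integral over the distinguished boundary, where every
  -- coordinate has modulus `ρ`; the series arises by expanding the kernel geometrically and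
  -- integrating termwise.
  refine ⟨fun α => ∫ θ, f (w θ) * ∏ i, ((w θ i)⁻¹) ^ α i ∂μ, fun α => ?_, fun z hz => ?_⟩
  · refine (norm_integral_le_of_norm_le_const (C := M / ρ ^ weight α)
      (Eventually.of_forall fun θ => ?_)).trans (by simp)
    rw [norm_mul, norm_prod, div_eq_mul_inv]
    refine mul_le_mul (hM _ (hwb θ)) (le_of_eq ?_) (Finset.prod_nonneg fun _ _ => norm_nonneg _) hM0
    simp only [norm_pow, norm_inv, hwn]
    rw [Finset.prod_pow_eq_pow_sum, inv_pow, weight]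
  · have hr : ∀ θ i, ‖z i * (w θ i)⁻¹‖ < 1 := fun θ i => by
      rw [norm_mul, norm_inv, hwn, ← div_eq_mul_inv, div_lt_one hρ]; exact hz i
    have hr' : ∀ i, ‖z i‖ / ρ < 1 := fun i => (div_lt_one hρ).2 (hz i)
    have hk : ∀ θ, HasSum (fun α : ι → ℕ => ∏ i, (z i * (w θ i)⁻¹) ^ α i)
        (∏ i, (w θ i / (w θ i - z i))) := by
      intro θ
      have h1 := (hasSum_prod_pi (g := fun i n => (z i * (w θ i)⁻¹) ^ n)
        (fun i => by simpa only [norm_pow] using summable_geometric_of_lt_one (norm_nonneg _) (hr θ i))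
        fun i => hasSum_geometric_of_norm_lt_one (hr θ i)).2
      convert h1 using 2 with i
      have : w θ i - z i ≠ 0 := by
        intro h
        have h2 := hz i
        rw [← sub_eq_zero.1 h, hwn] at h2
        exact lt_irrefl _ h2
      have h0 := hw0 θ i
      rw [div_eq_iff this, inv_mul_eq_div, eq_div_iff]
      · field_simp
      · intro h
        apply this
        have : w θ i * (1 - z i * (w θ i)⁻¹) = w θ i - z i := by field_simp
        rw [← this, h, mul_zero]
    have hbound : ∀ (α : ι → ℕ) θ, ‖f (w θ) * ∏ i, (z i * (w θ i)⁻¹) ^ α i‖ ≤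
        M * ∏ i, (‖z i‖ / ρ) ^ α i := by
      intro α θ
      rw [norm_mul, norm_prod]
      refine mul_le_mul (hM _ (hwb θ)) (le_of_eq ?_)
        (Finset.prod_nonneg fun _ _ => norm_nonneg _) hM0
      simp only [norm_pow, norm_mul, norm_inv, hwn, div_eq_mul_inv]
    have hsumb : Summable fun α : ι → ℕ => M * ∏ i, (‖z i‖ / ρ) ^ α i := by
      have h1 := (hasSum_prod_pi (g := fun i n => ((‖z i‖ / ρ : ℝ) : ℂ) ^ n)
        (G := fun i => (1 - ((‖z i‖ / ρ : ℝ) : ℂ))⁻¹)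
        (fun i => by
          have := summable_geometric_of_lt_one (div_nonneg (norm_nonneg (z i)) hρ.le) (hr' i)
          simpa only [norm_pow, Complex.norm_real, Real.norm_of_nonneg
            (div_nonneg (norm_nonneg (z i)) hρ.le)] using this)
        fun i => hasSum_geometric_of_norm_lt_one (by
          rw [Complex.norm_real, Real.norm_of_nonneg (div_nonneg (norm_nonneg (z i)) hρ.le)]
          exact hr' i)).1
      refine Summable.mul_left _ ?_
      refine h1.congr fun α => ?_
      rw [norm_prod]
      refine Finset.prod_congr rfl fun i _ => ?_
      rw [norm_pow, Complex.norm_real, Real.norm_of_nonneg (div_nonneg (norm_nonneg (z i)) hρ.le)]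
    have hcont : ∀ α : ι → ℕ, Continuous fun θ => f (w θ) * ∏ i, (z i * (w θ i)⁻¹) ^ α i := by
      intro α
      refine hfc.mul (continuous_finsetProd _ fun i _ => ?_)
      exact (continuous_const.mul (((continuous_apply i).comp hwc).inv₀ fun θ => hw0 θ i)).pow _
    have hmain := hasSum_integral_of_summable_integral_norm (μ := μ)
      (F := fun (α : ι → ℕ) θ => f (w θ) * ∏ i, (z i * (w θ i)⁻¹) ^ α i)
      (fun α => Integrable.of_bound (hcont α).aestronglyMeasurable _
        (Eventually.of_forall (hbound α)))
      (by
        refine Summable.of_nonneg_of_le (fun α => integral_nonneg fun _ => norm_nonneg _)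
          (fun α => ?_) hsumb
        have := norm_integral_le_of_norm_le_const (μ := μ)
          (f := fun θ => ‖f (w θ) * ∏ i, (z i * (w θ i)⁻¹) ^ α i‖)
          (C := M * ∏ i, (‖z i‖ / ρ) ^ α i)
          (Eventually.of_forall fun θ => by rw [norm_norm]; exact hbound α θ)
        simpa using (le_abs_self _).trans this)
    have hval : ∫ θ, ∑' α : ι → ℕ, f (w θ) * ∏ i, (z i * (w θ i)⁻¹) ^ α i ∂μ = f z := by
      rw [cauchy_formula_polydisc hρ hf hU hM hz Finset.univ]
      congr 1
      ext θ
      rw [tsum_mul_left, (hk θ).tsum_eq]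
      simp [hw]
    rw [hval] at hmain
    refine Eq.mpr (congrArg (fun F => HasSum F (f z)) (funext fun α => ?_)) hmain
    rw [← integral_mul_const]
    congr 1
    ext θ
    simp only [mul_pow, Finset.prod_mul_distrib]
    ring

/-! ### Uniqueness of coefficients by restriction to lines. -/

/-- The homogeneous part of degree `n` of a multivariate power series. -/
def homogeneousPart {ι : Type*} [Fintype ι] [DecidableEq ι] (c : (ι → ℕ) → ℂ) (w : ι → ℂ)
    (n : ℕ) : ℂ :=
  ∑ α ∈ Finset.piAntidiag Finset.univ n, c α * ∏ i, w i ^ α i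

theorem hasSum_homogeneousPart {ι : Type*} [Fintype ι] [DecidableEq ι] {c : (ι → ℕ) → ℂ}
    {w : ι → ℂ} {t S : ℂ} (h : HasSum (fun α => c α * ∏ i, (t * w i) ^ α i) S) :
    HasSum (fun n => t ^ n * homogeneousPart c w n) S := by
  rw [← (Equiv.sigmaFiberEquiv (weight : (ι → ℕ) → ℕ)).hasSum_iff] at h
  refine h.sigma fun n => ?_
  have : t ^ n * homogeneousPart c w n =
      ∑ α ∈ Finset.piAntidiag Finset.univ n, c α * ∏ i, (t * w i) ^ α i := by
    rw [homogeneousPart, Finset.mul_sum]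
    refine Finset.sum_congr rfl fun α hα => ?_
    have h1 := (Finset.mem_piAntidiag.1 hα).1
    rw [← h1, ← Finset.prod_pow_eq_pow_sum]
    simp only [mul_pow, Finset.prod_mul_distrib]
    ring
  rw [this, ← Finset.sum_coe_sort]
  let e : {α : ι → ℕ // weight α = n} ≃ Finset.piAntidiag (Finset.univ : Finset ι) n :=
    Equiv.subtypeEquivRight fun α => by simp [weight]
  have h2 := hasSum_fintype fun α : Finset.piAntidiag (Finset.univ : Finset ι) n =>
    c α * ∏ i, (t * w i) ^ (α : ι → ℕ) i
  rw [← e.hasSum_iff] at h2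
  exact h2

theorem hasFPowerSeriesAt_line {ι : Type*} [Fintype ι] [DecidableEq ι] {c : (ι → ℕ) → ℂ}
    {f : (ι → ℂ) → ℂ} {ε : ℝ} (hε : 0 < ε)
    (h : ∀ z : ι → ℂ, (∀ i, ‖z i‖ < ε) → HasSum (fun α => c α * ∏ i, z i ^ α i) (f z))
    (w : ι → ℂ) :
    HasFPowerSeriesAt (fun t : ℂ => f (t • w))
      (FormalMultilinearSeries.ofScalars ℂ (homogeneousPart c w)) 0 := by
  rw [hasFPowerSeriesAt_iff]
  have hc : ∀ i, ∀ᶠ t : ℂ in 𝓝 0, ‖t * w i‖ < ε := fun i => by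
    have : Tendsto (fun t : ℂ => ‖t * w i‖) (𝓝 0) (𝓝 0) := by
      have : Continuous fun t : ℂ => ‖t * w i‖ := by fun_prop
      simpa using this.tendsto 0
    exact this.eventually (gt_mem_nhds hε)
  filter_upwards [eventually_all.2 hc] with t ht
  have := hasSum_homogeneousPart (h (fun i => t * w i) ht)
  simp only [FormalMultilinearSeries.coeff_ofScalars, smul_eq_mul, zero_add]
  exact this

/-- Uniqueness of the coefficients of a multivariate power series. -/
theorem coeff_unique {ι : Type*} [Fintype ι] {c c' : (ι → ℕ) → ℂ}
    {f : (ι → ℂ) → ℂ} {ε : ℝ} (hε : 0 < ε)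
    (h : ∀ z : ι → ℂ, (∀ i, ‖z i‖ < ε) → HasSum (fun α => c α * ∏ i, z i ^ α i) (f z))
    (h' : ∀ z : ι → ℂ, (∀ i, ‖z i‖ < ε) → HasSum (fun α => c' α * ∏ i, z i ^ α i) (f z)) :
    c = c' := by
  classical
  have hQ : ∀ w n, homogeneousPart c w n = homogeneousPart c' w n := fun w n => by
    have := (hasFPowerSeriesAt_line hε h w).eq_formalMultilinearSeries
      (hasFPowerSeriesAt_line hε h' w)
    simpa only [FormalMultilinearSeries.coeff_ofScalars] using
      congrArg (fun p : FormalMultilinearSeries ℂ ℂ ℂ => p.coeff n) this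
  ext α
  -- One-variable uniqueness on each line makes the homogeneous parts agree at every point; a
  -- polynomial vanishing everywhere on an infinite field has zero coefficients.
  set P : MvPolynomial ι ℂ := ∑ β ∈ Finset.piAntidiag Finset.univ (weight α),
    MvPolynomial.monomial (Finsupp.equivFunOnFinite.symm β) (c β - c' β) with hP
  have hP0 : P = 0 := by
    refine MvPolynomial.funext fun w => ?_
    have := hQ w (weight α)
    rw [← sub_eq_zero, homogeneousPart, homogeneousPart, ← Finset.sum_sub_distrib] at this
    rw [hP, map_sum, map_zero, ← this]
    refine Finset.sum_congr rfl fun β _ => ?_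
    rw [MvPolynomial.eval_monomial, Finsupp.prod_fintype _ _ fun i => pow_zero _]
    simp [sub_mul]
  have h1 := congrArg (MvPolynomial.coeff (Finsupp.equivFunOnFinite.symm α)) hP0
  rw [hP, MvPolynomial.coeff_sum, MvPolynomial.coeff_zero,
    Finset.sum_eq_single_of_mem α (by simp [weight])] at h1
  · rw [MvPolynomial.coeff_monomial, if_pos rfl] at h1
    exact sub_eq_zero.1 h1
  · intro β _ hβ
    rw [MvPolynomial.coeff_monomial, if_neg]
    exact fun h => hβ (Finsupp.equivFunOnFinite.symm.injective h)

theorem homogeneousPart_one {ι : Type*} [Fintype ι] [DecidableEq ι] (c : (ι → ℕ) → ℂ)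
    (w : ι → ℂ) : homogeneousPart c w 1 = ∑ i, c (Pi.single i 1) * w i := by
  have : Finset.piAntidiag (Finset.univ : Finset ι) 1 =
      Finset.univ.image fun i : ι => (Pi.single i 1 : ι → ℕ) := by
    ext α
    simp only [Finset.mem_piAntidiag, Finset.mem_univ, implies_true, and_true, Finset.mem_image,
      true_and]
    constructor
    · intro h
      replace h : ∑ i, α i = 1 := h
      obtain ⟨i, -, hi⟩ : ∃ i ∈ Finset.univ, α i ≠ 0 := by
        by_contra hcon
        push Not at hcon
        rw [Finset.sum_eq_zero hcon] at h
        exact zero_ne_one h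
      refine ⟨i, funext fun j => ?_⟩
      have hs := Finset.add_sum_erase Finset.univ α (Finset.mem_univ i)
      by_cases hj : j = i
      · subst hj; simp; omega
      · have := Finset.single_le_sum (f := α) (fun _ _ => Nat.zero_le _)
          (Finset.mem_erase.2 ⟨hj, Finset.mem_univ j⟩)
        simp [hj]; omega
    · rintro ⟨i, rfl⟩
      simp
  rw [homogeneousPart, this, Finset.sum_image fun i _ j _ h => ?_]
  · refine Finset.sum_congr rfl fun i _ => ?_
    congr 1
    rw [Finset.prod_eq_single i] <;> simp +contextual
  · by_contra hij
    have := congrFun h i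
    simp [hij] at this

theorem hasDerivAt_line {ι : Type*} [Fintype ι] [DecidableEq ι] {c : (ι → ℕ) → ℂ}
    {f : (ι → ℂ) → ℂ} {ε : ℝ} (hε : 0 < ε)
    (h : ∀ z : ι → ℂ, (∀ i, ‖z i‖ < ε) → HasSum (fun α => c α * ∏ i, z i ^ α i) (f z))
    (w : ι → ℂ) :
    HasDerivAt (fun t : ℂ => f (t • w)) (∑ i, c (Pi.single i 1) * w i) 0 := by
  have := (hasFPowerSeriesAt_line hε h w).hasDerivAt
  rw [← homogeneousPart_one]
  have e := FormalMultilinearSeries.coeff_ofScalars (𝕜 := ℂ) (p := homogeneousPart c w) (n := 1)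
  rw [← e]
  exact this

/-! ### Closure properties of curve holomorphy. -/

theorem CurveHolomorphicOn.comp {ι κ : Type*} {f : (ι → ℂ) → ℂ} {U : Set (ι → ℂ)}
    {g : (κ → ℂ) → ι → ℂ} {V : Set (κ → ℂ)} [Fintype κ] [Fintype ι] (hf : CurveHolomorphicOn f U)
    (hg : DifferentiableOn ℂ g V) (hm : Set.MapsTo g V U) :
    CurveHolomorphicOn (fun z => f (g z)) V :=
  ⟨hf.1.comp hg.continuousOn hm, fun γ W hW hγ hγm =>
    hf.2 (fun t => g (γ t)) W hW (hg.comp hγ hγm) fun _ ht => hm (hγm ht)⟩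

theorem CurveHolomorphicOn.of_differentiableOn {ι : Type*} [Fintype ι] {f : (ι → ℂ) → ℂ}
    {U : Set (ι → ℂ)} (hf : DifferentiableOn ℂ f U) : CurveHolomorphicOn f U :=
  ⟨hf.continuousOn, fun _ _ _ hγ hm => hf.comp hγ hm⟩

theorem CurveHolomorphicOn.sub {ι : Type*} {f g : (ι → ℂ) → ℂ} {U : Set (ι → ℂ)}
    (hf : CurveHolomorphicOn f U) (hg : CurveHolomorphicOn g U) :
    CurveHolomorphicOn (fun z => f z - g z) U :=
  ⟨hf.1.sub hg.1, fun γ V hV hγ hm => (hf.2 γ V hV hγ hm).sub (hg.2 γ V hV hγ hm)⟩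

theorem CurveHolomorphicOn.add {ι : Type*} {f g : (ι → ℂ) → ℂ} {U : Set (ι → ℂ)}
    (hf : CurveHolomorphicOn f U) (hg : CurveHolomorphicOn g U) :
    CurveHolomorphicOn (fun z => f z + g z) U :=
  ⟨hf.1.add hg.1, fun γ V hV hγ hm => (hf.2 γ V hV hγ hm).add (hg.2 γ V hV hγ hm)⟩

theorem CurveHolomorphicOn.mul {ι : Type*} {f g : (ι → ℂ) → ℂ} {U : Set (ι → ℂ)}
    (hf : CurveHolomorphicOn f U) (hg : CurveHolomorphicOn g U) :
    CurveHolomorphicOn (fun z => f z * g z) U :=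
  ⟨hf.1.mul hg.1, fun γ V hV hγ hm => (hf.2 γ V hV hγ hm).mul (hg.2 γ V hV hγ hm)⟩

theorem CurveHolomorphicOn.sum {ι κ : Type*} {s : Finset κ} {f : κ → (ι → ℂ) → ℂ}
    {U : Set (ι → ℂ)} (hf : ∀ j ∈ s, CurveHolomorphicOn (f j) U) :
    CurveHolomorphicOn (fun z => ∑ j ∈ s, f j z) U :=
  ⟨continuousOn_finsetSum _ fun j hj => (hf j hj).1, fun γ V hV hγ hm =>
    DifferentiableOn.fun_sum fun j hj => (hf j hj).2 γ V hV hγ hm⟩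

theorem CurveHolomorphicOn.postcomp {ι : Type*} {f : (ι → ℂ) → ℂ} {φ : ℂ → ℂ}
    {U : Set (ι → ℂ)} {W : Set ℂ} (hf : CurveHolomorphicOn f U) (hφ : DifferentiableOn ℂ φ W)
    (hm : Set.MapsTo f U W) : CurveHolomorphicOn (fun z => φ (f z)) U :=
  ⟨hφ.continuousOn.comp hf.1 hm, fun γ V hV hγ hγm =>
    hφ.comp (hf.2 γ V hV hγ hγm) fun _ ht => hm (hγm ht)⟩

theorem CurveHolomorphicOn.mono {ι : Type*} {f : (ι → ℂ) → ℂ} {U V : Set (ι → ℂ)}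
    (hf : CurveHolomorphicOn f U) (h : V ⊆ U) : CurveHolomorphicOn f V :=
  ⟨hf.1.mono h, fun γ W hW hγ hm => hf.2 γ W hW hγ fun _ ht => h (hm ht)⟩

theorem CurveHolomorphicOn.tsum {ι κ : Type*} {f : κ → (ι → ℂ) → ℂ} {U : Set (ι → ℂ)}
    {u : κ → ℝ} (hu : Summable u) (hf : ∀ j, CurveHolomorphicOn (f j) U)
    (hb : ∀ j, ∀ z ∈ U, ‖f j z‖ ≤ u j) : CurveHolomorphicOn (fun z => ∑' j, f j z) U :=
  ⟨continuousOn_tsum (fun j => (hf j).1) hu hb, fun γ V hV hγ hm =>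
    Complex.differentiableOn_tsum_of_summable_norm hu (fun j => (hf j).2 γ V hV hγ hm) hV
      fun j _ ht => hb j _ (hm ht)⟩

/-! ### Coefficient bounds on ℓ¹-balls by projecting onto few variables. -/

/-- The coordinate projection onto the variables in `S`. -/
def coordProj {ι : Type*} [DecidableEq ι] (S : Finset ι) (z : ι → ℂ) : ι → ℂ :=
  fun i => if i ∈ S then z i else 0

theorem differentiable_coordProj {ι : Type*} [DecidableEq ι] [Fintype ι] (S : Finset ι) :
    Differentiable ℂ (coordProj S) := by
  refine differentiable_pi.2 fun i => ?_
  by_cases hi : i ∈ S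
  · simpa [coordProj, hi] using differentiable_apply (𝕜 := ℂ) (F' := fun _ : ι => ℂ) i
  · simp [coordProj, hi]

theorem single_coordProj {ι : Type*} [DecidableEq ι] (S : Finset ι) (z : ι → ℂ) (j : ι) :
    (Pi.single j (coordProj S z j) : ι → ℂ) = coordProj (S ∩ {j}) z := by
  ext i
  by_cases hi : i = j
  · subst hi; simp [coordProj]
  · simp [coordProj, hi]

/-- Setting the variables outside `S` to zero deletes exactly the monomials that involve one of
them. -/
theorem hasSum_coordProj {ι : Type*} [DecidableEq ι] [Fintype ι] {c : (ι → ℕ) → ℂ}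
    {f : (ι → ℂ) → ℂ} {ε : ℝ} (hε : 0 < ε)
    (h : ∀ z : ι → ℂ, (∀ i, ‖z i‖ < ε) → HasSum (fun α => c α * ∏ i, z i ^ α i) (f z))
    (S : Finset ι) (z : ι → ℂ) (hz : ∀ i, ‖z i‖ < ε) :
    HasSum (fun α : ι → ℕ => (if ∀ i ∉ S, α i = 0 then c α else 0) * ∏ i, z i ^ α i)
      (f (coordProj S z)) := by
  have h1 := h (coordProj S z) fun i => by
    by_cases hi : i ∈ S <;> simp [coordProj, hi, hz, hε]
  refine Eq.mpr (congrArg (fun F => HasSum F (f (coordProj S z))) (funext fun α => ?_)) h1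
  split_ifs with hα
  · congr 1
    refine Finset.prod_congr rfl fun i _ => ?_
    by_cases hi : i ∈ S
    · simp [coordProj, hi]
    · simp [hα i hi]
  · push Not at hα
    obtain ⟨i, hi, hαi⟩ := hα
    rw [Finset.prod_eq_zero (f := fun i => coordProj S z i ^ α i) (Finset.mem_univ i), mul_zero,
      zero_mul]
    simp [coordProj, hi, hαi]

theorem sum_norm_coordProj_le {ι : Type*} [DecidableEq ι] [Fintype ι] (S : Finset ι) {z : ι → ℂ}
    {ρ : ℝ} (hz : ∀ i, ‖z i‖ ≤ ρ) : ∑ i, ‖coordProj S z i‖ ≤ S.card * ρ := by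
  have : ∑ i, ‖coordProj S z i‖ = ∑ i ∈ S, ‖z i‖ := by
    rw [← Finset.sum_filter_add_sum_filter_not Finset.univ (· ∈ S)]
    rw [Finset.sum_eq_zero (s := Finset.univ.filter (· ∉ S)) fun i hi => by
      simp [coordProj, (Finset.mem_filter.1 hi).2], add_zero, Finset.filter_mem_eq_inter,
      Finset.univ_inter]
    exact Finset.sum_congr rfl fun i hi => by simp [coordProj, hi]
  rw [this, ← nsmul_eq_mul]
  exact Finset.sum_le_card_nsmul _ _ _ fun i _ => hz i

theorem closedBall_subset_of_card_mul_lt {ι : Type*} [Fintype ι] {ρ δ : ℝ} (hρ : 0 ≤ ρ)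
    (h : Fintype.card ι * ρ < δ) : closedBall (0 : ι → ℂ) ρ ⊆ {z | ∑ s, ‖z s‖ < δ} := by
  intro z hz
  rw [mem_closedBall_zero_iff, pi_norm_le_iff_of_nonneg hρ] at hz
  refine lt_of_le_of_lt ?_ h
  have := Finset.sum_le_card_nsmul Finset.univ (fun i => ‖z i‖) ρ fun i _ => hz i
  simpa using this

/-- A curve-holomorphic bounded function near the origin has a power series expansion. -/
theorem exists_hasSum_near_zero {ι : Type*} [Fintype ι] {f : (ι → ℂ) → ℂ} {δ M : ℝ} (hδ : 0 < δ)
    (hf : CurveHolomorphicOn f {z | ∑ s, ‖z s‖ < δ})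
    (hM : ∀ z : ι → ℂ, ∑ s, ‖z s‖ < δ → ‖f z‖ ≤ M) :
    ∃ (c : (ι → ℕ) → ℂ) (ε : ℝ), 0 < ε ∧
      ∀ z : ι → ℂ, (∀ i, ‖z i‖ < ε) → HasSum (fun α => c α * ∏ i, z i ^ α i) (f z) := by
  set ρ := δ / (Fintype.card ι + 1) with hρ
  have hpos : (0 : ℝ) < Fintype.card ι + 1 := by positivity
  have hρ0 : 0 < ρ := div_pos hδ hpos
  have hsub : closedBall (0 : ι → ℂ) ρ ⊆ {z | ∑ s, ‖z s‖ < δ} := by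
    refine closedBall_subset_of_card_mul_lt hρ0.le ?_
    have : (Fintype.card ι + 1) * ρ = δ := by rw [hρ]; field_simp
    nlinarith
  obtain ⟨c, -, hc⟩ := exists_hasSum_of_curveHolomorphicOn hρ0 hf hsub fun z hz => hM z (hsub hz)
  exact ⟨c, ρ, hρ0, hc⟩

/-- Bounds for the coefficients of a function in terms of its size and of its deviation from a sum
of functions of one variable. -/
theorem exists_coeff_bounds {ι : Type*} [Fintype ι] [DecidableEq ι] {f : (ι → ℂ) → ℂ}
    {δ M₁ M₂ : ℝ} (hδ : 0 < δ) (hf : CurveHolomorphicOn f {z | ∑ s, ‖z s‖ < δ})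
    (h₁ : ∀ z : ι → ℂ, ∑ s, ‖z s‖ < δ → ‖f z‖ ≤ M₁)
    (h₂ : ∀ z : ι → ℂ, ∑ s, ‖z s‖ < δ → ‖f z - ∑ j, f (Pi.single j (z j))‖ ≤ M₂) :
    ∃ a : (ι → ℕ) → ℂ,
      (∃ ε : ℝ, 0 < ε ∧
        ∀ z : ι → ℂ, (∀ i, ‖z i‖ < ε) → HasSum (fun α => a α * ∏ i, z i ^ α i) (f z)) ∧
      (∀ α, numNonzero α = 1 → ‖a α‖ ≤ M₁ * (2 / δ) ^ weight α) ∧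
      ∀ α, 1 < numNonzero α → ‖a α‖ ≤ M₂ * (2 * numNonzero α / δ) ^ weight α := by
  obtain ⟨a, ε, hε, ha⟩ := exists_hasSum_near_zero hδ hf h₁
  have key : ∀ (S : Finset ι) (α : ι → ℕ) (F : (ι → ℂ) → ℂ) (M : ℝ) (b : (ι → ℕ) → ℂ),
      0 < S.card → CurveHolomorphicOn F {z | ∑ s, ‖coordProj S z s‖ < δ} →
      (∀ z, ∑ s, ‖coordProj S z s‖ < δ → ‖F z‖ ≤ M) →
      (∀ z : ι → ℂ, (∀ i, ‖z i‖ < ε) → HasSum (fun α => b α * ∏ i, z i ^ α i) (F z)) →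
      ‖b α‖ ≤ M * (2 * S.card / δ) ^ weight α := by
    intro S α F M b hS hF hM hb
    have hS' : (0 : ℝ) < S.card := by exact_mod_cast hS
    -- Only the coordinates in `S` count in the ℓ¹-norm after projection, so the radius depends on
    -- the size of `S` and not on the number of all variables; the factor 2 makes the inclusion
    -- strict.
    set ρ := δ / (2 * S.card) with hρ
    have hρ0 : 0 < ρ := by positivity
    have hsub : closedBall (0 : ι → ℂ) ρ ⊆ {z | ∑ s, ‖coordProj S z s‖ < δ} := by
      intro z hz
      rw [mem_closedBall_zero_iff, pi_norm_le_iff_of_nonneg hρ0.le] at hz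
      refine lt_of_le_of_lt (sum_norm_coordProj_le S hz) ?_
      have : S.card * ρ = δ / 2 := by rw [hρ]; field_simp
      rw [this]; linarith
    obtain ⟨c, hc, hcs⟩ := exists_hasSum_of_curveHolomorphicOn hρ0 hF hsub
      fun z hz => hM z (hsub hz)
    have : b = c := coeff_unique (lt_min hε hρ0)
      (fun z hz => hb z fun i => (hz i).trans_le (min_le_left _ _))
      (fun z hz => hcs z fun i => (hz i).trans_le (min_le_right _ _))
    rw [this]
    refine (hc α).trans_eq ?_
    rw [hρ, div_eq_mul_inv, ← inv_pow, inv_div]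
  have hproj : ∀ S : Finset ι, CurveHolomorphicOn (fun z => f (coordProj S z))
      {z | ∑ s, ‖coordProj S z s‖ < δ} := fun S =>
    hf.comp (differentiable_coordProj S).differentiableOn fun z hz => hz
  refine ⟨a, ⟨ε, hε, ha⟩, fun α hα => ?_, fun α hα => ?_⟩
  · set S := Finset.univ.filter fun i => α i ≠ 0 with hS
    have hcard : S.card = 1 := hα
    have := key S α _ M₁ _ (by omega) (hproj S) (fun z hz => h₁ _ hz) (hasSum_coordProj hε ha S)
    rw [if_pos fun i hi => by simpa [hS] using hi, hcard] at this
    simpa using this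
  · set S := Finset.univ.filter fun i => α i ≠ 0 with hS
    have hcard : 1 < S.card := hα
    -- Each subtracted function depends on at most one variable, while `α` has at least two nonzero
    -- entries; the coefficient at `α` is therefore unchanged and inherits the bound for the mixed
    -- part.
    have := key S α (fun z => f (coordProj S z) - ∑ j, f (coordProj (S ∩ {j}) z)) M₂
      (fun β => (if ∀ i ∉ S, β i = 0 then a β else 0) -
        ∑ j, (if ∀ i ∉ S ∩ {j}, β i = 0 then a β else 0)) (by omega) ?_ ?_ ?_
    · rw [if_pos fun i hi => by simpa [hS] using hi, Finset.sum_eq_zero, sub_zero] at this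
      · exact this
      · intro j _
        rw [if_neg]
        intro hcon
        have : S ⊆ {j} := fun i hi => by
          by_contra hij
          exact (Finset.mem_filter.1 hi).2 (hcon i fun h => hij (Finset.mem_inter.1 h).2)
        have := Finset.card_le_card this
        simp at this
        omega
    · refine (hproj S).sub (CurveHolomorphicOn.sum fun j _ => (hproj _).mono fun z hz => ?_)
      replace hz : ∑ s, ‖coordProj S z s‖ < δ := hz
      refine lt_of_le_of_lt (Finset.sum_le_sum (g := fun i => ‖coordProj S z i‖) fun i _ => ?_) hz
      by_cases h1 : i ∈ S <;> by_cases h2 : i = j <;> simp [coordProj, h1, h2]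
    · intro z hz
      have := h₂ _ hz
      simpa only [single_coordProj] using this
    · intro z hz
      have := (hasSum_coordProj hε ha S z hz).sub
        (hasSum_sum fun j (_ : j ∈ Finset.univ) => hasSum_coordProj hε ha (S ∩ {j}) z hz)
      simpa only [sub_mul, Finset.sum_mul] using this

/-! ### Schwarz's lemma for the mixed part. -/

/-- Schwarz's lemma to first and second order on a ball of the `ℓ¹`-norm. -/
theorem schwarz_mixed {ι : Type*} [Fintype ι] [DecidableEq ι] {G : (ι → ℂ) → ℂ} {R M : ℝ}
    (hG : CurveHolomorphicOn G {z | ∑ s, ‖z s‖ < R})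
    (hM : ∀ z : ι → ℂ, ∑ s, ‖z s‖ < R → ‖G z - G 0‖ ≤ M) {z : ι → ℂ} (hz : ∑ s, ‖z s‖ < R) :
    ‖G z - G 0‖ ≤ M * ((∑ s, ‖z s‖) / R) ∧
      ‖(G z - G 0) - ∑ j, (G (Pi.single j (z j)) - G 0)‖ ≤ 4 * M * ((∑ s, ‖z s‖) / R) ^ 2 := by
  have hR : 0 < R := (Finset.sum_nonneg fun _ _ => norm_nonneg _).trans_lt hz
  have h0 : ∑ s : ι, ‖(0 : ι → ℂ) s‖ < R := by simpa using hR
  have hM0 : 0 ≤ M := (norm_nonneg _).trans (hM 0 h0)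
  obtain ⟨c, ε, hε, hc⟩ := exists_hasSum_near_zero hR hG (M := M + ‖G 0‖) fun z hz => by
    have := norm_le_norm_add_norm_sub' (G z) (G 0)
    linarith [hM z hz]
  -- Apply the one-variable Schwarz lemma to `G (t • y)` on the disc of radius R/σ. The linear term
  -- is at most `M` there by Cauchy's estimate, so removing it leaves a function bounded by `2 * M`
  -- with a double zero.
  have key : ∀ y : ι → ℂ, ∑ s, ‖y s‖ < R → ‖G y - G 0‖ ≤ M * ((∑ s, ‖y s‖) / R) ∧
      ‖G y - G 0 - ∑ i, c (Pi.single i 1) * y i‖ ≤ 2 * M * ((∑ s, ‖y s‖) / R) ^ 2 := by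
    intro y hy
    set σ := ∑ s, ‖y s‖ with hσ
    have hσ0 : 0 ≤ σ := Finset.sum_nonneg fun _ _ => norm_nonneg _
    rcases hσ0.eq_or_lt with h | hσpos
    · have hy0 : y = 0 := by
        ext i
        have := (Finset.sum_eq_zero_iff_of_nonneg fun s _ => norm_nonneg (y s)).1 h.symm i
          (Finset.mem_univ i)
        simpa using this
      subst hy0
      simp [← h]
    have hsum : ∀ t : ℂ, ∑ s, ‖(t • y) s‖ = ‖t‖ * σ := fun t => by
      simp [hσ, Finset.mul_sum]
    have hmem : ∀ t ∈ ball (0 : ℂ) (R / σ), ∑ s, ‖(t • y) s‖ < R := fun t ht => by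
      rw [hsum]
      rwa [mem_ball_zero_iff, lt_div_iff₀ hσpos] at ht
    have hd : DifferentiableOn ℂ (fun t : ℂ => G (t • y)) (ball 0 (R / σ)) := by
      refine hG.2 (fun t => t • y) _ isOpen_ball ?_ hmem
      exact (differentiable_id.smul_const y).differentiableOn
    have hone : (1 : ℂ) ∈ ball (0 : ℂ) (R / σ) := by
      simp [lt_div_iff₀ hσpos, hy]
    have hmaps : Set.MapsTo (fun t : ℂ => G (t • y)) (ball 0 (R / σ))
        (closedBall (G ((0 : ℂ) • y)) M) := fun t ht => by
      rw [mem_closedBall, dist_eq_norm, zero_smul]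
      exact hM _ (hmem t ht)
    have hder := hasDerivAt_line hε hc y
    set ℓ := ∑ i, c (Pi.single i 1) * y i with hℓ
    have hinv : 1 / (R / σ) = σ / R := by rw [one_div_div]
    have hℓb : ‖ℓ‖ ≤ M / (R / σ) := by
      rw [← hder.deriv]
      exact Complex.norm_deriv_le_div_of_mapsTo_ball hd hmaps (by positivity)
    constructor
    · have := Complex.dist_le_div_mul_dist_of_mapsTo_ball hd hmaps hone
      rw [dist_eq_norm, dist_eq_norm, zero_smul, one_smul] at this
      refine this.trans_eq ?_
      simp only [sub_zero, norm_one, mul_one]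
      rw [div_div_eq_mul_div, mul_div_assoc]
    · have hd2 : DifferentiableOn ℂ (fun t : ℂ => G (t • y) - t * ℓ) (ball 0 (R / σ)) :=
        hd.sub (differentiable_id.mul_const ℓ).differentiableOn
      have hmaps2 : Set.MapsTo (fun t : ℂ => G (t • y) - t * ℓ) (ball 0 (R / σ))
          (closedBall (G ((0 : ℂ) • y) - 0 * ℓ) (2 * M)) := fun t ht => by
        have h1 := hmaps ht
        rw [mem_closedBall, dist_eq_norm] at h1 ⊢
        have h2 : ‖t * ℓ‖ ≤ M := by
          rw [norm_mul]
          calc ‖t‖ * ‖ℓ‖ ≤ R / σ * (M / (R / σ)) :=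
                mul_le_mul (mem_ball_zero_iff.1 ht).le hℓb (norm_nonneg _) (by positivity)
            _ = M := by field_simp
        calc ‖G (t • y) - t * ℓ - (G ((0 : ℂ) • y) - 0 * ℓ)‖
            = ‖(G (t • y) - G ((0 : ℂ) • y)) - t * ℓ‖ := by congr 1; ring
          _ ≤ _ := (norm_sub_le _ _).trans (by linarith)
      have hlo := hder.isLittleO
      have := Complex.dist_le_mul_div_pow_of_mapsTo_ball_of_isLittleO (n := 1) hd2 hmaps2
        (by
          refine ((hlo.congr' (Eventually.of_forall fun t => ?_)
            (EventuallyEq.refl _ _)).trans_isBigO ?_)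
          · simp only [sub_zero, smul_eq_mul]; ring
          · simpa using (Asymptotics.isBigO_refl (fun t : ℂ => t) (𝓝 0)).norm_right) hone
      rw [dist_eq_norm, dist_eq_norm] at this
      simp only [one_smul, zero_smul, one_mul, zero_mul, sub_zero, norm_one, hinv] at this
      calc ‖G y - G 0 - ℓ‖ = ‖G y - ℓ - G 0‖ := by congr 1; ring
        _ ≤ _ := this
  refine ⟨(key z hz).1, ?_⟩
  have hsing : ∀ j, ∑ s, ‖(Pi.single j (z j) : ι → ℂ) s‖ = ‖z j‖ := fun j => by
    rw [Finset.sum_eq_single j] <;> simp +contextual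
  have hlin : ∀ j, ∑ i, c (Pi.single i 1) * (Pi.single j (z j) : ι → ℂ) i =
      c (Pi.single j 1) * z j := fun j => by
    rw [Finset.sum_eq_single j] <;> simp +contextual
  -- Linear parts are sums of one-variable functions, so they cancel and only second-order
  -- remainders survive. Their sum is controlled by ∑|z_j|² ≤ (∑|z_j|)², which gives 2M + 2M with no
  -- dimension factor.
  have hsplit : (G z - G 0) - ∑ j, (G (Pi.single j (z j)) - G 0) =
      (G z - G 0 - ∑ i, c (Pi.single i 1) * z i) -
        ∑ j, (G (Pi.single j (z j)) - G 0 -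
          ∑ i, c (Pi.single i 1) * (Pi.single j (z j) : ι → ℂ) i) := by
    simp only [hlin]
    rw [Finset.sum_sub_distrib (f := fun j => G (Pi.single j (z j)) - G 0)]
    ring
  rw [hsplit]
  refine (norm_sub_le _ _).trans ?_
  have hsq : ∑ j, ‖z j‖ ^ 2 ≤ (∑ j, ‖z j‖) ^ 2 :=
    Finset.sum_sq_le_sq_sum_of_nonneg fun _ _ => norm_nonneg _
  have h2 : ‖∑ j, (G (Pi.single j (z j)) - G 0 -
      ∑ i, c (Pi.single i 1) * (Pi.single j (z j) : ι → ℂ) i)‖ ≤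
      2 * M * ((∑ s, ‖z s‖) / R) ^ 2 := by
    calc _ ≤ ∑ j, 2 * M * (‖z j‖ / R) ^ 2 := by
          refine norm_sum_le_of_le _ fun j _ => ?_
          have := (key (Pi.single j (z j)) (by
            rw [hsing]
            exact (Finset.single_le_sum (f := fun s => ‖z s‖) (fun _ _ => norm_nonneg _)
              (Finset.mem_univ j)).trans_lt hz)).2
          rwa [hsing] at this
      _ = 2 * M * ((∑ j, ‖z j‖ ^ 2) / R ^ 2) := by
          rw [← Finset.mul_sum, Finset.sum_div]
          simp only [div_pow]
      _ ≤ _ := by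
          rw [div_pow]
          gcongr
  linarith [(key z hz).2]

/-! ### Fourier series on the circle and differentiation under the integral. -/

/-- The point of the unit circle with angle `2πθ`. -/
def circ (θ : ℝ) : ℂ := Complex.exp (2 * Real.pi * Complex.I * θ)

theorem norm_circ (θ : ℝ) : ‖circ θ‖ = 1 := by
  rw [circ, show (2 * Real.pi * Complex.I * θ : ℂ) = ((2 * Real.pi * θ : ℝ) : ℂ) * Complex.I by
    push_cast; ring]
  exact Complex.norm_exp_ofReal_mul_I _

theorem continuous_circ : Continuous circ := by unfold circ; fun_prop

theorem circ_neg (θ : ℝ) : circ (-θ) = Complex.exp (-(2 * Real.pi * Complex.I * θ)) := by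
  simp [circ]

theorem conj_circ (θ : ℝ) : (starRingEnd ℂ) (circ θ) = circ (-θ) := by
  rw [circ, circ, ← Complex.exp_conj]
  simp [Complex.conj_ofNat]

theorem integral_circ_pow_mul (n m : ℕ) :
    ∫ θ in (0 : ℝ)..1, circ θ ^ n * circ (-θ) ^ m = if n = m then 1 else 0 := by
  have h1 : ∀ θ : ℝ, circ θ ^ n * circ (-θ) ^ m =
      Complex.exp ((2 * Real.pi * Complex.I * ((n : ℂ) - m)) * θ) := by
    intro θ
    rw [circ, circ_neg, ← Complex.exp_nat_mul, ← Complex.exp_nat_mul, ← Complex.exp_add]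
    congr 1
    ring
  simp only [h1]
  split_ifs with h
  · simp [h]
  · have hne : (2 * Real.pi * Complex.I * ((n : ℂ) - m)) ≠ 0 := by
      have : (n : ℂ) - m ≠ 0 := sub_ne_zero.2 (by exact_mod_cast h)
      exact mul_ne_zero Complex.two_pi_I_ne_zero this
    rw [integral_exp_mul_complex hne]
    have : Complex.exp (2 * Real.pi * Complex.I * ((n : ℂ) - m) * (1 : ℝ)) = 1 := by
      rw [Complex.exp_eq_one_iff]
      exact ⟨(n : ℤ) - m, by push_cast; ring⟩
    rw [this]
    simp

/-- Parseval's identity for absolutely convergent power series on the unit circle. -/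
theorem hasSum_integral_circ {p q : ℕ → ℂ} {P Q : ℝ → ℂ} (hp : Summable fun n => ‖p n‖)
    (hq : Summable fun n => ‖q n‖) (hP : ∀ θ, HasSum (fun n => p n * circ θ ^ n) (P θ))
    (hQ : ∀ θ, HasSum (fun n => q n * circ (-θ) ^ n) (Q θ)) (hQc : Continuous Q) :
    HasSum (fun n => p n * q n) (∫ θ in (0 : ℝ)..1, P θ * Q θ) := by
  have hcp : ∀ n : ℕ, Continuous fun θ => circ θ ^ n := fun n => continuous_circ.pow n
  have hcm : ∀ n : ℕ, Continuous fun θ : ℝ => circ (-θ) ^ n :=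
    fun n => (continuous_circ.comp continuous_neg).pow n
  have hinner : ∀ n : ℕ, ∫ θ in (0 : ℝ)..1, circ θ ^ n * Q θ = q n := by
    intro n
    have h := intervalIntegral.hasSum_integral_of_dominated_convergence (a := 0) (b := 1)
      (μ := volume) (F := fun m θ => circ θ ^ n * (q m * circ (-θ) ^ m))
      (f := fun θ => circ θ ^ n * Q θ) (fun m _ => ‖q m‖)
      (fun m => ((hcp n).mul (continuous_const.mul (hcm m))).aestronglyMeasurable)
      (fun m => Eventually.of_forall fun θ _ => by simp [norm_circ])
      (Eventually.of_forall fun θ _ => hq) intervalIntegrable_const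
      (Eventually.of_forall fun θ _ => (hQ θ).mul_left _)
    have h2 : ∀ m : ℕ, ∫ θ in (0 : ℝ)..1, circ θ ^ n * (q m * circ (-θ) ^ m) =
        if m = n then q n else 0 := by
      intro m
      have : ∀ θ, circ θ ^ n * (q m * circ (-θ) ^ m) = q m * (circ θ ^ n * circ (-θ) ^ m) :=
        fun θ => by ring
      simp only [this]
      rw [intervalIntegral.integral_const_mul, integral_circ_pow_mul]
      by_cases hnm : m = n
      · simp [hnm]
      · simp [hnm, Ne.symm hnm]
    simp only [h2] at h
    exact h.unique (hasSum_ite_eq n (q n))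
  obtain ⟨B, hB⟩ : ∃ B, ∀ θ, ‖Q θ‖ ≤ B := ⟨∑' n, ‖q n‖, fun θ => by
    rw [← (hQ θ).tsum_eq]
    refine tsum_of_norm_bounded hq.hasSum fun n => ?_
    simp [norm_circ]⟩
  have h := intervalIntegral.hasSum_integral_of_dominated_convergence (a := 0) (b := 1)
    (μ := volume) (F := fun n θ => p n * circ θ ^ n * Q θ)
    (f := fun θ => P θ * Q θ) (fun n _ => ‖p n‖ * B)
    (fun n => ((continuous_const.mul (hcp n)).mul hQc).aestronglyMeasurable)
    (fun n => Eventually.of_forall fun θ _ => by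
      simp only [norm_mul, norm_pow, norm_circ, one_pow, mul_one]
      exact mul_le_mul_of_nonneg_left (hB θ) (norm_nonneg _))
    (Eventually.of_forall fun θ _ => hp.mul_right B) intervalIntegrable_const
    (Eventually.of_forall fun θ _ => (hP θ).mul_right _)
  refine Eq.mpr (congrArg (fun F => HasSum F _) (funext fun n => ?_)) h
  simp only [mul_assoc]
  rw [intervalIntegral.integral_const_mul, hinner]

/-- Differentiation under the integral sign for a bounded holomorphic integrand. -/
theorem hasDerivAt_integral_of_bounded {F : ℂ → ℝ → ℂ} {V : Set ℂ} (hV : IsOpen V) {B : ℝ}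
    (hd : ∀ θ, DifferentiableOn ℂ (fun t => F t θ) V) (hc : ∀ t ∈ V, Continuous (F t))
    (hB : ∀ t ∈ V, ∀ θ, ‖F t θ‖ ≤ B) {t₀ : ℂ} (ht₀ : t₀ ∈ V) :
    HasDerivAt (fun t => ∫ θ in (0 : ℝ)..1, F t θ)
      (∫ θ in (0 : ℝ)..1, deriv (fun t => F t θ) t₀) t₀ := by
  obtain ⟨δ, hδ, hδV⟩ := Metric.isOpen_iff.1 hV t₀ ht₀
  have hda : ∀ θ, ∀ t ∈ V, DifferentiableAt ℂ (fun t => F t θ) t := fun θ t ht =>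
    (hd θ t ht).differentiableAt (hV.mem_nhds ht)
  refine (intervalIntegral.hasDerivAt_integral_of_dominated_loc_of_deriv_le (μ := volume)
    (s := ball t₀ (δ / 2)) (bound := fun _ => B / (δ / 4)) (F' := fun t θ => deriv (fun t => F t θ) t)
    (ball_mem_nhds _ (by positivity)) ?_ ((hc t₀ ht₀).intervalIntegrable _ _) ?_ ?_
    intervalIntegrable_const ?_).2
  · filter_upwards [hV.mem_nhds ht₀] with t ht using (hc t ht).aestronglyMeasurable
  -- Measurability of the derivative in θ: it is a pointwise limit of continuous difference
  -- quotients, with increments small enough to stay in `V`.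
  · have hseq : Tendsto (fun n : ℕ => ((δ / 2 / ((n : ℝ) + 1) : ℝ) : ℂ)) atTop (𝓝[≠] 0) := by
      refine tendsto_nhdsWithin_iff.2 ⟨?_, Eventually.of_forall fun n => ?_⟩
      · rw [← Complex.ofReal_zero]
        refine (Complex.continuous_ofReal.tendsto 0).comp ?_
        have := (tendsto_one_div_add_atTop_nhds_zero_nat (𝕜 := ℝ)).const_mul (δ / 2)
        simpa [div_eq_mul_inv] using this
      · simp only [Set.mem_compl_iff, Set.mem_singleton_iff, Complex.ofReal_eq_zero]
        positivity
    refine aestronglyMeasurable_of_tendsto_ae atTop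
      (f := fun (n : ℕ) θ => ((δ / 2 / ((n : ℝ) + 1) : ℝ) : ℂ)⁻¹ •
        (F (t₀ + ((δ / 2 / ((n : ℝ) + 1) : ℝ) : ℂ)) θ - F t₀ θ)) (fun n => ?_)
      (Eventually.of_forall fun θ => ?_)
    · refine Continuous.aestronglyMeasurable ?_
      refine continuous_const.mul (Continuous.sub (hc _ (hδV ?_)) (hc _ ht₀))
      rw [mem_ball, dist_eq_norm, add_sub_cancel_left, Complex.norm_real, Real.norm_of_nonneg
        (by positivity)]
      calc δ / 2 / ((n : ℝ) + 1) ≤ δ / 2 := div_le_self (by positivity) (by simp)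
        _ < δ := by linarith
    · exact (hda θ t₀ ht₀).hasDerivAt.tendsto_slope_zero.comp hseq
  · refine Eventually.of_forall fun θ _ t ht => ?_
    have hsub : closedBall t (δ / 4) ⊆ V := fun y hy => hδV (by
      rw [mem_ball] at ht ⊢
      rw [mem_closedBall] at hy
      linarith [dist_triangle y t t₀])
    refine Complex.norm_deriv_le_of_forall_mem_sphere_norm_le (by positivity) ?_ fun y hy =>
      hB y (hsub (sphere_subset_closedBall hy)) θ
    exact ((hd θ).mono (by rw [closure_ball _ (by positivity)]; exact hsub)).diffContOnCl
  · refine Eventually.of_forall fun θ _ t ht => (hda θ t (hδV ?_)).hasDerivAt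
    rw [mem_ball] at ht ⊢
    linarith

/-! ### The local integral and its stability near the centre. -/

/-- The unimodular factor attached to a variable. -/
def rot {k : ℕ} (θ : ℝ) : Fin k ⊕ Fin k → ℂ := Sum.elim (fun _ => circ θ) fun _ => circ (-θ)

theorem norm_rot {k : ℕ} (θ : ℝ) (s : Fin k ⊕ Fin k) : ‖rot θ s‖ = 1 := by
  cases s <;> simp [rot, norm_circ]

theorem continuous_rot {k : ℕ} (s : Fin k ⊕ Fin k) : Continuous fun θ => rot θ s := by
  cases s
  · exact continuous_circ
  · exact continuous_circ.comp continuous_neg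

/-- The integrand of the local integral. -/
def szego {k : ℕ} (x : Fin k ⊕ Fin k → ℂ) (θ : ℝ) : ℂ := ∏ s, (1 - rot θ s * x s)⁻¹

/-- The local integral. -/
def szegoIntegral {k : ℕ} (x : Fin k ⊕ Fin k → ℂ) : ℂ := ∫ θ in (0 : ℝ)..1, szego x θ

theorem one_sub_rot_mul_ne_zero {k : ℕ} {x : Fin k ⊕ Fin k → ℂ} {s : Fin k ⊕ Fin k} (θ : ℝ)
    (h : ‖x s‖ < 1) : 1 - rot θ s * x s ≠ 0 := by
  intro h0
  have : ‖rot θ s * x s‖ = 1 := by rw [← sub_eq_zero.1 h0, norm_one]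
  rw [norm_mul, norm_rot, one_mul] at this
  linarith

theorem continuous_szego {k : ℕ} {x : Fin k ⊕ Fin k → ℂ} (h : ∀ s, ‖x s‖ < 1) :
    Continuous (szego x) := by
  refine continuous_finsetProd _ fun s _ => ?_
  exact (continuous_const.sub ((continuous_rot s).mul continuous_const)).inv₀
    fun θ => one_sub_rot_mul_ne_zero θ (h s)

theorem norm_inv_one_sub_rot_le {k : ℕ} {x : Fin k ⊕ Fin k → ℂ} {ρ : ℝ} (hρ : ρ < 1)
    {s : Fin k ⊕ Fin k} (h : ‖x s‖ ≤ ρ) (θ : ℝ) : ‖(1 - rot θ s * x s)⁻¹‖ ≤ (1 - ρ)⁻¹ := by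
  rw [norm_inv]
  refine inv_anti₀ (by linarith) ?_
  have := norm_sub_norm_le 1 (rot θ s * x s)
  rw [norm_one, norm_mul, norm_rot, one_mul] at this
  linarith

theorem norm_szego_le {k : ℕ} {x : Fin k ⊕ Fin k → ℂ} {ρ : ℝ} (hρ : ρ < 1)
    (h : ∀ s, ‖x s‖ ≤ ρ) (θ : ℝ) :
    ‖szego x θ‖ ≤ ∏ _s : Fin k ⊕ Fin k, (1 - ρ)⁻¹ := by
  rw [szego, norm_prod]
  exact Finset.prod_le_prod (fun _ _ => norm_nonneg _) fun s _ => norm_inv_one_sub_rot_le hρ (h s) θ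

theorem differentiableOn_prod {E κ : Type*} [NormedAddCommGroup E] [NormedSpace ℂ E]
    {f : κ → E → ℂ} {U : Set E} {s : Finset κ} (h : ∀ i ∈ s, DifferentiableOn ℂ (f i) U) :
    DifferentiableOn ℂ (fun x => ∏ i ∈ s, f i x) U := by
  classical
  induction s using Finset.induction_on with
  | empty => simp
  | insert a s ha ih =>
    simp only [Finset.prod_insert ha]
    exact (h a (Finset.mem_insert_self a s)).mul
      (ih fun i hi => h i (Finset.mem_insert_of_mem hi))

theorem differentiableOn_szego {k : ℕ} (θ : ℝ) :
    DifferentiableOn ℂ (fun x : Fin k ⊕ Fin k → ℂ => szego x θ) {x | ∀ s, ‖x s‖ < 1} := by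
  have h : ∀ s ∈ (Finset.univ : Finset (Fin k ⊕ Fin k)), DifferentiableOn ℂ
      (fun x : Fin k ⊕ Fin k → ℂ => (1 - rot θ s * x s)⁻¹) {x | ∀ s, ‖x s‖ < 1} := fun s _ => by
    refine DifferentiableOn.fun_inv ?_ fun x hx => one_sub_rot_mul_ne_zero θ (hx s)
    exact ((differentiable_const _).sub ((differentiable_const _).mul
      (differentiable_apply (𝕜 := ℂ) (F' := fun _ : Fin k ⊕ Fin k => ℂ) s))).differentiableOn
  exact differentiableOn_prod h

theorem hasDerivAt_szegoIntegral {k : ℕ} {ρ : ℝ} (hρ : ρ < 1) {γ : ℂ → Fin k ⊕ Fin k → ℂ}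
    {V : Set ℂ} (hV : IsOpen V) (hγ : DifferentiableOn ℂ γ V) (hm : ∀ t ∈ V, ∀ s, ‖γ t s‖ < ρ)
    {t₀ : ℂ} (ht₀ : t₀ ∈ V) :
    HasDerivAt (fun t => szegoIntegral (γ t))
      (∫ θ in (0 : ℝ)..1, deriv (fun t => szego (γ t) θ) t₀) t₀ :=
  hasDerivAt_integral_of_bounded hV
    (fun θ => (differentiableOn_szego θ).comp hγ fun t ht s => (hm t ht s).trans hρ)
    (fun t ht => continuous_szego fun s => (hm t ht s).trans hρ)
    (fun t ht θ => norm_szego_le hρ (fun s => (hm t ht s).le) θ) ht₀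

theorem curveHolomorphicOn_szegoIntegral {k : ℕ} {ρ : ℝ} (hρ : ρ < 1) :
    CurveHolomorphicOn (szegoIntegral (k := k)) {x | ∀ s, ‖x s‖ < ρ} := by
  constructor
  · intro x hx
    refine intervalIntegral.continuousWithinAt_of_dominated_interval
      (bound := fun _ => ∏ _s : Fin k ⊕ Fin k, (1 - ρ)⁻¹) ?_ ?_ intervalIntegrable_const ?_
    · filter_upwards [self_mem_nhdsWithin] with y hy
      exact (continuous_szego fun s => (hy s).trans hρ).aestronglyMeasurable
    · filter_upwards [self_mem_nhdsWithin] with y hy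
      exact Eventually.of_forall fun θ _ => norm_szego_le hρ (fun s => (hy s).le) θ
    · exact Eventually.of_forall fun θ _ => ((differentiableOn_szego θ).continuousOn.mono
        fun y hy s => (hy s).trans hρ) x hx
  · intro γ V hV hγ hm t ht
    exact (hasDerivAt_szegoIntegral hρ hV hγ hm ht).differentiableAt.differentiableWithinAt

/-- At the centre the two groups of k factors are complex conjugates, which makes the integrand |1 -
r e(θ)|^{-2k}. Its positivity is what makes relative bounds uniform in k. -/
theorem szego_const {k : ℕ} (r θ : ℝ) :
    szego (fun _ : Fin k ⊕ Fin k => (r : ℂ)) θ =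
      (((Complex.normSq (1 - circ θ * r))⁻¹ ^ k : ℝ) : ℂ) := by
  have h : 1 - circ (-θ) * r = (starRingEnd ℂ) (1 - circ θ * r) := by
    rw [map_sub, map_mul, conj_circ, map_one, Complex.conj_ofReal]
  simp only [szego, Fintype.prod_sum_type, rot, Sum.elim_inl, Sum.elim_inr, Finset.prod_const,
    Finset.card_univ, Fintype.card_fin]
  rw [h, ← mul_pow, ← mul_inv, Complex.mul_conj]
  push_cast
  rfl

/-- The local integral at the centre. -/
def szegoConst (k : ℕ) (r : ℝ) : ℝ :=
  ∫ θ in (0 : ℝ)..1, (Complex.normSq (1 - circ θ * r))⁻¹ ^ k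

theorem szegoIntegral_const {k : ℕ} (r : ℝ) :
    szegoIntegral (fun _ : Fin k ⊕ Fin k => (r : ℂ)) = szegoConst k r := by
  simp only [szegoIntegral, szego_const, szegoConst]
  exact intervalIntegral.integral_ofReal

theorem one_sub_circ_mul_ne_zero {r : ℝ} (hr0 : 0 ≤ r) (hr : r < 1) (θ : ℝ) :
    1 - circ θ * r ≠ 0 := by
  intro h
  have : ‖circ θ * r‖ = 1 := by rw [← sub_eq_zero.1 h, norm_one]
  rw [norm_mul, norm_circ, one_mul, Complex.norm_real, Real.norm_of_nonneg hr0] at this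
  linarith

theorem continuous_szegoConst_integrand (k : ℕ) {r : ℝ} (hr0 : 0 ≤ r) (hr : r < 1) :
    Continuous fun θ => (Complex.normSq (1 - circ θ * r))⁻¹ ^ k := by
  refine Continuous.pow (Continuous.inv₀ ?_ fun θ => ?_) k
  · exact Complex.continuous_normSq.comp
      (continuous_const.sub (continuous_circ.mul continuous_const))
  · exact fun h => one_sub_circ_mul_ne_zero hr0 hr θ (Complex.normSq_eq_zero.1 h)

theorem szegoConst_pos (k : ℕ) {r : ℝ} (hr0 : 0 ≤ r) (hr : r < 1) : 0 < szegoConst k r := by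
  refine intervalIntegral.intervalIntegral_pos_of_pos
    ((continuous_szegoConst_integrand k hr0 hr).intervalIntegrable _ _) (fun θ => ?_) one_pos
  exact pow_pos (inv_pos.2 (Complex.normSq_pos.2 (one_sub_circ_mul_ne_zero hr0 hr θ))) k

/-- The integrand changes pointwise by a relative amount at most 1/2. Because the central integrand
is positive, integrating this bound loses nothing, however small the integral may be compared with
the maximum of the integrand. -/
theorem norm_szegoIntegral_sub_le {k : ℕ} {r : ℝ} (hr0 : 0 ≤ r) (hr : r ≤ 3 / 4)
    {x : Fin k ⊕ Fin k → ℂ} (hx : ∑ s, ‖x s - r‖ ≤ 1 / 20) :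
    ‖szegoIntegral x - szegoConst k r‖ ≤ 1 / 2 * szegoConst k r := by
  have hxs : ∀ s, ‖x s‖ ≤ 4 / 5 := fun s => by
    have h1 := (Finset.single_le_sum (f := fun s => ‖x s - r‖) (fun _ _ => norm_nonneg _)
      (Finset.mem_univ s)).trans hx
    have h2 := norm_le_norm_add_norm_sub' (x s) (r : ℂ)
    rw [Complex.norm_real, Real.norm_of_nonneg hr0] at h2
    linarith
  have hrn : ‖(r : ℂ)‖ < 1 := by
    rw [Complex.norm_real, Real.norm_of_nonneg hr0]; linarith
  have hpt : ∀ θ, ‖szego x θ - szego (fun _ : Fin k ⊕ Fin k => (r : ℂ)) θ‖ ≤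
      1 / 2 * (Complex.normSq (1 - circ θ * r))⁻¹ ^ k := by
    intro θ
    have hfac : szego x θ = szego (fun _ : Fin k ⊕ Fin k => (r : ℂ)) θ *
        ∏ s, (1 + rot θ s * (x s - r) * (1 - rot θ s * x s)⁻¹) := by
      rw [szego, szego, ← Finset.prod_mul_distrib]
      refine Finset.prod_congr rfl fun s _ => ?_
      have h1 : 1 - rot θ s * x s ≠ 0 :=
        one_sub_rot_mul_ne_zero θ ((hxs s).trans_lt (by norm_num))
      have h2 : 1 - rot θ s * (r : ℂ) ≠ 0 :=
        one_sub_rot_mul_ne_zero (x := fun _ : Fin k ⊕ Fin k => (r : ℂ)) θ hrn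
      field_simp
      ring
    have hprod := Finset.norm_prod_one_add_sub_one_le Finset.univ
      fun s => rot θ s * (x s - r) * (1 - rot θ s * x s)⁻¹
    -- Each inverse is at most 5 since ‖x s‖ ≤ 4/5, and 5 · 1/20 = 1/4; then e^{1/4} - 1 ≤ 1/2.
    have hsum : ∑ s, ‖rot θ s * (x s - r) * (1 - rot θ s * x s)⁻¹‖ ≤ 1 / 4 := by
      calc _ ≤ ∑ s, ‖x s - r‖ * 5 := by
            refine Finset.sum_le_sum fun s _ => ?_
            rw [norm_mul, norm_mul, norm_rot, one_mul]
            refine mul_le_mul_of_nonneg_left ?_ (norm_nonneg _)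
            refine (norm_inv_one_sub_rot_le (by norm_num) (hxs s) θ).trans (by norm_num)
        _ ≤ _ := by rw [← Finset.sum_mul]; linarith
    have hexp : Real.exp (∑ s, ‖rot θ s * (x s - r) * (1 - rot θ s * x s)⁻¹‖) - 1 ≤ 1 / 2 := by
      have h1 := Real.exp_le_exp.2 hsum
      have h2 := Real.abs_exp_sub_one_le (x := 1 / 4) (by norm_num [abs_of_pos])
      have h3 := le_abs_self (Real.exp (1 / 4) - 1)
      rw [abs_of_pos (by norm_num : (0 : ℝ) < 1 / 4)] at h2
      linarith
    rw [hfac, ← mul_sub_one, norm_mul, szego_const, Complex.norm_real, Real.norm_of_nonneg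
      (by have := Complex.normSq_nonneg (1 - circ θ * r); positivity), mul_comm]
    refine mul_le_mul_of_nonneg_right (hprod.trans hexp) ?_
    have := Complex.normSq_nonneg (1 - circ θ * r)
    positivity
  rw [← szegoIntegral_const, szegoIntegral, szegoIntegral, ← intervalIntegral.integral_sub]
  · refine (intervalIntegral.norm_integral_le_of_norm_le zero_le_one
      (g := fun θ => 1 / 2 * (Complex.normSq (1 - circ θ * r))⁻¹ ^ k)
      (Eventually.of_forall fun θ _ => hpt θ) ?_).trans_eq ?_
    · exact (continuous_const.mul
        (continuous_szegoConst_integrand k hr0 (by linarith))).intervalIntegrable _ _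
    · rw [intervalIntegral.integral_const_mul, szegoConst]
  · exact (continuous_szego fun s => (hxs s).trans_lt (by norm_num)).intervalIntegrable _ _
  · exact (continuous_szego fun s => hrn).intervalIntegrable _ _

/-! ### Cancellation of quadratic terms when all variables are small. -/

/-- The product of geometric series as a power series with bounded coefficients. -/
theorem exists_hasSum_prod_geometric {κ : Type*} (s : Finset κ) (u : κ → ℂ)
    (hu : ∀ j ∈ s, ‖u j‖ < 1) :
    ∃ h : ℕ → ℂ, h 0 = 1 ∧ h 1 = ∑ j ∈ s, u j ∧ (∀ n, ‖h n‖ ≤ (∑ j ∈ s, ‖u j‖) ^ n) ∧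
      ∀ w : ℂ, ‖w‖ ≤ 1 → (Summable fun n => ‖h n * w ^ n‖) ∧
        HasSum (fun n => h n * w ^ n) (∏ j ∈ s, (1 - w * u j)⁻¹) := by
  classical
  induction s using Finset.induction_on with
  | empty =>
    refine ⟨fun n => if n = 0 then 1 else 0, by simp, by simp, fun n => ?_, fun w _ => ?_⟩
    · by_cases hn : n = 0 <;> simp [hn]
    · have h1 : ∀ n : ℕ, (if n = 0 then (1 : ℂ) else 0) * w ^ n = if n = 0 then 1 else 0 := by
        intro n; by_cases hn : n = 0 <;> simp [hn]
      simp only [h1, Finset.prod_empty]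
      refine ⟨summable_of_ne_finset_zero (s := {0}) fun n hn => ?_, hasSum_ite_eq 0 1⟩
      simp [Finset.notMem_singleton.1 hn]
  | insert a s ha ih =>
    obtain ⟨h, h0, h1, hb, hs⟩ := ih fun j hj => hu j (Finset.mem_insert_of_mem hj)
    refine ⟨fun n => ∑ p ∈ Finset.HasAntidiagonal.antidiagonal n, h p.1 * u a ^ p.2,
      by simp [h0], ?_, ?_, ?_⟩
    · rw [Finset.sum_insert ha]
      simp [Finset.Nat.antidiagonal_succ, h0, h1]
    · intro n
      rw [Finset.sum_insert ha, add_comm, (Commute.all _ _).add_pow']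
      refine norm_sum_le_of_le _ fun p hp => ?_
      rw [norm_mul, norm_pow]
      have hnn : 0 ≤ (∑ j ∈ s, ‖u j‖) ^ p.1 * ‖u a‖ ^ p.2 := by positivity
      -- The Cauchy product is dominated by the binomial expansion of the n-th power of the sum,
      -- whose coefficients are at least 1.
      have hch : 1 ≤ n.choose p.1 := Nat.choose_pos (by
        have := Finset.HasAntidiagonal.mem_antidiagonal.1 hp; omega)
      calc ‖h p.1‖ * ‖u a‖ ^ p.2 ≤ (∑ j ∈ s, ‖u j‖) ^ p.1 * ‖u a‖ ^ p.2 := by gcongr; exact hb _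
        _ ≤ n.choose p.1 • ((∑ j ∈ s, ‖u j‖) ^ p.1 * ‖u a‖ ^ p.2) := by
          rw [nsmul_eq_mul]
          exact le_mul_of_one_le_left hnn (by exact_mod_cast hch)
    · intro w hw
      obtain ⟨hs1, hs2⟩ := hs w hw
      have hwa : ‖w * u a‖ < 1 := by
        rw [norm_mul]
        have := hu a (Finset.mem_insert_self a s)
        nlinarith [norm_nonneg (u a), norm_nonneg w]
      have hg := hasSum_geometric_of_norm_lt_one hwa
      have hgs : Summable fun n => ‖(w * u a) ^ n‖ := by
        simpa only [norm_pow] using summable_geometric_of_lt_one (norm_nonneg _) hwa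
      have heq : ∀ n, (∑ p ∈ Finset.HasAntidiagonal.antidiagonal n, h p.1 * u a ^ p.2) * w ^ n =
          ∑ p ∈ Finset.HasAntidiagonal.antidiagonal n, h p.1 * w ^ p.1 * (w * u a) ^ p.2 := by
        intro n
        rw [Finset.sum_mul]
        refine Finset.sum_congr rfl fun p hp => ?_
        rw [← Finset.HasAntidiagonal.mem_antidiagonal.1 hp]
        ring
      simp only [heq]
      have hsum := summable_norm_sum_mul_antidiagonal_of_summable_norm hs1 hgs
      refine ⟨hsum, ?_⟩
      have := hsum.of_norm.hasSum
      rw [← tsum_mul_tsum_eq_tsum_sum_antidiagonal_of_summable_norm hs1 hgs, hs2.tsum_eq,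
        hg.tsum_eq] at this
      rwa [Finset.prod_insert ha, mul_comm ((1 - w * u a)⁻¹)]

/-- The terms of degree at least two in the product are majorised by those of the exponential of the
sum of absolute values. -/
theorem norm_prod_one_sub_sub_le {κ : Type*} (s : Finset κ) (x : κ → ℂ) :
    ‖∏ j ∈ s, (1 - x j) - (1 - ∑ j ∈ s, x j)‖ ≤
      Real.exp (∑ j ∈ s, ‖x j‖) - 1 - ∑ j ∈ s, ‖x j‖ := by
  classical
  induction s using Finset.induction_on with
  | empty => simp
  | insert a s ha ih =>
    rw [Finset.prod_insert ha, Finset.sum_insert ha, Finset.sum_insert ha]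
    set P := ∏ j ∈ s, (1 - x j)
    set S := ∑ j ∈ s, x j with hS
    set σ := ∑ j ∈ s, ‖x j‖ with hσ
    have hSσ : ‖S‖ ≤ σ := norm_sum_le _ _
    have e : (1 - x a) * P - (1 - (x a + S)) = (1 - x a) * (P - (1 - S)) + x a * S := by ring
    have h1 : ‖1 - x a‖ ≤ 1 + ‖x a‖ := (norm_sub_le _ _).trans (by simp)
    have h2 : 0 ≤ Real.exp σ - 1 - σ := (norm_nonneg _).trans ih
    have h3 : (1 + ‖x a‖) * Real.exp σ ≤ Real.exp (‖x a‖ + σ) := by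
      rw [Real.exp_add]
      have := Real.add_one_le_exp ‖x a‖
      gcongr
      linarith
    calc _ ≤ (1 + ‖x a‖) * (Real.exp σ - 1 - σ) + ‖x a‖ * σ := by
          rw [e]
          refine (norm_add_le _ _).trans (add_le_add ?_ ?_)
          · rw [norm_mul]; exact mul_le_mul h1 ih (norm_nonneg _) (by positivity)
          · rw [norm_mul]; gcongr
      _ ≤ _ := by nlinarith

/-- The product over all pairs in a local factor. -/
def pairProd {k : ℕ} (x : Fin k ⊕ Fin k → ℂ) : ℂ :=
  ∏ i : Fin k, ∏ j : Fin k, (1 - x (Sum.inl i) * x (Sum.inr j))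

/-- Let U and V be the sums of the two groups of variables. By Parseval the integral is 1 + UV +
O(S⁴), while the pair product is 1 - UV + O(S⁴), so the quadratic terms cancel. This is also why the
Euler product converges. -/
theorem norm_pairProd_mul_szegoIntegral_sub_one_le {k : ℕ} {x : Fin k ⊕ Fin k → ℂ} {S : ℝ}
    (hS : S ≤ 1 / 4) (hx : ∑ s, ‖x s‖ ≤ S) :
    ‖pairProd x * szegoIntegral x - 1‖ ≤ 10 * S ^ 4 := by
  have hx0 : 0 ≤ ∑ s, ‖x s‖ := Finset.sum_nonneg fun _ _ => norm_nonneg _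
  have hS0 : 0 ≤ S := hx0.trans hx
  set a := ∑ i : Fin k, ‖x (Sum.inl i)‖ with ha
  set b := ∑ j : Fin k, ‖x (Sum.inr j)‖ with hb
  have ha0 : 0 ≤ a := Finset.sum_nonneg fun _ _ => norm_nonneg _
  have hb0 : 0 ≤ b := Finset.sum_nonneg fun _ _ => norm_nonneg _
  have hab : a + b ≤ S := by rwa [ha, hb, ← Fintype.sum_sum_type fun s => ‖x s‖]
  have hxs : ∀ s, ‖x s‖ < 1 := fun s => by
    have := Finset.single_le_sum (f := fun s => ‖x s‖) (fun _ _ => norm_nonneg _)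
      (Finset.mem_univ s)
    linarith
  set σ := a * b with hσ
  have hσ0 : 0 ≤ σ := mul_nonneg ha0 hb0
  have hσS : σ ≤ S ^ 2 := by nlinarith
  have hσ1 : σ ≤ 1 / 16 := by nlinarith
  obtain ⟨h, h0, h1, hbd, hs⟩ := exists_hasSum_prod_geometric Finset.univ
    (fun i : Fin k => x (Sum.inl i)) fun i _ => hxs _
  obtain ⟨g, g0, g1, gbd, gs⟩ := exists_hasSum_prod_geometric Finset.univ
    (fun i : Fin k => x (Sum.inr i)) fun i _ => hxs _
  rw [← ha] at hbd
  rw [← hb] at gbd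
  set U := ∑ i : Fin k, x (Sum.inl i)
  set V := ∑ i : Fin k, x (Sum.inr i)
  have hUa : ‖U‖ ≤ a := norm_sum_le _ _
  have hVb : ‖V‖ ≤ b := norm_sum_le _ _
  have hUV : ‖U * V‖ ≤ σ := by
    rw [norm_mul]; exact mul_le_mul hUa hVb (norm_nonneg _) ha0
  have hint : HasSum (fun n => h n * g n) (szegoIntegral x) := by
    have h2 := hasSum_integral_circ (p := h) (q := g)
      (P := fun θ => ∏ i : Fin k, (1 - circ θ * x (Sum.inl i))⁻¹)
      (Q := fun θ => ∏ i : Fin k, (1 - circ (-θ) * x (Sum.inr i))⁻¹)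
      (by simpa using (hs 1 (by simp)).1) (by simpa using (gs 1 (by simp)).1)
      (fun θ => (hs _ (norm_circ θ).le).2) (fun θ => (gs _ (norm_circ _).le).2)
      (by
        refine continuous_finsetProd _ fun i _ => ?_
        refine (continuous_const.sub
          ((continuous_circ.comp continuous_neg).mul continuous_const)).inv₀ fun θ => ?_
        exact one_sub_rot_mul_ne_zero θ (hxs (Sum.inr i)))
    have h3 : szegoIntegral x = ∫ θ in (0 : ℝ)..1, (∏ i : Fin k, (1 - circ θ * x (Sum.inl i))⁻¹) *
        ∏ i : Fin k, (1 - circ (-θ) * x (Sum.inr i))⁻¹ := by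
      simp only [szegoIntegral, szego, Fintype.prod_sum_type, rot, Sum.elim_inl, Sum.elim_inr]
    rw [h3]
    exact h2
  have hJ : ‖szegoIntegral x - (1 + U * V)‖ ≤ 2 * σ ^ 2 := by
    have h2 := (hasSum_nat_add_iff' 2).2 hint
    have hgeo := (hasSum_geometric_of_lt_one hσ0 (by linarith)).mul_left (σ ^ 2)
    have h3 := tsum_of_norm_bounded hgeo (f := fun n => h (n + 2) * g (n + 2)) fun n => by
      rw [norm_mul, ← pow_add, add_comm 2 n, hσ, mul_pow]
      exact mul_le_mul (hbd _) (gbd _) (norm_nonneg _) (by positivity)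
    rw [h2.tsum_eq] at h3
    simp only [Finset.sum_range_succ, Finset.sum_range_zero, zero_add, h0, g0, h1, g1,
      mul_one] at h3
    refine h3.trans ?_
    have : (1 - σ)⁻¹ ≤ 2 := by
      rw [inv_le_comm₀ (by linarith) (by norm_num)]; linarith
    nlinarith [sq_nonneg σ]
  have hD : ‖pairProd x - (1 - U * V)‖ ≤ σ ^ 2 := by
    have h2 := norm_prod_one_sub_sub_le (Finset.univ : Finset (Fin k × Fin k))
      fun p => x (Sum.inl p.1) * x (Sum.inr p.2)
    rw [Fintype.prod_prod_type, Fintype.sum_prod_type, Fintype.sum_prod_type] at h2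
    simp only [norm_mul] at h2
    rw [← Finset.sum_mul_sum, ← Finset.sum_mul_sum] at h2
    refine h2.trans ((le_abs_self _).trans ?_)
    exact Real.abs_exp_sub_one_sub_id_le (x := a * b) (by rw [abs_of_nonneg hσ0]; linarith)
  set J := szegoIntegral x
  set D := pairProd x
  have e : D * J - 1 = -((U * V) * (U * V)) + (D - (1 - U * V)) * (1 + U * V) +
      D * (J - (1 + U * V)) := by ring
  have hD2 : ‖D‖ ≤ 2 := by
    have h4 := norm_le_norm_add_norm_sub' D (1 - U * V)
    have h5 : ‖1 - U * V‖ ≤ 1 + σ := (norm_sub_le _ _).trans (by rw [norm_one]; linarith)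
    nlinarith
  have h5 : ‖1 + U * V‖ ≤ 2 := (norm_add_le _ _).trans (by rw [norm_one]; linarith)
  calc ‖D * J - 1‖ ≤ σ * σ + σ ^ 2 * 2 + 2 * (2 * σ ^ 2) := by
        rw [e]
        refine (norm_add₃_le).trans ?_
        rw [norm_neg, norm_mul (U * V), norm_mul _ (1 + U * V), norm_mul D]
        exact add_le_add (add_le_add (mul_le_mul hUV hUV (norm_nonneg _) hσ0)
          (mul_le_mul hD h5 (norm_nonneg _) (by positivity)))
          (mul_le_mul hD2 hJ (norm_nonneg _) (by norm_num))
    _ ≤ 10 * (S ^ 2) ^ 2 := by nlinarith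
    _ = _ := by ring

/-! ### Logarithm of the normalised local integral. -/

/-- The point `r (1 + ζ)`. -/
def scaledPoint {k : ℕ} (r : ℝ) (ζ : Fin k ⊕ Fin k → ℂ) : Fin k ⊕ Fin k → ℂ :=
  fun s => (r : ℂ) * (1 + ζ s)

theorem scaledPoint_zero {k : ℕ} (r : ℝ) :
    scaledPoint r (0 : Fin k ⊕ Fin k → ℂ) = fun _ => (r : ℂ) := by
  ext; simp [scaledPoint]

theorem differentiable_scaledPoint {k : ℕ} (r : ℝ) :
    Differentiable ℂ (scaledPoint (k := k) r) :=
  differentiable_pi.2 fun s => (differentiable_const _).mul ((differentiable_const _).add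
    (differentiable_apply (𝕜 := ℂ) (F' := fun _ : Fin k ⊕ Fin k => ℂ) s))

theorem sum_norm_scaledPoint_sub {k : ℕ} {r : ℝ} (hr : 0 ≤ r) (ζ : Fin k ⊕ Fin k → ℂ) :
    ∑ s, ‖scaledPoint r ζ s - r‖ = r * ∑ s, ‖ζ s‖ := by
  rw [Finset.mul_sum]
  refine Finset.sum_congr rfl fun s _ => ?_
  rw [scaledPoint, mul_add, mul_one, add_sub_cancel_left, norm_mul, Complex.norm_real,
    Real.norm_of_nonneg hr]

/-- The local factor in rescaled coordinates. -/
def scaledFactor {k : ℕ} (r : ℝ) (ζ : Fin k ⊕ Fin k → ℂ) : ℂ :=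
  pairProd (scaledPoint r ζ) * szegoIntegral (scaledPoint r ζ)

theorem norm_log_le_of_norm_sub_one_le {w : ℂ} {ε : ℝ} (hε : ε ≤ 1 / 2) (hw : ‖w - 1‖ ≤ ε) :
    ‖Complex.log w‖ ≤ 3 / 2 * ε := by
  have := Complex.norm_log_one_add_half_le_self (z := w - 1) (hw.trans hε)
  rw [add_sub_cancel] at this
  linarith

theorem mem_slitPlane_of_norm_sub_one_le {w : ℂ} (hw : ‖w - 1‖ ≤ 1 / 2) :
    w ∈ Complex.slitPlane := by
  have := Complex.mem_slitPlane_of_norm_lt_one (z := w - 1) (by linarith)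
  rwa [add_sub_cancel] at this

/-- The logarithm of the normalised local integral. -/
def szegoLog {k : ℕ} (r : ℝ) (ζ : Fin k ⊕ Fin k → ℂ) : ℂ :=
  Complex.log (szegoIntegral (scaledPoint r ζ) / szegoConst k r)

theorem norm_szegoIntegral_div_sub_one_le {k : ℕ} {r : ℝ} (hr0 : 0 < r) (hr : r ≤ 3 / 4)
    {ζ : Fin k ⊕ Fin k → ℂ} (hζ : ∑ s, ‖ζ s‖ < 1 / (20 * r)) :
    ‖szegoIntegral (scaledPoint r ζ) / szegoConst k r - 1‖ ≤ 1 / 2 := by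
  have hpos := szegoConst_pos k hr0.le (by linarith : r < 1)
  have h1 : ∑ s, ‖scaledPoint r ζ s - r‖ ≤ 1 / 20 := by
    rw [sum_norm_scaledPoint_sub hr0.le]
    rw [lt_div_iff₀ (by positivity)] at hζ
    linarith
  have h2 := norm_szegoIntegral_sub_le hr0.le hr h1
  have hne : (szegoConst k r : ℂ) ≠ 0 := by exact_mod_cast hpos.ne'
  rw [div_sub_one hne, norm_div, Complex.norm_real, Real.norm_of_nonneg hpos.le,
    div_le_iff₀ hpos]
  exact h2

theorem norm_scaledPoint_lt {k : ℕ} {r : ℝ} (hr0 : 0 < r) (hr : r ≤ 3 / 4)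
    {ζ : Fin k ⊕ Fin k → ℂ} (hζ : ∑ s, ‖ζ s‖ < 1 / (20 * r)) (s : Fin k ⊕ Fin k) :
    ‖scaledPoint r ζ s‖ < 9 / 10 := by
  have h1 : ‖ζ s‖ < 1 / (20 * r) := (Finset.single_le_sum (f := fun s => ‖ζ s‖)
    (fun _ _ => norm_nonneg _) (Finset.mem_univ s)).trans_lt hζ
  rw [lt_div_iff₀ (by positivity)] at h1
  rw [scaledPoint, norm_mul, Complex.norm_real, Real.norm_of_nonneg hr0.le]
  have h2 : ‖1 + ζ s‖ ≤ 1 + ‖ζ s‖ := (norm_add_le _ _).trans (by rw [norm_one])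
  nlinarith

theorem curveHolomorphicOn_szegoLog {k : ℕ} {r : ℝ} (hr0 : 0 < r) (hr : r ≤ 3 / 4) :
    CurveHolomorphicOn (szegoLog (k := k) r) {ζ | ∑ s, ‖ζ s‖ < 1 / (20 * r)} := by
  have h1 : CurveHolomorphicOn (fun ζ : Fin k ⊕ Fin k → ℂ => szegoIntegral (scaledPoint r ζ))
      {ζ | ∑ s, ‖ζ s‖ < 1 / (20 * r)} :=
    (curveHolomorphicOn_szegoIntegral (by norm_num : (9 / 10 : ℝ) < 1)).comp
      (differentiable_scaledPoint r).differentiableOn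
      fun ζ hζ s => norm_scaledPoint_lt hr0 hr hζ s
  have h2 := h1.postcomp (φ := fun w => w / szegoConst k r) (W := Set.univ)
    (differentiable_id.div_const _).differentiableOn (Set.mapsTo_univ _ _)
  refine h2.postcomp (φ := Complex.log) (W := Complex.slitPlane)
    (fun w hw => (Complex.differentiableAt_log hw).differentiableWithinAt) fun ζ hζ => ?_
  exact mem_slitPlane_of_norm_sub_one_le (norm_szegoIntegral_div_sub_one_le hr0 hr hζ)

theorem szegoLog_zero {k : ℕ} {r : ℝ} (hr0 : 0 < r) (hr : r ≤ 3 / 4) :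
    szegoLog r (0 : Fin k ⊕ Fin k → ℂ) = 0 := by
  have hpos := szegoConst_pos k hr0.le (by linarith : r < 1)
  have hne : (szegoConst k r : ℂ) ≠ 0 := by exact_mod_cast hpos.ne'
  rw [szegoLog, scaledPoint_zero, szegoIntegral_const, div_self hne, Complex.log_one]

/-- An x-displacement of 1/20 corresponds to a ζ-radius 1/(20r), which grows as r shrinks. Schwarz
therefore yields a factor `r` for the size and `r ^ 2` for the mixed part. -/
theorem szegoLog_bounds {k : ℕ} {r : ℝ} (hr0 : 0 < r) (hr : r ≤ 3 / 4)
    {ζ : Fin k ⊕ Fin k → ℂ} (hζ : ∑ s, ‖ζ s‖ < 1 / (20 * r)) :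
    ‖szegoLog r ζ‖ ≤ 20 * r * ∑ s, ‖ζ s‖ ∧
      ‖szegoLog r ζ - ∑ j, szegoLog r (Pi.single j (ζ j))‖ ≤
        1600 * r ^ 2 * (∑ s, ‖ζ s‖) ^ 2 := by
  have h := schwarz_mixed (M := 1) (curveHolomorphicOn_szegoLog (k := k) hr0 hr)
    (fun ζ hζ => by
      rw [szegoLog_zero hr0 hr, sub_zero]
      exact (norm_log_le_of_norm_sub_one_le le_rfl
        (norm_szegoIntegral_div_sub_one_le hr0 hr hζ)).trans (by norm_num)) hζ
  simp only [szegoLog_zero hr0 hr, sub_zero] at h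
  refine ⟨h.1.trans_eq ?_, h.2.trans_eq ?_⟩
  · field_simp
  · field_simp
    ring

/-! ### Logarithm of the product over pairs. -/

/-- The logarithm of a factor of the product over pairs. -/
def pairLog (q : ℝ) (a b : ℂ) : ℂ := Complex.log (1 - q * (1 + a) * (1 + b))

theorem norm_one_sub_pair {q : ℝ} (hq0 : 0 ≤ q) (hq : q ≤ 1 / 2) {a b : ℂ} (ha : ‖a‖ ≤ 1 / 10)
    (hb : ‖b‖ ≤ 1 / 10) : ‖(q : ℂ) * (1 + a) * (1 + b)‖ ≤ 61 / 100 := by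
  rw [norm_mul, norm_mul, Complex.norm_real, Real.norm_of_nonneg hq0]
  have h1 : ‖1 + a‖ ≤ 11 / 10 := (norm_add_le _ _).trans (by rw [norm_one]; linarith)
  have h2 : ‖1 + b‖ ≤ 11 / 10 := (norm_add_le _ _).trans (by rw [norm_one]; linarith)
  calc q * ‖1 + a‖ * ‖1 + b‖ ≤ 1 / 2 * (11 / 10) * (11 / 10) := by gcongr
    _ ≤ _ := by norm_num

theorem one_sub_pair_mem_slitPlane {q : ℝ} (hq0 : 0 ≤ q) (hq : q ≤ 1 / 2) {a b : ℂ}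
    (ha : ‖a‖ ≤ 1 / 10) (hb : ‖b‖ ≤ 1 / 10) :
    1 - (q : ℂ) * (1 + a) * (1 + b) ∈ Complex.slitPlane := by
  have := Complex.mem_slitPlane_of_norm_lt_one (z := -((q : ℂ) * (1 + a) * (1 + b)))
    (by rw [norm_neg]; linarith [norm_one_sub_pair hq0 hq ha hb])
  rwa [← sub_eq_add_neg] at this

theorem le_norm_one_sub_pair {q : ℝ} (hq0 : 0 ≤ q) (hq : q ≤ 1 / 2) {a b : ℂ}
    (ha : ‖a‖ ≤ 1 / 10) (hb : ‖b‖ ≤ 1 / 10) :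
    39 / 100 ≤ ‖1 - (q : ℂ) * (1 + a) * (1 + b)‖ := by
  have := norm_sub_norm_le 1 ((q : ℂ) * (1 + a) * (1 + b))
  rw [norm_one] at this
  linarith [norm_one_sub_pair hq0 hq ha hb]

theorem hasDerivAt_pairLog {q : ℝ} (hq0 : 0 ≤ q) (hq : q ≤ 1 / 2) {a b : ℂ}
    (ha : ‖a‖ ≤ 1 / 10) (hb : ‖b‖ ≤ 1 / 10) :
    HasDerivAt (fun b => pairLog q a b)
      (-(q * (1 + a)) / (1 - (q : ℂ) * (1 + a) * (1 + b))) b := by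
  have h1 : HasDerivAt (fun b : ℂ => 1 - (q : ℂ) * (1 + a) * (1 + b)) (-(q * (1 + a))) b := by
    have := (((hasDerivAt_id b).const_add 1).const_mul ((q : ℂ) * (1 + a))).const_sub 1
    simpa using this
  exact h1.clog (one_sub_pair_mem_slitPlane hq0 hq ha hb)

theorem norm_pairLog_sub_le {q : ℝ} (hq0 : 0 ≤ q) (hq : q ≤ 1 / 2) {a b : ℂ}
    (ha : ‖a‖ ≤ 1 / 10) (hb : ‖b‖ ≤ 1 / 10) : ‖pairLog q a b - pairLog q a 0‖ ≤ 3 * q * ‖b‖ := by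
  have := (convex_closedBall (0 : ℂ) (1 / 10)).norm_image_sub_le_of_norm_hasDerivWithin_le
    (f := fun b => pairLog q a b) (C := 3 * q) (x := 0) (y := b)
    (fun y hy => (hasDerivAt_pairLog hq0 hq ha (mem_closedBall_zero_iff.1 hy)).hasDerivWithinAt)
    (fun y hy => by
      have h1 := le_norm_one_sub_pair hq0 hq ha (mem_closedBall_zero_iff.1 hy)
      have h2 : ‖1 + a‖ ≤ 11 / 10 := (norm_add_le _ _).trans (by rw [norm_one]; linarith)
      rw [norm_div, norm_neg, norm_mul, Complex.norm_real, Real.norm_of_nonneg hq0,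
        div_le_iff₀ (by linarith)]
      nlinarith) (mem_closedBall_self (by norm_num)) (mem_closedBall_zero_iff.2 hb)
  simpa using this

theorem pairLog_comm (q : ℝ) (a b : ℂ) : pairLog q a b = pairLog q b a := by
  rw [pairLog, pairLog]; congr 1; ring

theorem norm_pairLog_sub_zero_le {q : ℝ} (hq0 : 0 ≤ q) (hq : q ≤ 1 / 2) {a b : ℂ}
    (ha : ‖a‖ ≤ 1 / 10) (hb : ‖b‖ ≤ 1 / 10) :
    ‖pairLog q a b - pairLog q 0 0‖ ≤ 3 * q * (‖a‖ + ‖b‖) := by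
  have h1 := norm_pairLog_sub_le hq0 hq ha hb
  have h2 := norm_pairLog_sub_le hq0 hq (a := 0) (by norm_num) ha
  rw [pairLog_comm q 0 a] at h2
  calc _ = ‖(pairLog q a b - pairLog q a 0) + (pairLog q a 0 - pairLog q 0 0)‖ := by
        congr 1; ring
    _ ≤ _ := (norm_add_le _ _).trans (by linarith)

/-- Mean value inequality in `b` for the increment in `a`: its `b`-derivative is a difference of two
fractions with numerator of size q‖a‖. -/
theorem norm_pairLog_second_difference_le {q : ℝ} (hq0 : 0 ≤ q) (hq : q ≤ 1 / 2) {a b : ℂ}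
    (ha : ‖a‖ ≤ 1 / 10) (hb : ‖b‖ ≤ 1 / 10) :
    ‖(pairLog q a b - pairLog q 0 0) - (pairLog q a 0 - pairLog q 0 0) -
      (pairLog q 0 b - pairLog q 0 0)‖ ≤ 7 * q * (‖a‖ * ‖b‖) := by
  -- An opaque name for 0, so that both derivatives keep the same shape.
  obtain ⟨c, hc⟩ : ∃ c : ℂ, c = 0 := ⟨0, rfl⟩
  have h0 : ‖c‖ ≤ 1 / 10 := by rw [hc]; norm_num
  have := (convex_closedBall (0 : ℂ) (1 / 10)).norm_image_sub_le_of_norm_hasDerivWithin_le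
    (f := fun b => pairLog q a b - pairLog q c b) (C := 7 * q * ‖a‖) (x := 0) (y := b)
    (fun y hy => ((hasDerivAt_pairLog hq0 hq ha (mem_closedBall_zero_iff.1 hy)).sub
      (hasDerivAt_pairLog hq0 hq h0 (mem_closedBall_zero_iff.1 hy))).hasDerivWithinAt)
    (fun y hy => by
      rw [mem_closedBall_zero_iff] at hy
      have h1 := le_norm_one_sub_pair hq0 hq ha hy
      have h2 := le_norm_one_sub_pair hq0 hq h0 hy
      have n1 : 1 - (q : ℂ) * (1 + a) * (1 + y) ≠ 0 := norm_pos_iff.1 (by linarith)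
      have n2 : 1 - (q : ℂ) * (1 + c) * (1 + y) ≠ 0 := norm_pos_iff.1 (by linarith)
      have e : -(q * (1 + a)) / (1 - (q : ℂ) * (1 + a) * (1 + y)) -
          -(q * (1 + c)) / (1 - (q : ℂ) * (1 + c) * (1 + y)) =
          -(q * (a - c)) /
            ((1 - (q : ℂ) * (1 + a) * (1 + y)) * (1 - (q : ℂ) * (1 + c) * (1 + y))) := by
        rw [div_sub_div _ _ n1 n2]
        congr 1
        ring
      have h3 : (39 / 100) * (39 / 100) ≤ ‖1 - (q : ℂ) * (1 + a) * (1 + y)‖ *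
          ‖1 - (q : ℂ) * (1 + c) * (1 + y)‖ := by gcongr
      have h4 : 0 ≤ q * ‖a‖ := by positivity
      rw [e, norm_div, norm_neg, norm_mul, norm_mul, Complex.norm_real, Real.norm_of_nonneg hq0,
        div_le_iff₀ (by linarith), show ‖a - c‖ = ‖a‖ by rw [hc, sub_zero]]
      nlinarith [mul_le_mul_of_nonneg_left h3 h4])
    (mem_closedBall_self (by norm_num)) (mem_closedBall_zero_iff.2 hb)
  rw [sub_zero, hc] at this
  calc _ = ‖pairLog q a b - pairLog q 0 b - (pairLog q a 0 - pairLog q 0 0)‖ := by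
        congr 1; ring
    _ ≤ _ := this.trans_eq (by ring)

/-- The logarithm of the normalised product over pairs. -/
def pairProdLog {k : ℕ} (q : ℝ) (ζ : Fin k ⊕ Fin k → ℂ) : ℂ :=
  ∑ i : Fin k, ∑ j : Fin k, (pairLog q (ζ (Sum.inl i)) (ζ (Sum.inr j)) - pairLog q 0 0)

/-- Each variable occurs in k pairs, whence the factor k in the size. Subtracting the one-variable
parts leaves mixed second differences, whose sum factors into a product of two ℓ¹-norms and carries
no k. -/
theorem pairProdLog_bounds {k : ℕ} {q : ℝ} (hq0 : 0 ≤ q) (hq : q ≤ 1 / 2)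
    {ζ : Fin k ⊕ Fin k → ℂ} (hζ : ∑ s, ‖ζ s‖ ≤ 1 / 10) :
    ‖pairProdLog q ζ‖ ≤ 3 * q * k * ∑ s, ‖ζ s‖ ∧
      ‖pairProdLog q ζ - ∑ j, pairProdLog q (Pi.single j (ζ j))‖ ≤
        7 * q * (∑ s, ‖ζ s‖) ^ 2 := by
  have hs : ∀ s, ‖ζ s‖ ≤ 1 / 10 := fun s => (Finset.single_le_sum (f := fun s => ‖ζ s‖)
    (fun _ _ => norm_nonneg _) (Finset.mem_univ s)).trans hζ
  constructor
  · calc _ ≤ ∑ i : Fin k, ∑ j : Fin k, 3 * q * (‖ζ (Sum.inl i)‖ + ‖ζ (Sum.inr j)‖) :=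
          norm_sum_le_of_le _ fun i _ => norm_sum_le_of_le _ fun j _ =>
            norm_pairLog_sub_zero_le hq0 hq (hs _) (hs _)
      _ = _ := by
          simp only [← Finset.mul_sum, Finset.sum_add_distrib, Fintype.sum_sum_type,
            Finset.sum_const, Finset.card_univ, Fintype.card_fin, nsmul_eq_mul]
          ring
  · have hl : ∀ i, pairProdLog q (Pi.single (Sum.inl i) (ζ (Sum.inl i)) : Fin k ⊕ Fin k → ℂ) =
        ∑ _j : Fin k, (pairLog q (ζ (Sum.inl i)) 0 - pairLog q 0 0) := by
      intro i
      rw [pairProdLog, Finset.sum_eq_single i]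
      · simp
      · intro b _ hb
        simp [hb]
      · simp
    have hr : ∀ j, pairProdLog q (Pi.single (Sum.inr j) (ζ (Sum.inr j)) : Fin k ⊕ Fin k → ℂ) =
        ∑ _i : Fin k, (pairLog q 0 (ζ (Sum.inr j)) - pairLog q 0 0) := by
      intro j
      rw [pairProdLog]
      refine Finset.sum_congr rfl fun i _ => ?_
      rw [Finset.sum_eq_single j]
      · simp
      · intro b _ hb
        simp [hb]
      · simp
    have e : pairProdLog q ζ - ∑ j, pairProdLog q (Pi.single j (ζ j)) =
        ∑ i : Fin k, ∑ j : Fin k,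
          ((pairLog q (ζ (Sum.inl i)) (ζ (Sum.inr j)) - pairLog q 0 0) -
            (pairLog q (ζ (Sum.inl i)) 0 - pairLog q 0 0) -
            (pairLog q 0 (ζ (Sum.inr j)) - pairLog q 0 0)) := by
      rw [Fintype.sum_sum_type]
      simp only [hl, hr]
      rw [pairProdLog]
      simp only [Finset.sum_sub_distrib]
      rw [Finset.sum_comm (f := fun (x : Fin k) (_ : Fin k) => pairLog q 0 (ζ (Sum.inr x)))]
      ring
    rw [e]
    calc _ ≤ ∑ i : Fin k, ∑ j : Fin k, 7 * q * (‖ζ (Sum.inl i)‖ * ‖ζ (Sum.inr j)‖) :=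
          norm_sum_le_of_le _ fun i _ => norm_sum_le_of_le _ fun j _ =>
            norm_pairLog_second_difference_le hq0 hq (hs _) (hs _)
      _ = 7 * q * ((∑ i : Fin k, ‖ζ (Sum.inl i)‖) * ∑ j : Fin k, ‖ζ (Sum.inr j)‖) := by
          rw [Finset.sum_mul_sum]
          simp only [← Finset.mul_sum]
      _ ≤ _ := by
          rw [Fintype.sum_sum_type]
          have h1 : 0 ≤ ∑ i : Fin k, ‖ζ (Sum.inl i)‖ := Finset.sum_nonneg fun _ _ => norm_nonneg _
          have h2 : 0 ≤ ∑ i : Fin k, ‖ζ (Sum.inr i)‖ := Finset.sum_nonneg fun _ _ => norm_nonneg _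
          refine mul_le_mul_of_nonneg_left ?_ (by positivity)
          nlinarith

theorem curveHolomorphicOn_pairProdLog {k : ℕ} {q : ℝ} (hq0 : 0 ≤ q) (hq : q ≤ 1 / 2) :
    CurveHolomorphicOn (pairProdLog (k := k) q) {ζ | ∑ s, ‖ζ s‖ ≤ 1 / 10} := by
  refine CurveHolomorphicOn.sum fun i _ => CurveHolomorphicOn.sum fun j _ =>
    CurveHolomorphicOn.of_differentiableOn ?_
  refine DifferentiableOn.sub_const (DifferentiableOn.clog ?_ fun ζ hζ => ?_) _
  · have h : ∀ s, Differentiable ℂ fun ζ : Fin k ⊕ Fin k → ℂ => 1 + ζ s := fun s =>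
      (differentiable_const _).add
        (differentiable_apply (𝕜 := ℂ) (F' := fun _ : Fin k ⊕ Fin k => ℂ) s)
    exact ((differentiable_const _).sub (((differentiable_const _).mul (h _)).mul
      (h _))).differentiableOn
  · have hs : ∀ s, ‖ζ s‖ ≤ 1 / 10 := fun s => (Finset.single_le_sum (f := fun s => ‖ζ s‖)
      (fun _ _ => norm_nonneg _) (Finset.mem_univ s)).trans hζ
    exact one_sub_pair_mem_slitPlane hq0 hq (hs _) (hs _)

/-- A sum of k² principal logarithms need not be the principal logarithm of the product; only the
exponentiated identity is needed. -/
theorem exp_pairProdLog_mul {k : ℕ} {r : ℝ} (hr : r ^ 2 ≤ 1 / 2)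
    {ζ : Fin k ⊕ Fin k → ℂ} (hζ : ∑ s, ‖ζ s‖ ≤ 1 / 10) :
    Complex.exp (pairProdLog (r ^ 2) ζ) * pairProd (scaledPoint r (0 : Fin k ⊕ Fin k → ℂ)) =
      pairProd (scaledPoint r ζ) := by
  have hs : ∀ s, ‖ζ s‖ ≤ 1 / 10 := fun s => (Finset.single_le_sum (f := fun s => ‖ζ s‖)
    (fun _ _ => norm_nonneg _) (Finset.mem_univ s)).trans hζ
  have h0 : ‖(0 : ℂ)‖ ≤ 1 / 10 := by norm_num
  rw [pairProdLog, pairProd, pairProd, Complex.exp_sum, ← Finset.prod_mul_distrib]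
  refine Finset.prod_congr rfl fun i _ => ?_
  rw [Complex.exp_sum, ← Finset.prod_mul_distrib]
  refine Finset.prod_congr rfl fun j _ => ?_
  have n1 := Complex.slitPlane_ne_zero
    (one_sub_pair_mem_slitPlane (sq_nonneg r) hr (hs (Sum.inl i)) (hs (Sum.inr j)))
  have n2 := Complex.slitPlane_ne_zero (one_sub_pair_mem_slitPlane (sq_nonneg r) hr h0 h0)
  have e : ∀ η : Fin k ⊕ Fin k → ℂ, scaledPoint r η (Sum.inl i) * scaledPoint r η (Sum.inr j) =
      ((r ^ 2 : ℝ) : ℂ) * (1 + η (Sum.inl i)) * (1 + η (Sum.inr j)) := fun η => by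
    simp only [scaledPoint]; push_cast; ring
  rw [e, e, Complex.exp_sub, pairLog, pairLog, Complex.exp_log n1, Complex.exp_log n2]
  exact div_mul_cancel₀ _ n2

/-! ### Logarithm of the local factor in rescaled coordinates. -/

/-- A logarithm of the local factor relative to its central value, for all primes. -/
theorem exists_log_scaledFactor {k : ℕ} {r : ℝ} (hr0 : 0 < r) (hr : r ^ 2 ≤ 1 / 2) :
    ∃ G : (Fin k ⊕ Fin k → ℂ) → ℂ, CurveHolomorphicOn G {ζ | ∑ s, ‖ζ s‖ < 1 / 20} ∧
      ∀ ζ : Fin k ⊕ Fin k → ℂ, ∑ s, ‖ζ s‖ < 1 / 20 →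
        Complex.exp (G ζ) * scaledFactor r (0 : Fin k ⊕ Fin k → ℂ) = scaledFactor r ζ ∧
        ‖G ζ‖ ≤ (3 * r ^ 2 * k + 20 * r) * ∑ s, ‖ζ s‖ ∧
        ‖G ζ - ∑ j, G (Pi.single j (ζ j))‖ ≤ 1607 * r ^ 2 * (∑ s, ‖ζ s‖) ^ 2 := by
  have hr34 : r ≤ 3 / 4 := by nlinarith
  have hdom : (1 : ℝ) / 20 ≤ 1 / (20 * r) := by
    apply one_div_le_one_div_of_le (by positivity); linarith
  refine ⟨fun ζ => pairProdLog (r ^ 2) ζ + szegoLog r ζ, ?_, fun ζ hζ => ⟨?_, ?_, ?_⟩⟩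
  · refine ((curveHolomorphicOn_pairProdLog (sq_nonneg r) hr).mono fun ζ hζ => ?_).add
      ((curveHolomorphicOn_szegoLog hr0 hr34).mono fun ζ hζ => ?_)
    · exact (show ∑ s, ‖ζ s‖ < 1 / 20 from hζ).le.trans (by norm_num)
    · exact lt_of_lt_of_le hζ hdom
  · have hpos := szegoConst_pos k hr0.le (by linarith : r < 1)
    have hne : (szegoConst k r : ℂ) ≠ 0 := by exact_mod_cast hpos.ne'
    have h1 := exp_pairProdLog_mul hr (ζ := ζ) (hζ.le.trans (by norm_num))
    have h2 : szegoIntegral (scaledPoint r ζ) / szegoConst k r ≠ 0 :=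
      Complex.slitPlane_ne_zero (mem_slitPlane_of_norm_sub_one_le
        (norm_szegoIntegral_div_sub_one_le hr0 hr34 (hζ.trans_le hdom)))
    rw [Complex.exp_add, scaledFactor, scaledFactor, ← h1, szegoLog, Complex.exp_log h2,
      scaledPoint_zero, szegoIntegral_const]
    field_simp
  · have h1 := (pairProdLog_bounds (sq_nonneg r) hr (ζ := ζ) (hζ.le.trans (by norm_num))).1
    have h2 := (szegoLog_bounds hr0 hr34 (hζ.trans_le hdom)).1
    exact (norm_add_le _ _).trans (by linarith)
  · have h1 := (pairProdLog_bounds (sq_nonneg r) hr (ζ := ζ) (hζ.le.trans (by norm_num))).2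
    have h2 := (szegoLog_bounds hr0 hr34 (hζ.trans_le hdom)).2
    rw [Finset.sum_add_distrib, add_sub_add_comm]
    exact (norm_add_le _ _).trans (by linarith)

theorem norm_scaledFactor_sub_one_le {k : ℕ} {r R : ℝ} (hr0 : 0 < r) (hk : k ≤ R)
    (hR : 3 * r * R ≤ 1 / 4) {ζ : Fin k ⊕ Fin k → ℂ} (hζ : ∑ s, ‖ζ s‖ ≤ R) :
    ‖scaledFactor r ζ - 1‖ ≤ 810 * (r * R) ^ 4 := by
  refine (norm_pairProd_mul_szegoIntegral_sub_one_le hR ?_).trans_eq (by ring)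
  calc ∑ s, ‖scaledPoint r ζ s‖ ≤ ∑ s, r * (1 + ‖ζ s‖) := by
        refine Finset.sum_le_sum fun s _ => ?_
        rw [scaledPoint, norm_mul, Complex.norm_real, Real.norm_of_nonneg hr0.le]
        gcongr
        exact (norm_add_le _ _).trans (by rw [norm_one])
    _ = r * (2 * k + ∑ s, ‖ζ s‖) := by
        rw [← Finset.mul_sum, Finset.sum_add_distrib, Finset.sum_const, Finset.card_univ,
          Fintype.card_sum, Fintype.card_fin, nsmul_eq_mul]
        push_cast
        ring
    _ ≤ 3 * r * R := by nlinarith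

/-- A logarithm of the local factor relative to its central value, for large primes. -/
theorem exists_log_scaledFactor_of_large {k : ℕ} {r R : ℝ} (hr0 : 0 < r) (hk : k ≤ R)
    (hR : 20 * r * R ≤ 1) :
    ∃ G : (Fin k ⊕ Fin k → ℂ) → ℂ, CurveHolomorphicOn G {ζ | ∑ s, ‖ζ s‖ < R} ∧
      ∀ ζ : Fin k ⊕ Fin k → ℂ, ∑ s, ‖ζ s‖ < R →
        Complex.exp (G ζ) * scaledFactor r (0 : Fin k ⊕ Fin k → ℂ) = scaledFactor r ζ ∧
        ‖G ζ‖ ≤ 2430 * (r * R) ^ 4 * ((∑ s, ‖ζ s‖) / R) ∧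
        ‖G ζ - ∑ j, G (Pi.single j (ζ j))‖ ≤
          9720 * (r * R) ^ 4 * ((∑ s, ‖ζ s‖) / R) ^ 2 := by
  rcases (Nat.cast_nonneg (α := ℝ) k).trans hk |>.eq_or_lt with hR0 | hR0
  · refine ⟨0, ⟨continuousOn_const, fun _ _ _ _ _ => differentiableOn_const _⟩, fun ζ hζ => ?_⟩
    rw [← hR0] at hζ
    exact absurd hζ (not_lt.2 (Finset.sum_nonneg fun _ _ => norm_nonneg _))
  have hb : ∀ ζ : Fin k ⊕ Fin k → ℂ, ∑ s, ‖ζ s‖ < R →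
      ‖scaledFactor r ζ - 1‖ ≤ 810 * (r * R) ^ 4 := fun ζ hζ =>
    norm_scaledFactor_sub_one_le hr0 hk (by linarith) hζ.le
  have hsmall : 810 * (r * R) ^ 4 ≤ 1 / 2 := by
    have h1 : r * R ≤ 1 / 20 := by linarith
    have h2 : (r * R) ^ 4 ≤ (1 / 20) ^ 4 := by gcongr
    linarith
  have hslit : ∀ ζ : Fin k ⊕ Fin k → ℂ, ∑ s, ‖ζ s‖ < R → scaledFactor r ζ ∈ Complex.slitPlane :=
    fun ζ hζ => mem_slitPlane_of_norm_sub_one_le ((hb ζ hζ).trans hsmall)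
  have h0 : ∑ s, ‖(0 : Fin k ⊕ Fin k → ℂ) s‖ < R := by simpa using hR0
  set G : (Fin k ⊕ Fin k → ℂ) → ℂ :=
    fun ζ => Complex.log (scaledFactor r ζ) - Complex.log (scaledFactor r 0) with hG
  have hG0 : G 0 = 0 := sub_self _
  have hhol : CurveHolomorphicOn G {ζ | ∑ s, ‖ζ s‖ < R} := by
    have h1 : CurveHolomorphicOn (fun ζ : Fin k ⊕ Fin k → ℂ => szegoIntegral (scaledPoint r ζ))
        {ζ | ∑ s, ‖ζ s‖ < R} := by
      refine (curveHolomorphicOn_szegoIntegral (by norm_num : (9 / 10 : ℝ) < 1)).comp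
        (differentiable_scaledPoint r).differentiableOn fun ζ hζ s => ?_
      have h1 : ‖ζ s‖ < R := (Finset.single_le_sum (f := fun s => ‖ζ s‖)
        (fun _ _ => norm_nonneg _) (Finset.mem_univ s)).trans_lt hζ
      have hk1 : (1 : ℝ) ≤ k := by
        have : 0 < k := by
          rcases Nat.eq_zero_or_pos k with h | h
          · subst h; exact s.elim Fin.elim0 Fin.elim0
          · exact h
        exact_mod_cast this
      rw [scaledPoint, norm_mul, Complex.norm_real, Real.norm_of_nonneg hr0.le]
      have h2 : ‖1 + ζ s‖ ≤ 1 + ‖ζ s‖ := (norm_add_le _ _).trans (by rw [norm_one])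
      calc r * ‖1 + ζ s‖ ≤ r * (R + R) := by gcongr; linarith
        _ < 9 / 10 := by linarith
    have h2 : CurveHolomorphicOn (fun ζ : Fin k ⊕ Fin k → ℂ => pairProd (scaledPoint r ζ))
        {ζ | ∑ s, ‖ζ s‖ < R} := by
      refine CurveHolomorphicOn.of_differentiableOn ?_
      refine differentiableOn_prod fun i _ => differentiableOn_prod fun j _ => ?_
      have h := differentiable_pi.1 (differentiable_scaledPoint (k := k) r)
      exact ((differentiable_const _).sub ((h _).mul (h _))).differentiableOn
    exact ((h2.mul h1).postcomp (φ := Complex.log) (W := Complex.slitPlane)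
      (fun w hw => (Complex.differentiableAt_log hw).differentiableWithinAt) hslit).sub
        ⟨continuousOn_const, fun _ _ _ _ _ => differentiableOn_const _⟩
  have hM : ∀ ζ : Fin k ⊕ Fin k → ℂ, ∑ s, ‖ζ s‖ < R → ‖G ζ - G 0‖ ≤ 2430 * (r * R) ^ 4 := by
    intro ζ hζ
    rw [hG0, sub_zero]
    have h1 := norm_log_le_of_norm_sub_one_le hsmall (hb ζ hζ)
    have h2 := norm_log_le_of_norm_sub_one_le hsmall (hb 0 h0)
    exact (norm_sub_le _ _).trans (by linarith)
  refine ⟨G, hhol, fun ζ hζ => ?_⟩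
  have h := schwarz_mixed hhol hM hζ
  simp only [hG0, sub_zero] at h
  refine ⟨?_, h.1, h.2.trans_eq (by ring)⟩
  have n1 := Complex.slitPlane_ne_zero (hslit ζ hζ)
  have n2 := Complex.slitPlane_ne_zero (hslit 0 h0)
  rw [hG]
  simp only
  rw [Complex.exp_sub, Complex.exp_log n1, Complex.exp_log n2, div_mul_cancel₀ _ n2]

/-! ### Return to the shifts: bounds for each prime. -/

/-- The logarithmic scale attached to `k`. -/
def logScale (k : ℕ) : ℝ := Real.log k + 16

/-- `p^{-1/2}`. -/
def primeRad (p : ℕ) : ℝ := Real.exp (-(Real.log p / 2))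

/-- The sign of a variable in a local factor. -/
def varSign {k : ℕ} : Fin k ⊕ Fin k → ℂ := Sum.elim (fun _ => -1) fun _ => 1

/-- The rescaled coordinates attached to the shifts `z`. -/
def shiftCoord {k : ℕ} (T : ℝ) (z : Fin k ⊕ Fin k → ℂ) : Fin k ⊕ Fin k → ℂ :=
  fun s => Complex.exp (varSign s * T * z s) - 1

theorem norm_varSign {k : ℕ} (s : Fin k ⊕ Fin k) : ‖varSign s‖ = 1 := by
  cases s <;> simp [varSign]

theorem shiftCoord_zero {k : ℕ} (T : ℝ) : shiftCoord T (0 : Fin k ⊕ Fin k → ℂ) = 0 := by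
  ext; simp [shiftCoord]

theorem shiftCoord_single {k : ℕ} (T : ℝ) (j : Fin k ⊕ Fin k) (w : ℂ) :
    shiftCoord T (Pi.single j w) = Pi.single j (Complex.exp (varSign j * T * w) - 1) := by
  ext s
  by_cases h : s = j
  · subst h; simp [shiftCoord]
  · simp [shiftCoord, h]

theorem differentiable_shiftCoord {k : ℕ} (T : ℝ) :
    Differentiable ℂ (shiftCoord (k := k) T) :=
  differentiable_pi.2 fun s => (((differentiable_const _).mul
    (differentiable_apply (𝕜 := ℂ) (F' := fun _ : Fin k ⊕ Fin k => ℂ) s)).cexp).sub_const 1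

theorem norm_exp_sub_one_le_mul_exp (w : ℂ) :
    ‖Complex.exp w - 1‖ ≤ ‖w‖ * Real.exp ‖w‖ := by
  have := Complex.norm_exp_sub_sum_le_norm_mul_exp w 1
  simpa using this

theorem localFactor_eq_scaledFactor {k p : ℕ} (hp : 0 < p) (z : Fin k ⊕ Fin k → ℂ) :
    localFactor k p z = scaledFactor (primeRad p) (shiftCoord (Real.log p) z) := by
  have hp0 : (p : ℂ) ≠ 0 := by exact_mod_cast hp.ne'
  have hcpow : ∀ w : ℂ, (p : ℂ) ^ w = Complex.exp ((Real.log p : ℂ) * w) := fun w => by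
    rw [Complex.cpow_def_of_ne_zero hp0, Complex.natCast_log]
  have hpt : ∀ s, scaledPoint (primeRad p) (shiftCoord (Real.log p) z) s =
      Complex.exp (-((Real.log p : ℂ) / 2) + varSign s * (Real.log p : ℂ) * z s) := fun s => by
    simp only [scaledPoint, shiftCoord, primeRad, add_sub_cancel]
    rw [Complex.exp_add]
    push_cast
    rfl
  rw [localFactor, scaledFactor, pairProd, szegoIntegral]
  congr 1
  · refine Finset.prod_congr rfl fun i _ => Finset.prod_congr rfl fun j _ => ?_
    rw [hcpow, hpt, hpt, ← Complex.exp_add]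
    congr 2
    simp only [varSign, Sum.elim_inl, Sum.elim_inr]
    ring
  · congr 1
    ext θ
    simp only [szego, Fintype.prod_sum_type, rot, Sum.elim_inl, Sum.elim_inr,
      Finset.prod_mul_distrib]
    congr 1
    · refine Finset.prod_congr rfl fun j _ => ?_
      rw [hpt, hcpow, div_eq_mul_inv, ← Complex.exp_neg, circ]
      congr 4
      simp only [varSign, Sum.elim_inl]
      ring
    · refine Finset.prod_congr rfl fun j _ => ?_
      rw [hpt, hcpow, div_eq_mul_inv, ← Complex.exp_neg, circ_neg]
      congr 4
      simp only [varSign, Sum.elim_inr]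
      ring

theorem primeRad_pos (p : ℕ) : 0 < primeRad p := Real.exp_pos _

theorem primeRad_sq {p : ℕ} (hp : 0 < p) : primeRad p ^ 2 = 1 / p := by
  rw [primeRad, ← Real.exp_nat_mul]
  have : ((2 : ℕ) : ℝ) * -(Real.log p / 2) = -Real.log p := by push_cast; ring
  rw [this, Real.exp_neg, Real.exp_log (by exact_mod_cast hp), one_div]

theorem primeRad_sq_le {p : ℕ} (hp : 2 ≤ p) : primeRad p ^ 2 ≤ 1 / 2 := by
  rw [primeRad_sq (by omega)]
  apply one_div_le_one_div_of_le (by norm_num)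
  exact_mod_cast hp

theorem logScale_ge {k : ℕ} (hk : 1 ≤ k) : 16 ≤ logScale k := by
  have := Real.log_nonneg (x := (k : ℝ)) (by exact_mod_cast hk)
  rw [logScale]; linarith

/-- Bound for the logarithm of the local factor at `p`. -/
def localBound (k p : ℕ) : ℝ :=
  if Real.log p ≤ 2 * logScale k then k * (Real.log p / (p * logScale k)) + primeRad p
  else 2430 * k ^ 2 * primeRad p ^ 3

/-- Bound for the part of the logarithm of the local factor at `p` that mixes the variables. -/
def localMixedBound (k p : ℕ) : ℝ :=
  if Real.log p ≤ 2 * logScale k then Real.log p / (p * logScale k)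
  else 9720 * k * primeRad p ^ 3

/-- With log p = yL and y ≥ 2, both claims compare exponents that decrease in y because L ≥ 16. The
shift 16 in `logScale` makes their values at y = 2 equal to -14 and -8. -/
theorem large_prime_estimates {k p : ℕ} (hk : 1 ≤ k) (hp : 2 * logScale k < Real.log p) :
    20 * primeRad p * (k * Real.exp (Real.log p / logScale k)) ≤ 1 ∧
      (primeRad p * (k * Real.exp (Real.log p / logScale k))) ^ 4 ≤ k ^ 3 * primeRad p ^ 3 := by
  have hL := logScale_ge hk
  have hk0 : (0 : ℝ) < k := by exact_mod_cast hk
  have hkL : (k : ℝ) = Real.exp (logScale k - 16) := by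
    rw [logScale, add_sub_cancel_right, Real.exp_log hk0]
  set L := logScale k
  set T := Real.log p
  have hL0 : 0 < L := by linarith
  obtain ⟨y, hy⟩ : ∃ y, y = T / L := ⟨_, rfl⟩
  have hTy : T = y * L := by rw [hy]; field_simp
  have hy2 : 2 ≤ y := by rw [hy, le_div_iff₀ hL0]; linarith
  rw [← hy]
  constructor
  · have h1 : primeRad p * (k * Real.exp y) ≤ Real.exp (-14) := by
      rw [hkL, primeRad, ← Real.exp_add, ← Real.exp_add]
      refine Real.exp_le_exp.2 ?_
      change -(T / 2) + (L - 16 + y) ≤ -14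
      nlinarith
    have h2 : Real.exp (-14) ≤ 1 / 20 := by
      rw [Real.exp_neg, one_div]
      refine inv_anti₀ (by norm_num) ?_
      have h3 := Real.add_one_le_exp (7 : ℝ)
      have h4 : Real.exp 14 = Real.exp 7 * Real.exp 7 := by rw [← Real.exp_add]; norm_num
      nlinarith
    linarith
  · have h1 : k * Real.exp (4 * y) * primeRad p ≤ 1 := by
      rw [hkL, primeRad, ← Real.exp_add, ← Real.exp_add, ← Real.exp_zero]
      refine Real.exp_le_exp.2 ?_
      change L - 16 + 4 * y + -(T / 2) ≤ 0
      nlinarith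
    have h2 : (primeRad p * (k * Real.exp y)) ^ 4 =
        k * Real.exp (4 * y) * primeRad p * (k ^ 3 * primeRad p ^ 3) := by
      rw [show 4 * y = ((4 : ℕ) : ℝ) * y by norm_num, Real.exp_nat_mul]
      ring
    rw [h2]
    have := primeRad_pos p
    exact mul_le_of_le_one_left (by positivity) h1

theorem norm_localFactor_zero_sub_one_le {k p : ℕ} (hk : 1 ≤ k) (hp0 : 0 < p)
    (hp : 2 * logScale k < Real.log p) :
    ‖localFactor k p 0 - 1‖ ≤ 810 * (k ^ 3 * primeRad p ^ 3) := by
  obtain ⟨h1, h2⟩ := large_prime_estimates hk hp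
  have hL := logScale_ge hk
  have hR : (k : ℝ) ≤ k * Real.exp (Real.log p / logScale k) :=
    le_mul_of_one_le_right (Nat.cast_nonneg _) (Real.one_le_exp (div_nonneg (by linarith)
      (by linarith)))
  rw [localFactor_eq_scaledFactor hp0, shiftCoord_zero]
  refine (norm_scaledFactor_sub_one_le (primeRad_pos p) hR (by linarith) ?_).trans (by linarith)
  simp only [Pi.zero_apply, norm_zero, Finset.sum_const_zero]
  positivity

/-- A holomorphic logarithm of the local factor relative to its central value, with bounds for
its size and for its mixed part. -/
theorem exists_local_log {k p : ℕ} (hk : 1 ≤ k) (hp : 2 ≤ p) :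
    ∃ g : (Fin k ⊕ Fin k → ℂ) → ℂ,
      CurveHolomorphicOn g {z | ∑ s, ‖z s‖ < 1 / (400 * logScale k)} ∧ g 0 = 0 ∧
      ∀ z : Fin k ⊕ Fin k → ℂ, ∑ s, ‖z s‖ < 1 / (400 * logScale k) →
        Complex.exp (g z) * localFactor k p 0 = localFactor k p z ∧
        ‖g z‖ ≤ localBound k p ∧
        ‖g z - ∑ j, g (Pi.single j (z j))‖ ≤ localMixedBound k p := by
  have hL := logScale_ge hk
  have hp0 : 0 < p := by omega
  have hp0' : (0 : ℝ) < p := by exact_mod_cast hp0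
  have hk0 : (0 : ℝ) < k := by exact_mod_cast hk
  have hr0 := primeRad_pos p
  have hrsq := primeRad_sq hp0
  have hT0 : 0 < Real.log p := Real.log_pos (by exact_mod_cast hp)
  set L := logScale k with hLdef
  set T := Real.log p with hTdef
  set r := primeRad p with hrdef
  have hL0 : 0 < L := by linarith
  have hy0 : 0 < T / L := by positivity
  have hterm : ∀ z : Fin k ⊕ Fin k → ℂ, ∀ s, ‖varSign s * T * z s‖ = T * ‖z s‖ := fun z s => by
    rw [norm_mul, norm_mul, norm_varSign, one_mul, Complex.norm_real, Real.norm_of_nonneg hT0.le]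
  have hsum : ∀ z : Fin k ⊕ Fin k → ℂ, ∑ s, ‖z s‖ < 1 / (400 * L) →
      T * ∑ s, ‖z s‖ < T / L / 400 := fun z hz => by
    calc T * ∑ s, ‖z s‖ < T * (1 / (400 * L)) := by gcongr
      _ = _ := by field_simp
  have hterm' : ∀ z : Fin k ⊕ Fin k → ℂ, ∑ s, ‖z s‖ < 1 / (400 * L) → ∀ s,
      ‖varSign s * T * z s‖ ≤ T / L / 400 := fun z hz s => by
    rw [hterm]
    refine le_trans ?_ (hsum z hz).le
    gcongr
    exact Finset.single_le_sum (f := fun s => ‖z s‖) (fun _ _ => norm_nonneg _)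
      (Finset.mem_univ s)
  have hcompose : ∀ (G : (Fin k ⊕ Fin k → ℂ) → ℂ) (R : ℝ),
      CurveHolomorphicOn G {ζ | ∑ s, ‖ζ s‖ < R} →
      (∀ z : Fin k ⊕ Fin k → ℂ, ∑ s, ‖z s‖ < 1 / (400 * L) → ∑ s, ‖shiftCoord T z s‖ < R) →
      CurveHolomorphicOn (fun z => G (shiftCoord T z)) {z | ∑ s, ‖z s‖ < 1 / (400 * L)} :=
    fun G R hG hR => hG.comp (differentiable_shiftCoord T).differentiableOn fun z hz => hR z hz
  have hsingle : ∀ z : Fin k ⊕ Fin k → ℂ, ∀ j,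
      shiftCoord T (Pi.single j (z j)) = Pi.single j (shiftCoord T z j) := fun z j => by
    rw [shiftCoord_single]; rfl
  -- For p ≤ e^{2L} the exponents are at most 1/200, and σ ≤ T/(200L) lies well inside the ball of
  -- radius 1/20.
  by_cases hT : T ≤ 2 * L
  · have hy2 : T / L ≤ 2 := by rwa [div_le_iff₀ hL0]
    have hN : ∀ z : Fin k ⊕ Fin k → ℂ, ∑ s, ‖z s‖ < 1 / (400 * L) →
        ∑ s, ‖shiftCoord T z s‖ ≤ T / L / 200 := fun z hz => by
      calc ∑ s, ‖shiftCoord T z s‖ ≤ ∑ s, 2 * (T * ‖z s‖) := by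
            refine Finset.sum_le_sum fun s _ => ?_
            rw [← hterm]
            exact Complex.norm_exp_sub_one_le ((hterm' z hz s).trans (by linarith))
        _ = 2 * (T * ∑ s, ‖z s‖) := by rw [← Finset.mul_sum, ← Finset.mul_sum]
        _ ≤ _ := by linarith [hsum z hz]
    obtain ⟨G, hG, hGb⟩ := exists_log_scaledFactor (k := k) hr0 (primeRad_sq_le hp)
    have hG0 : G (shiftCoord T 0) = 0 := by
      rw [shiftCoord_zero]
      have := (hGb 0 (by simp)).2.1
      simpa using this
    have hdom : ∀ z : Fin k ⊕ Fin k → ℂ, ∑ s, ‖z s‖ < 1 / (400 * L) →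
        ∑ s, ‖shiftCoord T z s‖ < 1 / 20 := fun z hz => (hN z hz).trans_lt (by linarith)
    refine ⟨fun z => G (shiftCoord T z), hcompose G _ hG hdom, hG0, fun z hz => ?_⟩
    obtain ⟨e1, e2, e3⟩ := hGb _ (hdom z hz)
    have hN0 : 0 ≤ ∑ s, ‖shiftCoord T z s‖ := Finset.sum_nonneg fun _ _ => norm_nonneg _
    have hq : T / (p * L) = r ^ 2 * (T / L) := by rw [hrsq]; field_simp
    refine ⟨?_, ?_, ?_⟩
    · rw [localFactor_eq_scaledFactor hp0, localFactor_eq_scaledFactor hp0, shiftCoord_zero]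
      exact e1
    · rw [localBound, if_pos hT, hq]
      calc _ ≤ (3 * r ^ 2 * k + 20 * r) * (T / L / 200) := by
            refine e2.trans ?_
            gcongr
            exact hN z hz
        _ ≤ k * (r ^ 2 * (T / L)) + r := by
            have h1 : 0 ≤ k * (r ^ 2 * (T / L)) := by positivity
            nlinarith
    · rw [localMixedBound, if_pos hT, hq]
      simp only [hsingle]
      calc _ ≤ 1607 * r ^ 2 * (T / L / 200) ^ 2 := by
            refine e3.trans ?_
            gcongr
            exact hN z hz
        _ = r ^ 2 * (T / L) * (1607 / 40000 * (T / L)) := by ring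
        _ ≤ r ^ 2 * (T / L) * 1 := by gcongr; linarith
        _ = _ := mul_one _
  · rw [not_le] at hT
    obtain ⟨h1, h2⟩ := large_prime_estimates hk hT
    rw [← hTdef, ← hLdef, ← hrdef] at h1 h2
    -- The actual ℓ¹-norm stays below e^{T/L} = R/k, so Schwarz on the larger ball gains 1/k, and
    -- 1/k² for the mixed part.
    set R := k * Real.exp (T / L) with hR
    have hk1 : (1 : ℝ) ≤ k := by exact_mod_cast hk
    have hkR : (k : ℝ) ≤ R := le_mul_of_one_le_right hk0.le (Real.one_le_exp hy0.le)
    have hR0 : 0 < R := hk0.trans_le hkR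
    have hN : ∀ z : Fin k ⊕ Fin k → ℂ, ∑ s, ‖z s‖ < 1 / (400 * L) →
        ∑ s, ‖shiftCoord T z s‖ < Real.exp (T / L) := fun z hz => by
      calc ∑ s, ‖shiftCoord T z s‖ ≤ ∑ s, T * ‖z s‖ * Real.exp (T / L / 400) := by
            refine Finset.sum_le_sum fun s _ => (norm_exp_sub_one_le_mul_exp _).trans ?_
            have := hterm' z hz s
            rw [hterm] at this ⊢
            gcongr
        _ = (T * ∑ s, ‖z s‖) * Real.exp (T / L / 400) := by
            rw [← Finset.sum_mul, ← Finset.mul_sum]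
        _ < Real.exp (T / L / 400) * Real.exp (T / L / 400) := by
            gcongr
            have := Real.add_one_le_exp (T / L / 400)
            linarith [hsum z hz]
        _ ≤ Real.exp (T / L) := by
            rw [← Real.exp_add]
            exact Real.exp_le_exp.2 (by linarith)
    have hdom : ∀ z : Fin k ⊕ Fin k → ℂ, ∑ s, ‖z s‖ < 1 / (400 * L) →
        ∑ s, ‖shiftCoord T z s‖ < R := fun z hz =>
      (hN z hz).trans_le (le_mul_of_one_le_left (Real.exp_pos _).le hk1)
    obtain ⟨G, hG, hGb⟩ := exists_log_scaledFactor_of_large (k := k) hr0 hkR h1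
    have hG0 : G (shiftCoord T 0) = 0 := by
      rw [shiftCoord_zero]
      have := (hGb 0 (by simp; positivity)).2.1
      simpa using this
    refine ⟨fun z => G (shiftCoord T z), hcompose G _ hG hdom, hG0, fun z hz => ?_⟩
    obtain ⟨e1, e2, e3⟩ := hGb _ (hdom z hz)
    have hN0 : 0 ≤ ∑ s, ‖shiftCoord T z s‖ := Finset.sum_nonneg fun _ _ => norm_nonneg _
    have hratio : (∑ s, ‖shiftCoord T z s‖) / R ≤ 1 / k := by
      rw [div_le_div_iff₀ hR0 hk0, one_mul, hR, mul_comm]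
      exact mul_le_mul_of_nonneg_left (hN z hz).le hk0.le
    have hratio0 : 0 ≤ (∑ s, ‖shiftCoord T z s‖) / R := by positivity
    refine ⟨?_, ?_, ?_⟩
    · rw [localFactor_eq_scaledFactor hp0, localFactor_eq_scaledFactor hp0, shiftCoord_zero]
      exact e1
    · rw [localBound, if_neg (not_le.2 hT)]
      calc _ ≤ 2430 * (k ^ 3 * r ^ 3) * (1 / k) := by
            refine e2.trans ?_
            gcongr
        _ = _ := by rw [← hrdef]; field_simp
    · rw [localMixedBound, if_neg (not_le.2 hT)]
      simp only [hsingle]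
      calc _ ≤ 9720 * (k ^ 3 * r ^ 3) * (1 / k) ^ 2 := by
            refine e3.trans ?_
            gcongr
        _ = _ := by rw [← hrdef]; field_simp

/-! ### Sums over primes. -/

/-- Mertens' upper bound for `∑ log p / p`. -/
theorem sum_log_div_prime_le {N : ℕ} {S : Finset ℕ} (hS : ∀ p ∈ S, p.Prime ∧ p ≤ N) :
    ∑ p ∈ S, Real.log p / p ≤ Real.log N + Real.log 4 := by
  rcases Nat.eq_zero_or_pos N with rfl | hN
  · have : S = ∅ := Finset.eq_empty_of_forall_notMem fun p hp => by
      have := (hS p hp).1.pos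
      have := (hS p hp).2
      omega
    rw [this]
    simpa using Real.log_nonneg (by norm_num : (1 : ℝ) ≤ 4)
  have hN' : (0 : ℝ) < N := by exact_mod_cast hN
  have hlog : ∀ p ∈ S, 0 ≤ Real.log p := fun p hp =>
    Real.log_nonneg (by exact_mod_cast (hS p hp).1.one_lt.le)
  -- Legendre: the exponent of p in N! is at least ⌊N/p⌋. Replacing the floor by N/p costs at most ∑
  -- log p ≤ N log 4 by Chebyshev.
  have h1 : ∑ p ∈ S, ((N / p : ℕ) : ℝ) * Real.log p ≤ Real.log (N.factorial) := by
    rw [Real.log_nat_eq_sum_factorization, Finsupp.sum]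
    have hsub : S ⊆ (N.factorial).factorization.support := fun p hp => by
      rw [Nat.support_factorization, Nat.mem_primeFactors]
      exact ⟨(hS p hp).1, (hS p hp).1.dvd_factorial.2 (hS p hp).2, N.factorial_ne_zero⟩
    refine le_trans (Finset.sum_le_sum fun p hp => ?_)
      (Finset.sum_le_sum_of_subset_of_nonneg hsub fun p hp _ =>
        mul_nonneg (Nat.cast_nonneg _) (Real.log_natCast_nonneg _))
    refine mul_le_mul_of_nonneg_right ?_ (hlog p hp)
    rw [Nat.factorization_factorial (hS p hp).1 (b := Nat.log p N + 1) (Nat.lt_succ_self _)]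
    have hmem : 1 ∈ Finset.Ico 1 (Nat.log p N + 1) := by
      have := Nat.log_pos (hS p hp).1.one_lt (hS p hp).2
      exact Finset.mem_Ico.2 ⟨le_rfl, by omega⟩
    have := Finset.single_le_sum (f := fun i => N / p ^ i) (fun _ _ => Nat.zero_le _) hmem
    simp only [pow_one] at this
    exact_mod_cast this
  have h2 : Real.log (N.factorial) ≤ N * Real.log N := by
    rw [← Real.log_pow]
    refine Real.log_le_log (by exact_mod_cast N.factorial_pos) ?_
    exact_mod_cast N.factorial_le_pow
  have h3 : ∑ p ∈ S, Real.log p ≤ Real.log 4 * N := by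
    refine le_trans ?_ (Chebyshev.theta_le_log4_mul_x hN'.le)
    rw [Chebyshev.theta_eq_sum_primesLE_log]
    refine Finset.sum_le_sum_of_subset_of_nonneg (fun p hp => ?_) fun p _ _ =>
      Real.log_natCast_nonneg p
    exact Nat.mem_primesLE.2 ⟨(hS p hp).2, (hS p hp).1⟩
  have h4 : ∑ p ∈ S, (N : ℝ) * (Real.log p / p) ≤
      ∑ p ∈ S, (((N / p : ℕ) : ℝ) * Real.log p + Real.log p) := by
    refine Finset.sum_le_sum fun p hp => ?_
    have hp0 : (0 : ℝ) < p := by exact_mod_cast (hS p hp).1.pos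
    have h5 : (N : ℝ) / p ≤ (N / p : ℕ) + 1 := by
      rw [div_le_iff₀ hp0]
      have := Nat.lt_div_mul_add (a := N) (hS p hp).1.pos
      have h6 : ((N : ℕ) : ℝ) < ((N / p * p + p : ℕ) : ℝ) := by exact_mod_cast this
      push_cast at h6
      linarith
    calc (N : ℝ) * (Real.log p / p) = N / p * Real.log p := by ring
      _ ≤ ((N / p : ℕ) + 1) * Real.log p := mul_le_mul_of_nonneg_right h5 (hlog p hp)
      _ = _ := by ring
  rw [← Finset.mul_sum, Finset.sum_add_distrib] at h4
  have h7 : (N : ℝ) * ∑ p ∈ S, Real.log p / p ≤ N * (Real.log N + Real.log 4) := by linarith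
  exact le_of_mul_le_mul_left h7 hN'

theorem primeRad_eq {n : ℕ} (hn : 0 < n) : primeRad n = 1 / √n := by
  rw [primeRad, Real.exp_neg, Real.exp_half, Real.exp_log (by exact_mod_cast hn), one_div]

theorem sum_primeRad_le {N : ℕ} {S : Finset ℕ} (hS : ∀ n ∈ S, 0 < n ∧ n ≤ N) :
    ∑ n ∈ S, primeRad n ≤ 2 * √N := by
  have h : ∀ N : ℕ, ∑ i ∈ Finset.range N, primeRad (i + 1) ≤ 2 * √N := by
    intro N
    induction N with
    | zero => simp
    | succ n ih =>
      rw [Finset.sum_range_succ, primeRad_eq n.succ_pos]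
      have h1 : 0 < √((n + 1 : ℕ) : ℝ) := Real.sqrt_pos.2 (by positivity)
      have h2 : 0 ≤ √(n : ℝ) := Real.sqrt_nonneg _
      have h3 : √((n + 1 : ℕ) : ℝ) ^ 2 = n + 1 := by rw [Real.sq_sqrt (by positivity)]; push_cast; ring
      have h4 : √(n : ℝ) ^ 2 = n := Real.sq_sqrt (by positivity)
      have h5 : 1 / √((n + 1 : ℕ) : ℝ) ≤ 2 * √((n + 1 : ℕ) : ℝ) - 2 * √(n : ℝ) := by
        rw [div_le_iff₀ h1]
        nlinarith [sq_nonneg (√((n + 1 : ℕ) : ℝ) - √(n : ℝ))]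
      linarith
  refine le_trans ?_ (h N)
  rw [Finset.range_eq_Ico, Finset.sum_Ico_add' (fun n => primeRad n) 0 N 1]
  refine Finset.sum_le_sum_of_subset_of_nonneg (fun n hn => ?_) fun n _ _ => (primeRad_pos n).le
  have := hS n hn
  simp
  omega

/-- Telescoping over all integers: (n+1)^{-3/2} ≤ 2(n^{-1/2} - (n+1)^{-1/2}). -/
theorem sum_primeRad_cube_le {N : ℕ} (hN : 0 < N) {S : Finset ℕ} (hS : ∀ n ∈ S, N < n) :
    ∑ n ∈ S, primeRad n ^ 3 ≤ 2 * primeRad N := by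
  have h : ∀ m : ℕ, ∑ i ∈ Finset.range m, primeRad (N + 1 + i) ^ 3 ≤
      2 * primeRad N - 2 * primeRad (N + m) := by
    intro m
    induction m with
    | zero => simp
    | succ n ih =>
      rw [Finset.sum_range_succ, show N + 1 + n = N + n + 1 by ring,
        show N + (n + 1) = N + n + 1 by ring]
      have hpos : 0 < N + n := by omega
      set M := N + n
      have hx : primeRad (M + 1) ^ 2 = 1 / ((M : ℝ) + 1) := by
        rw [primeRad_sq M.succ_pos]; push_cast; rfl
      have hy : primeRad M ^ 2 = 1 / (M : ℝ) := primeRad_sq hpos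
      have hx0 := primeRad_pos (M + 1)
      have hy0 := primeRad_pos M
      set x := primeRad (M + 1)
      set y := primeRad M
      have hM : (0 : ℝ) < M := by exact_mod_cast hpos
      have hd : y ^ 2 - x ^ 2 = x ^ 2 * y ^ 2 := by
        rw [hx, hy]; field_simp; ring
      have hxy : x ≤ y := by
        refine le_of_sq_le_sq ?_ hy0.le
        nlinarith [mul_pos (pow_pos hx0 2) (pow_pos hy0 2)]
      have h1 : x ^ 3 ≤ 2 * (y - x) := by
        have h2 : (y - x) * (y + x) = x ^ 2 * y ^ 2 := by rw [← hd]; ring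
        have h3 : x ^ 2 * y ^ 2 ≤ (y - x) * (2 * y) := by
          rw [← h2]; exact mul_le_mul_of_nonneg_left (by linarith) (by linarith)
        have h4 : x ^ 2 * y ≤ 2 * (y - x) := by
          refine le_of_mul_le_mul_right ?_ hy0
          nlinarith
        nlinarith [mul_le_mul_of_nonneg_left hxy (sq_nonneg x)]
      linarith
  obtain ⟨m, hm⟩ : ∃ m, ∀ n ∈ S, n < N + 1 + m := ⟨S.sup id, fun n hn => by
    have := Finset.le_sup (f := id) hn
    simp only [id] at this
    omega⟩
  have h1 := h m
  have h2 : ∑ n ∈ S, primeRad n ^ 3 ≤ ∑ i ∈ Finset.range m, primeRad (N + 1 + i) ^ 3 := by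
    have h3 := Finset.sum_Ico_eq_sum_range (fun n => primeRad n ^ 3) (N + 1) (N + 1 + m)
    rw [Nat.add_sub_cancel_left] at h3
    rw [← h3]
    refine Finset.sum_le_sum_of_subset_of_nonneg (fun n hn => ?_)
      fun n _ _ => (pow_pos (primeRad_pos n) 3).le
    have := hS n hn
    have := hm n hn
    simp
    omega
  linarith [primeRad_pos (N + m)]

/-- The cutoff e^{2L} = e^{32}k² balances the ranges: Mertens divided by L is bounded, √N is of
order k below the cutoff, and the tail of n^{-3/2} is of order 1/k above it. -/
theorem sum_small_large_le {k : ℕ} (hk : 1 ≤ k) (s : Finset Nat.Primes) :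
    ∑ p ∈ s.filter fun p : Nat.Primes => Real.log (p : ℕ) ≤ 2 * logScale k, Real.log (p : ℕ) / ((p : ℕ) * logScale k) ≤ 3 ∧
    ∑ p ∈ s.filter fun p : Nat.Primes => Real.log (p : ℕ) ≤ 2 * logScale k, primeRad p ≤ 2 * Real.exp 16 * k ∧
    ∑ p ∈ s.filter fun p : Nat.Primes => ¬ Real.log (p : ℕ) ≤ 2 * logScale k, primeRad p ^ 3 ≤ 4 / k := by
  have hL := logScale_ge hk
  have hk0 : (0 : ℝ) < k := by exact_mod_cast hk
  have heL : Real.exp (logScale k) = Real.exp 16 * k := by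
    rw [logScale, Real.exp_add, Real.exp_log hk0, mul_comm]
  set L := logScale k
  set N := ⌊Real.exp (2 * L)⌋₊ with hN
  have he1 : 1 ≤ Real.exp (2 * L) := Real.one_le_exp (by linarith)
  have hN1 : 1 ≤ N := Nat.le_floor (by simpa using he1)
  have hN0 : (0 : ℝ) < N := by exact_mod_cast hN1
  have hNle : (N : ℝ) ≤ Real.exp (2 * L) := Nat.floor_le (by positivity)
  have hNge : Real.exp (2 * L) < N + 1 := Nat.lt_floor_add_one _
  have hsmall : ∀ p : Nat.Primes, Real.log (p : ℕ) ≤ 2 * L ↔ (p : ℕ) ≤ N := fun p => by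
    rw [Real.log_le_iff_le_exp (by exact_mod_cast p.2.pos), hN, Nat.le_floor_iff (by positivity)]
  have hsq : Real.exp (2 * L) = Real.exp L ^ 2 := by rw [← Real.exp_nat_mul]; norm_num
  have himg : ∀ (P : Nat.Primes → Prop) [DecidablePred P] (f : ℕ → ℝ),
      ∑ p ∈ s.filter P, f p = ∑ n ∈ (s.filter P).map ⟨fun p : Nat.Primes => (p : ℕ), Subtype.val_injective⟩, f n :=
    fun P _ f => by rw [Finset.sum_map]; rfl
  refine ⟨?_, ?_, ?_⟩
  · have h1 := sum_log_div_prime_le (N := N) (S := (s.filter fun p : Nat.Primes =>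
      Real.log (p : ℕ) ≤ 2 * L).map ⟨fun p : Nat.Primes => (p : ℕ), Subtype.val_injective⟩) fun n hn => by
        obtain ⟨p, hp, rfl⟩ := Finset.mem_map.1 hn
        exact ⟨p.2, (hsmall p).1 (Finset.mem_filter.1 hp).2⟩
    rw [← himg _ fun n => Real.log n / n] at h1
    have h2 : ∑ p ∈ s.filter fun p : Nat.Primes => Real.log (p : ℕ) ≤ 2 * L, Real.log (p : ℕ) / ((p : ℕ) * L) =
        (∑ p ∈ s.filter fun p : Nat.Primes => Real.log (p : ℕ) ≤ 2 * L, Real.log (p : ℕ) / (p : ℕ)) / L := by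
      rw [Finset.sum_div]
      exact Finset.sum_congr rfl fun p _ => by rw [div_div]
    rw [h2, div_le_iff₀ (by linarith)]
    have h3 : Real.log N ≤ 2 * L := (Real.log_le_iff_le_exp hN0).2 hNle
    have h4 : Real.log 4 ≤ 4 - 1 := Real.log_le_sub_one_of_pos (by norm_num)
    linarith
  · rw [himg _ fun n => primeRad n]
    refine (sum_primeRad_le (N := N) fun n hn => ?_).trans ?_
    · obtain ⟨p, hp, rfl⟩ := Finset.mem_map.1 hn
      exact ⟨p.2.pos, (hsmall p).1 (Finset.mem_filter.1 hp).2⟩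
    · rw [mul_assoc, ← heL]
      refine mul_le_mul_of_nonneg_left ?_ (by norm_num)
      rw [Real.sqrt_le_iff]
      exact ⟨(Real.exp_pos _).le, hNle.trans_eq hsq⟩
  · rw [himg _ fun n => primeRad n ^ 3]
    refine (sum_primeRad_cube_le hN1 fun n hn => ?_).trans ?_
    · obtain ⟨p, hp, rfl⟩ := Finset.mem_map.1 hn
      exact not_le.1 fun h => (Finset.mem_filter.1 hp).2 ((hsmall p).2 h)
    · rw [primeRad_eq hN1]
      have h1 : (k : ℝ) / 2 ≤ √N := by
        refine Real.le_sqrt_of_sq_le ?_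
        have h2 : (k : ℝ) ≤ Real.exp L := by
          rw [heL]; exact le_mul_of_one_le_left hk0.le (Real.one_le_exp (by norm_num))
        have h4 : (k : ℝ) ^ 2 ≤ Real.exp L ^ 2 := pow_le_pow_left₀ hk0.le h2 2
        have h5 : (1 : ℝ) ≤ N := by exact_mod_cast hN1
        rw [hsq] at hNge
        nlinarith
      have h3 : 0 < √(N : ℝ) := Real.sqrt_pos.2 hN0
      rw [mul_one_div, div_le_div_iff₀ h3 hk0]
      linarith

/-- The constant in the bounds for sums over primes. -/
def sumConst : ℝ := 2 * Real.exp 16 + 38880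

theorem localBound_nonneg {k p : ℕ} (hk : 1 ≤ k) : 0 ≤ localBound k p := by
  have := logScale_ge hk
  have := primeRad_pos p
  have := Real.log_natCast_nonneg p
  rw [localBound]
  split_ifs <;> positivity

theorem localMixedBound_nonneg {k p : ℕ} (hk : 1 ≤ k) : 0 ≤ localMixedBound k p := by
  have := logScale_ge hk
  have := primeRad_pos p
  have := Real.log_natCast_nonneg p
  rw [localMixedBound]
  split_ifs <;> positivity

theorem sum_localBound_le {k : ℕ} (hk : 1 ≤ k) (s : Finset Nat.Primes) :
    ∑ p ∈ s, localBound k p ≤ sumConst * k := by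
  obtain ⟨h1, h2, h3⟩ := sum_small_large_le hk s
  have hk0 : (0 : ℝ) < k := by exact_mod_cast hk
  simp only [localBound]
  rw [Finset.sum_ite, Finset.sum_add_distrib, ← Finset.mul_sum, ← Finset.mul_sum]
  have h4 : (k : ℝ) * ∑ p ∈ s.filter fun p : Nat.Primes => Real.log (p : ℕ) ≤ 2 * logScale k,
      Real.log (p : ℕ) / ((p : ℕ) * logScale k) ≤ k * 3 := mul_le_mul_of_nonneg_left h1 hk0.le
  have h5 : (2430 : ℝ) * k ^ 2 * ∑ p ∈ s.filter fun p : Nat.Primes => ¬ Real.log (p : ℕ) ≤ 2 * logScale k,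
      primeRad p ^ 3 ≤ 2430 * k ^ 2 * (4 / k) := mul_le_mul_of_nonneg_left h3 (by positivity)
  have h6 : (2430 : ℝ) * k ^ 2 * (4 / k) = 9720 * k := by field_simp; norm_num
  rw [sumConst]
  linarith

theorem sum_localMixedBound_le {k : ℕ} (hk : 1 ≤ k) (s : Finset Nat.Primes) :
    ∑ p ∈ s, localMixedBound k p ≤ sumConst := by
  obtain ⟨h1, h2, h3⟩ := sum_small_large_le hk s
  have hk0 : (0 : ℝ) < k := by exact_mod_cast hk
  simp only [localMixedBound]
  rw [Finset.sum_ite, ← Finset.mul_sum]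
  have h5 : (9720 : ℝ) * k * ∑ p ∈ s.filter fun p : Nat.Primes => ¬ Real.log (p : ℕ) ≤ 2 * logScale k,
      primeRad p ^ 3 ≤ 9720 * k * (4 / k) := mul_le_mul_of_nonneg_left h3 (by positivity)
  have h6 : (9720 : ℝ) * k * (4 / k) = 38880 := by field_simp; norm_num
  have h7 := Real.one_le_exp (by norm_num : (0 : ℝ) ≤ 16)
  have h8 := Real.add_one_le_exp (16 : ℝ)
  rw [sumConst]
  linarith

theorem summable_primeRad_cube : Summable fun p : Nat.Primes => primeRad p ^ 3 := by
  refine summable_of_sum_le (c := 2) (fun p => (pow_pos (primeRad_pos p) 3).le) fun s => ?_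
  have h := sum_primeRad_cube_le one_pos (S := s.map ⟨fun p : Nat.Primes => (p : ℕ), Subtype.val_injective⟩)
    fun n hn => by
      obtain ⟨p, hp, rfl⟩ := Finset.mem_map.1 hn
      exact p.2.one_lt
  rw [Finset.sum_map] at h
  refine h.trans ?_
  simp [primeRad]

/-! ### Hypergeometric values of the local integral; here k = m + 1. -/

theorem hasSum_choose_mul_pow (m : ℕ) {x : ℂ} (hx : ‖x‖ < 1) :
    HasSum (fun n => ((n + m).choose m : ℂ) * x ^ n) ((1 - x)⁻¹ ^ (m + 1)) := by
  have := hasSum_choose_mul_geometric_of_norm_lt_one m hx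
  rwa [one_div, ← inv_pow] at this

theorem summable_norm_choose_mul_pow (m : ℕ) {r : ℝ} (hr0 : 0 ≤ r) (hr : r < 1) :
    Summable fun n => ‖((n + m).choose m : ℂ) * (r : ℂ) ^ n‖ :=
  (hasSum_choose_mul_pow m (by rwa [Complex.norm_real, Real.norm_of_nonneg hr0])).summable.norm

theorem norm_circ_mul_lt {r : ℝ} (hr0 : 0 ≤ r) (hr : r < 1) (θ : ℝ) : ‖circ θ * r‖ < 1 := by
  rwa [norm_mul, norm_circ, one_mul, Complex.norm_real, Real.norm_of_nonneg hr0]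

theorem continuous_inv_one_sub_circ {r : ℝ} (hr0 : 0 ≤ r) (hr : r < 1) (n : ℕ) :
    Continuous fun θ => (1 - circ (-θ) * r)⁻¹ ^ n :=
  ((continuous_const.sub ((continuous_circ.comp continuous_neg).mul continuous_const)).inv₀
    fun θ => one_sub_circ_mul_ne_zero hr0 hr (-θ)).pow n

theorem hasSum_circ_series (m : ℕ) {r : ℝ} (hr0 : 0 ≤ r) (hr : r < 1) (θ : ℝ) :
    HasSum (fun n => ((n + m).choose m * (r : ℂ) ^ n) * circ θ ^ n)
      ((1 - circ θ * r)⁻¹ ^ (m + 1)) := by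
  refine (hasSum_choose_mul_pow m (norm_circ_mul_lt hr0 hr θ)).congr_fun fun n => ?_
  rw [mul_pow]; ring

theorem hypergeometric_one_eq (m : ℕ) (q : ℝ) :
    ordinaryHypergeometric ((m + 1 : ℕ) : ℝ) ((m + 1 : ℕ) : ℝ) (1 : ℝ) q =
      ∑' n : ℕ, ((n + m).choose m : ℝ) ^ 2 * q ^ n := by
  rw [ordinaryHypergeometric_eq_tsum]
  refine tsum_congr fun n => ?_
  have h1 : (ascPochhammer ℝ n).eval (1 : ℝ) = n.factorial := by
    have := ascPochhammer_nat_eq_natCast_ascFactorial ℝ 1 n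
    rwa [Nat.one_ascFactorial, Nat.cast_one] at this
  have h2 : (ascPochhammer ℝ n).eval ((m + 1 : ℕ) : ℝ) = n.factorial * (n + m).choose m := by
    rw [ascPochhammer_nat_eq_natCast_ascFactorial, Nat.ascFactorial_eq_factorial_mul_choose,
      Nat.cast_mul, Nat.add_comm m n, Nat.choose_symm_add]
  have h3 : (n.factorial : ℝ) ≠ 0 := by exact_mod_cast n.factorial_ne_zero
  rw [h1, h2, smul_eq_mul]
  field_simp

/-- The prefactor k turns each term into a coefficient of (1-x)^{-k-1} times a shifted coefficient
of (1-x)^{-k}, the form in which Parseval produces it. -/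
theorem hypergeometric_two_eq (m : ℕ) (q : ℝ) :
    ((m + 1 : ℕ) : ℝ) * ordinaryHypergeometric (((m + 1 : ℕ) : ℝ) + 1) (((m + 1 : ℕ) : ℝ) + 1)
      (2 : ℝ) q =
      ∑' n : ℕ, ((n + (m + 1)).choose (m + 1) : ℝ) * ((n + 1 + m).choose m : ℝ) * q ^ n := by
  rw [ordinaryHypergeometric_eq_tsum, ← tsum_mul_left]
  refine tsum_congr fun n => ?_
  have h1 : (ascPochhammer ℝ n).eval (2 : ℝ) = (n + 1).factorial := by
    have := ascPochhammer_nat_eq_natCast_ascFactorial ℝ 2 n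
    have h := Nat.factorial_mul_ascFactorial 1 n
    rw [Nat.factorial_one, one_mul, add_comm] at h
    rw [add_comm n 1, ← h]
    exact_mod_cast this
  have h2 : (ascPochhammer ℝ n).eval (((m + 1 : ℕ) : ℝ) + 1) =
      n.factorial * (n + (m + 1)).choose (m + 1) := by
    have := ascPochhammer_nat_eq_natCast_ascFactorial ℝ (m + 1 + 1) n
    rw [Nat.ascFactorial_eq_factorial_mul_choose, Nat.cast_mul, Nat.add_comm (m + 1) n,
      Nat.choose_symm_add] at this
    rw [← this]
    push_cast
    rfl
  have h3 : (n.factorial : ℝ) ≠ 0 := by exact_mod_cast n.factorial_ne_zero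
  have h4 : ((n + 1 + m).choose m : ℝ) * (n + 1) = (n + (m + 1)).choose (m + 1) * (m + 1) := by
    have := Nat.choose_succ_right_eq (n + 1 + m) m
    rw [show n + 1 + m - m = n + 1 by omega] at this
    rw [show n + (m + 1) = n + 1 + m by ring]
    exact_mod_cast this.symm
  have h5 : ((n : ℝ) + 1) ≠ 0 := by positivity
  rw [h1, h2, smul_eq_mul, Nat.factorial_succ]
  push_cast
  field_simp
  linear_combination -((n + (m + 1)).choose (m + 1) : ℝ) * q ^ n * h4

/-- Parseval for (1-x)^{-k} paired with its conjugate on the circle of radius r. -/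
theorem szegoConst_eq (m : ℕ) {r : ℝ} (hr0 : 0 ≤ r) (hr : r < 1) :
    szegoConst (m + 1) r =
      ordinaryHypergeometric ((m + 1 : ℕ) : ℝ) ((m + 1 : ℕ) : ℝ) (1 : ℝ) (r ^ 2) := by
  have h := hasSum_integral_circ (summable_norm_choose_mul_pow m hr0 hr)
    (summable_norm_choose_mul_pow m hr0 hr) (hasSum_circ_series m hr0 hr)
    (fun θ => hasSum_circ_series m hr0 hr (-θ)) (continuous_inv_one_sub_circ hr0 hr _)
  have h1 : ∫ θ in (0 : ℝ)..1, (1 - circ θ * r)⁻¹ ^ (m + 1) * (1 - circ (-θ) * r)⁻¹ ^ (m + 1) =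
      szegoConst (m + 1) r := by
    rw [← szegoIntegral_const, szegoIntegral]
    congr 1
    ext θ
    simp [szego, Fintype.prod_sum_type, rot, mul_comm]
  rw [h1] at h
  rw [hypergeometric_one_eq]
  have h2 : HasSum (fun n => ((((n + m).choose m : ℝ) ^ 2 * (r ^ 2) ^ n : ℝ) : ℂ))
      (szegoConst (m + 1) r : ℂ) := by
    refine h.congr_fun fun n => ?_
    push_cast
    ring
  exact (Complex.hasSum_ofReal.1 h2).tsum_eq.symm

/-! ### First derivative of the local factor at the centre. -/

/-- The point with all coordinates `r`, except for the coordinate `s`. -/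
def nearConst {k : ℕ} (r : ℝ) (s : Fin k ⊕ Fin k) (w : ℂ) : Fin k ⊕ Fin k → ℂ :=
  Function.update (fun _ => (r : ℂ)) s w

theorem integral_deriv_szego (m : ℕ) {r : ℝ} (hr0 : 0 ≤ r) (hr : r < 1) :
    ∫ θ in (0 : ℝ)..1, circ θ * (1 - circ θ * r)⁻¹ ^ (m + 2) * (1 - circ (-θ) * r)⁻¹ ^ (m + 1) =
      ((r * (((m + 1 : ℕ) : ℝ) * ordinaryHypergeometric (((m + 1 : ℕ) : ℝ) + 1)
        (((m + 1 : ℕ) : ℝ) + 1) (2 : ℝ) (r ^ 2)) : ℝ) : ℂ) := by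
  -- The extra factor e(θ) shifts the Fourier coefficients by one; the constant coefficient is set
  -- to 0, so truncated subtraction does no harm.
  set p : ℕ → ℂ := fun n => if n = 0 then 0 else ((n - 1 + (m + 1)).choose (m + 1) : ℂ) * r ^ (n - 1)
    with hp
  have hp1 : ∀ n, p (n + 1) = ((n + (m + 1)).choose (m + 1) : ℂ) * r ^ n := fun n => by simp [hp]
  have hp0 : p 0 = 0 := by simp [hp]
  have h := hasSum_integral_circ (p := p)
    (P := fun θ => circ θ * (1 - circ θ * r)⁻¹ ^ (m + 2)) ?_
    (summable_norm_choose_mul_pow m hr0 hr) ?_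
    (fun θ => hasSum_circ_series m hr0 hr (-θ)) (continuous_inv_one_sub_circ hr0 hr _)
  · rw [← hasSum_nat_add_iff' 1] at h
    simp only [Finset.range_one, Finset.sum_singleton, hp0, zero_mul, sub_zero, hp1] at h
    have h2 : HasSum (fun n => ((r * (((n + (m + 1)).choose (m + 1) : ℝ) *
        ((n + 1 + m).choose m : ℝ) * (r ^ 2) ^ n) : ℝ) : ℂ))
        (∫ θ in (0 : ℝ)..1, circ θ * (1 - circ θ * r)⁻¹ ^ (m + 2) *
          (1 - circ (-θ) * r)⁻¹ ^ (m + 1)) := by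
      refine h.congr_fun fun n => ?_
      push_cast
      ring
    rw [← h2.tsum_eq, ← Complex.ofReal_tsum, tsum_mul_left, hypergeometric_two_eq]
  · refine (summable_nat_add_iff 1).1 ?_
    simp only [hp1]
    exact summable_norm_choose_mul_pow (m + 1) hr0 hr
  · intro θ
    rw [← hasSum_nat_add_iff' 1]
    simp only [Finset.range_one, Finset.sum_singleton, hp0, zero_mul, sub_zero, hp1]
    refine ((hasSum_circ_series (m + 1) hr0 hr θ).mul_left (circ θ)).congr_fun fun n => ?_
    ring

theorem hasDerivAt_szegoIntegral_nearConst {m : ℕ} {r : ℝ} (hr0 : 0 ≤ r) (hr : r < 1)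
    (i : Fin (m + 1)) :
    HasDerivAt (fun w => szegoIntegral (nearConst r (Sum.inl i) w))
      ((r * (((m + 1 : ℕ) : ℝ) * ordinaryHypergeometric (((m + 1 : ℕ) : ℝ) + 1)
        (((m + 1 : ℕ) : ℝ) + 1) (2 : ℝ) (r ^ 2)) : ℝ) : ℂ) r := by
  have hd : Differentiable ℂ (nearConst (k := m + 1) r (Sum.inl i)) := by
    refine differentiable_pi.2 fun s => ?_
    by_cases h : s = Sum.inl i
    · subst h; simp [nearConst]
    · simp [nearConst, h]
  have h := hasDerivAt_szegoIntegral (ρ := (1 + r) / 2) (by linarith)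
    (isOpen_ball (x := (r : ℂ)) (ε := (1 - r) / 2)) hd.differentiableOn (fun t ht s => ?_)
    (mem_ball_self (by linarith))
  · rw [← integral_deriv_szego m hr0 hr]
    convert h using 1
    congr 1
    ext θ
    have h1 : ∀ w, szego (nearConst r (Sum.inl i) w) θ = (1 - circ θ * w)⁻¹ *
        ∏ s ∈ Finset.univ.erase (Sum.inl i), (1 - rot θ s * (r : ℂ))⁻¹ := fun w => by
      rw [szego, ← Finset.mul_prod_erase _ _ (Finset.mem_univ (Sum.inl i))]
      congr 1
      · simp [nearConst, rot]
      · refine Finset.prod_congr rfl fun s hs => ?_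
        rw [nearConst, Function.update_of_ne (Finset.ne_of_mem_erase hs)]
    have h2 : szego (fun _ : Fin (m + 1) ⊕ Fin (m + 1) => (r : ℂ)) θ =
        (1 - circ θ * r)⁻¹ ^ (m + 1) * (1 - circ (-θ) * r)⁻¹ ^ (m + 1) := by
      simp [szego, Fintype.prod_sum_type, rot, mul_comm]
    have h3 : nearConst r (Sum.inl i) (r : ℂ) = fun _ => (r : ℂ) := by simp [nearConst]
    have h4 := h1 r
    rw [h3, h2] at h4
    have hne := one_sub_circ_mul_ne_zero hr0 hr θ
    have h5 : HasDerivAt (fun w : ℂ => (1 - circ θ * w)⁻¹) (circ θ * (1 - circ θ * r)⁻¹ ^ 2) r := by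
      have := (((hasDerivAt_id (r : ℂ)).const_mul (circ θ)).const_sub 1).fun_inv hne
      refine this.congr_deriv ?_
      simp only [id]
      field_simp
    have h6 := (h5.mul_const (∏ s ∈ Finset.univ.erase (Sum.inl i),
      (1 - rot θ s * (r : ℂ))⁻¹)).deriv
    simp only [h1]
    rw [h6]
    linear_combination circ θ * (1 - circ θ * r)⁻¹ * h4
  · rw [mem_ball, dist_eq_norm] at ht
    by_cases hs : s = Sum.inl i
    · subst hs
      have := norm_le_norm_add_norm_sub' t (r : ℂ)
      rw [Complex.norm_real, Real.norm_of_nonneg hr0] at this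
      simp only [nearConst, Function.update_self]
      linarith
    · simp only [nearConst, Function.update_of_ne hs, Complex.norm_real, Real.norm_of_nonneg hr0]
      linarith

theorem pairProd_nearConst {m : ℕ} (r : ℝ) (i : Fin (m + 1)) (w : ℂ) :
    pairProd (nearConst r (Sum.inl i) w) =
      (1 - w * r) ^ (m + 1) * (1 - (r : ℂ) ^ 2) ^ ((m + 1) * m) := by
  rw [pairProd, ← Finset.mul_prod_erase _ _ (Finset.mem_univ i)]
  congr 1
  · simp [nearConst]
  · have : ∀ i' ∈ Finset.univ.erase i, ∏ j : Fin (m + 1),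
        (1 - nearConst r (Sum.inl i) w (Sum.inl i') * nearConst r (Sum.inl i) w (Sum.inr j)) =
        (1 - (r : ℂ) ^ 2) ^ (m + 1) := fun i' hi' => by
      have h : (Sum.inl i' : Fin (m + 1) ⊕ Fin (m + 1)) ≠ Sum.inl i := fun h =>
        Finset.ne_of_mem_erase hi' (Sum.inl_injective h)
      simp [nearConst, h, sq]
    rw [Finset.prod_congr rfl this, Finset.prod_const, Finset.card_erase_of_mem (Finset.mem_univ i),
      Finset.card_univ, Fintype.card_fin, ← pow_mul, Nat.add_sub_cancel]

/-- The product whose value at `scaledPoint r ζ` is `scaledFactor r ζ`. -/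
def rawFactor {k : ℕ} (x : Fin k ⊕ Fin k → ℂ) : ℂ := pairProd x * szegoIntegral x

/-- The reflection θ ↦ 1 - θ exchanges the two groups of variables, so only derivatives in the first
group need computing. -/
theorem rawFactor_swap {k : ℕ} (x : Fin k ⊕ Fin k → ℂ) :
    rawFactor (fun s => x s.swap) = rawFactor x := by
  rw [rawFactor, rawFactor]
  congr 1
  · simp only [pairProd, Sum.swap_inl, Sum.swap_inr]
    rw [Finset.prod_comm]
    exact Finset.prod_congr rfl fun i _ => Finset.prod_congr rfl fun j _ => by rw [mul_comm]
  · simp only [szegoIntegral]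
    have h1 : ∀ θ : ℝ, szego (fun s => x s.swap) θ = szego x (1 - θ) := fun θ => by
      have h2 : circ (1 - θ) = circ (-θ) := by
        rw [circ, circ, show (2 * Real.pi * Complex.I * ((1 - θ : ℝ) : ℂ) : ℂ) =
          2 * Real.pi * Complex.I * ((-θ : ℝ) : ℂ) + 2 * Real.pi * Complex.I by push_cast; ring,
          Complex.exp_periodic]
      have h3 : circ (-(1 - θ)) = circ θ := by
        rw [circ, circ, show (2 * Real.pi * Complex.I * ((-(1 - θ) : ℝ) : ℂ) : ℂ) =
          2 * Real.pi * Complex.I * (θ : ℂ) - 2 * Real.pi * Complex.I by push_cast; ring,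
          Complex.exp_periodic.sub_eq]
      simp only [szego, Fintype.prod_sum_type, rot, Sum.elim_inl, Sum.elim_inr, Sum.swap_inl,
        Sum.swap_inr, h2, h3]
      rw [mul_comm]
    simp only [h1]
    rw [intervalIntegral.integral_comp_sub_left (fun θ => szego x θ) 1]
    simp

theorem rawFactor_nearConst_inr {k : ℕ} (r : ℝ) (j : Fin k) (w : ℂ) :
    rawFactor (nearConst r (Sum.inr j) w) = rawFactor (nearConst r (Sum.inl j) w) := by
  rw [← rawFactor_swap]
  congr 1
  ext s
  cases s <;> simp [nearConst, Function.update_apply]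

theorem primeRad_lt_one {p : ℕ} (hp : 2 ≤ p) : primeRad p < 1 := by
  have h := primeRad_sq_le hp
  have h0 := primeRad_pos p
  nlinarith

theorem rawFactor_const {k : ℕ} (r : ℝ) :
    rawFactor (fun _ : Fin k ⊕ Fin k => (r : ℂ)) =
      (((1 - r ^ 2) ^ (k ^ 2) * szegoConst k r : ℝ) : ℂ) := by
  rw [rawFactor, szegoIntegral_const, pairProd]
  simp only [Finset.prod_const, Finset.card_univ, Fintype.card_fin]
  push_cast
  rw [← pow_mul, sq k, sq (r : ℂ)]

theorem localFactor_eq_rawFactor {k p : ℕ} (hp : 0 < p) (z : Fin k ⊕ Fin k → ℂ) :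
    localFactor k p z = rawFactor fun s =>
      (primeRad p : ℂ) * Complex.exp (varSign s * Real.log p * z s) := by
  rw [localFactor_eq_scaledFactor hp, scaledFactor, rawFactor]
  have : scaledPoint (primeRad p) (shiftCoord (Real.log p) z) = fun s =>
      (primeRad p : ℂ) * Complex.exp (varSign s * Real.log p * z s) := by
    ext s; simp [scaledPoint, shiftCoord]
  rw [this]

theorem localFactor_zero_eq {k p : ℕ} (hp : 0 < p) :
    localFactor k p 0 = (((1 - 1 / (p : ℝ)) ^ (k ^ 2) * szegoConst k (primeRad p) : ℝ) : ℂ) := by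
  rw [localFactor_eq_rawFactor hp, ← primeRad_sq hp, ← rawFactor_const]
  simp

/-- The central value of the local factor, as a real number. -/
def centralValue (k p : ℕ) : ℝ :=
  (1 - 1 / (p : ℝ)) ^ (k ^ 2) * ordinaryHypergeometric (k : ℝ) (k : ℝ) (1 : ℝ) (1 / (p : ℝ))

theorem szegoConst_primeRad {k p : ℕ} (hk : 1 ≤ k) (hp : 2 ≤ p) :
    szegoConst k (primeRad p) = ordinaryHypergeometric (k : ℝ) (k : ℝ) (1 : ℝ) (1 / (p : ℝ)) := by
  obtain ⟨m, rfl⟩ := Nat.exists_eq_add_of_le' hk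
  rw [szegoConst_eq m (primeRad_pos p).le (primeRad_lt_one hp), primeRad_sq (by omega)]

theorem localFactor_zero_eq_centralValue {k p : ℕ} (hk : 1 ≤ k) (hp : 2 ≤ p) :
    localFactor k p 0 = centralValue k p := by
  rw [localFactor_zero_eq (by omega), szegoConst_primeRad hk hp, centralValue]

theorem hypergeometric_pos {k p : ℕ} (hk : 1 ≤ k) (hp : 2 ≤ p) :
    0 < ordinaryHypergeometric (k : ℝ) (k : ℝ) (1 : ℝ) (1 / (p : ℝ)) := by
  rw [← szegoConst_primeRad hk hp]
  exact szegoConst_pos k (primeRad_pos p).le (primeRad_lt_one hp)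

theorem one_sub_one_div_pos {p : ℕ} (hp : 2 ≤ p) : 0 < 1 - 1 / (p : ℝ) := by
  have h2 : (2 : ℝ) ≤ p := by exact_mod_cast hp
  rw [sub_pos, div_lt_one (by linarith)]
  linarith

theorem centralValue_pos {k p : ℕ} (hk : 1 ≤ k) (hp : 2 ≤ p) : 0 < centralValue k p :=
  mul_pos (pow_pos (one_sub_one_div_pos hp) _) (hypergeometric_pos hk hp)

theorem hasDerivAt_rawFactor_nearConst {m : ℕ} {r : ℝ} (hr0 : 0 ≤ r) (hr : r < 1)
    (s : Fin (m + 1) ⊕ Fin (m + 1)) :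
    HasDerivAt (fun w => rawFactor (nearConst r s w))
      ((-((m + 1 : ℕ) : ℝ) * r * (1 - r ^ 2) ^ (m + (m + 1) * m) * szegoConst (m + 1) r +
        (1 - r ^ 2) ^ ((m + 1) ^ 2) * (r * (((m + 1 : ℕ) : ℝ) *
          ordinaryHypergeometric (((m + 1 : ℕ) : ℝ) + 1) (((m + 1 : ℕ) : ℝ) + 1) (2 : ℝ)
            (r ^ 2))) : ℝ) : ℂ) r := by
  have key : ∀ i : Fin (m + 1), HasDerivAt (fun w => rawFactor (nearConst r (Sum.inl i) w))
      ((-((m + 1 : ℕ) : ℝ) * r * (1 - r ^ 2) ^ (m + (m + 1) * m) * szegoConst (m + 1) r +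
        (1 - r ^ 2) ^ ((m + 1) ^ 2) * (r * (((m + 1 : ℕ) : ℝ) *
          ordinaryHypergeometric (((m + 1 : ℕ) : ℝ) + 1) (((m + 1 : ℕ) : ℝ) + 1) (2 : ℝ)
            (r ^ 2))) : ℝ) : ℂ) r := fun i => by
    have h1 : HasDerivAt (fun w : ℂ => pairProd (nearConst r (Sum.inl i) w))
        (((m + 1 : ℕ) : ℂ) * (1 - r * r) ^ m * (-r) * (1 - (r : ℂ) ^ 2) ^ ((m + 1) * m)) r := by
      simp only [pairProd_nearConst]
      have h2 : HasDerivAt (fun w : ℂ => 1 - w * r) (-(r : ℂ)) r := by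
        simpa using ((hasDerivAt_id (r : ℂ)).mul_const (r : ℂ)).const_sub 1
      exact (h2.pow (m + 1)).mul_const _
    have h3 := h1.mul (hasDerivAt_szegoIntegral_nearConst hr0 hr i)
    have h4 : nearConst r (Sum.inl i) (r : ℂ) = fun _ => (r : ℂ) := by simp [nearConst]
    refine h3.congr_deriv ?_
    rw [pairProd_nearConst, h4, szegoIntegral_const]
    push_cast
    ring
  cases s with
  | inl i => exact key i
  | inr j => simpa only [rawFactor_nearConst_inr] using key j

/-- Chain rule through x_s = r exp(± z_s log p), whose derivative at 0 is ± r log p; multiplied by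
the factor r in the x-derivative it gives (log p)/p. -/
theorem hasDerivAt_localFactor {k p : ℕ} (hk : 1 ≤ k) (hp : 2 ≤ p) (s : Fin k ⊕ Fin k) :
    HasDerivAt (fun t : ℂ => localFactor k p (t • Pi.single s 1))
      (-varSign s * bTerm k p * localFactor k p 0) 0 := by
  have hp0 : 0 < p := by omega
  rw [localFactor_zero_eq_centralValue hk hp]
  have hF := hypergeometric_pos hk hp
  have hS := szegoConst_primeRad hk hp
  have hr := primeRad_sq hp0
  have h1p := one_sub_one_div_pos hp
  obtain ⟨m, rfl⟩ := Nat.exists_eq_add_of_le' hk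
  have hpt : ∀ t : ℂ, (fun s' : Fin (m + 1) ⊕ Fin (m + 1) => (primeRad p : ℂ) *
      Complex.exp (varSign s' * Real.log p * (t • Pi.single s (1 : ℂ) : _ → ℂ) s')) =
      nearConst (primeRad p) s (primeRad p * Complex.exp (varSign s * Real.log p * t)) := by
    intro t
    ext s'
    by_cases h : s' = s
    · subst h; simp [nearConst]
    · simp [nearConst, h]
  simp only [localFactor_eq_rawFactor hp0, hpt]
  have h1 : HasDerivAt (fun t : ℂ => (primeRad p : ℂ) * Complex.exp (varSign s * Real.log p * t))
      (primeRad p * (varSign s * Real.log p)) 0 := by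
    have := (((hasDerivAt_id (0 : ℂ)).const_mul (varSign s * (Real.log p : ℂ))).cexp).const_mul
      (primeRad p : ℂ)
    simpa using this
  have h2 := hasDerivAt_rawFactor_nearConst (primeRad_pos p).le (primeRad_lt_one hp) s
  have h3 : (primeRad p : ℂ) * Complex.exp (varSign s * Real.log p * 0) = primeRad p := by simp
  rw [← h3] at h2
  have h4 := h2.comp (0 : ℂ) h1
  refine h4.congr_deriv ?_
  have hp1 : (p : ℝ) - 1 ≠ 0 := by
    have : (2 : ℝ) ≤ p := by exact_mod_cast hp
    linarith
  have hpne : (p : ℝ) ≠ 0 := by positivity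
  have hmain : (-((m + 1 : ℕ) : ℝ) * primeRad p * (1 - primeRad p ^ 2) ^ (m + (m + 1) * m) *
      szegoConst (m + 1) (primeRad p) +
        (1 - primeRad p ^ 2) ^ ((m + 1) ^ 2) * (primeRad p * (((m + 1 : ℕ) : ℝ) *
          ordinaryHypergeometric (((m + 1 : ℕ) : ℝ) + 1) (((m + 1 : ℕ) : ℝ) + 1) (2 : ℝ)
            (primeRad p ^ 2)))) * (primeRad p * Real.log p) =
      -(bTerm (m + 1) p * centralValue (m + 1) p) := by
    rw [hS, bTerm, centralValue]
    have e1 : (m + 1) ^ 2 = (m + (m + 1) * m) + 1 := by ring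
    rw [e1, pow_succ _ (m + (m + 1) * m), pow_succ _ (m + (m + 1) * m), hr]
    set F := ordinaryHypergeometric ((m + 1 : ℕ) : ℝ) ((m + 1 : ℕ) : ℝ) (1 : ℝ) (1 / (p : ℝ))
    set F2 := ordinaryHypergeometric (((m + 1 : ℕ) : ℝ) + 1) (((m + 1 : ℕ) : ℝ) + 1) (2 : ℝ)
      (1 / (p : ℝ))
    set X := (1 - 1 / (p : ℝ)) ^ (m + (m + 1) * m)
    have e2 : 1 - 1 / (p : ℝ) = (p - 1) / p := by field_simp
    rw [e2]
    calc _ = primeRad p ^ 2 * ((m + 1 : ℕ) : ℝ) * Real.log p * X *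
          (-F + (p - 1) / p * F2) := by ring
      _ = _ := by rw [hr]; field_simp; ring
  have hmain' := congrArg (fun x : ℝ => (x : ℂ)) hmain
  simp only [Complex.ofReal_mul, Complex.ofReal_neg] at hmain'
  linear_combination varSign s * hmain'

/-- Differentiate the exponentiated identity at 0 and cancel the nonzero central value; no choice of
branch enters. -/
theorem hasDerivAt_local_log {k p : ℕ} (hk : 1 ≤ k) (hp : 2 ≤ p)
    {g : (Fin k ⊕ Fin k → ℂ) → ℂ} {δ : ℝ} (hδ : 0 < δ)
    (hg : CurveHolomorphicOn g {z | ∑ s, ‖z s‖ < δ}) (hg0 : g 0 = 0)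
    (hexp : ∀ z : Fin k ⊕ Fin k → ℂ, ∑ s, ‖z s‖ < δ →
      Complex.exp (g z) * localFactor k p 0 = localFactor k p z) (s : Fin k ⊕ Fin k) :
    DifferentiableOn ℂ (fun t : ℂ => g (t • Pi.single s 1)) (ball 0 δ) ∧
      deriv (fun t : ℂ => g (t • Pi.single s 1)) 0 = -varSign s * bTerm k p := by
  have hm : ∀ t ∈ ball (0 : ℂ) δ,
      ∑ s', ‖(t • Pi.single s (1 : ℂ) : Fin k ⊕ Fin k → ℂ) s'‖ < δ := fun t ht => by
    rw [mem_ball_zero_iff] at ht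
    rw [Finset.sum_eq_single s]
    · simpa using ht
    · intro b _ hb; simp [hb]
    · simp
  have hd : DifferentiableOn ℂ (fun t : ℂ => g (t • Pi.single s 1)) (ball 0 δ) :=
    hg.2 (fun t : ℂ => t • Pi.single s 1) _ isOpen_ball
      (differentiable_id.smul_const _).differentiableOn hm
  refine ⟨hd, ?_⟩
  have h1 := (hd.differentiableAt (isOpen_ball.mem_nhds (mem_ball_self hδ))).hasDerivAt
  have h2 := h1.cexp.mul_const (localFactor k p 0)
  have h3 := hasDerivAt_localFactor hk hp s
  have h4 : (fun t : ℂ => Complex.exp (g (t • Pi.single s 1)) * localFactor k p 0) =ᶠ[𝓝 0]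
      fun t : ℂ => localFactor k p (t • Pi.single s 1) := by
    filter_upwards [isOpen_ball.mem_nhds (mem_ball_self hδ)] with t ht using hexp _ (hm t ht)
  have h5 := (h2.congr_of_eventuallyEq h4.symm).unique h3
  have hne : localFactor k p 0 ≠ 0 := by
    rw [localFactor_zero_eq_centralValue hk hp]
    exact_mod_cast (centralValue_pos hk hp).ne'
  rw [zero_smul, hg0, Complex.exp_zero, one_mul] at h5
  exact mul_right_cancel₀ hne h5

/-! ### The Euler product and its logarithm. -/

theorem finite_primes_log_le (x : ℝ) : {p : Nat.Primes | Real.log (p : ℕ) ≤ x}.Finite := by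
  refine Set.Finite.subset ((Set.finite_Iic ⌊Real.exp x⌋₊).preimage
    (Subtype.val_injective (p := Nat.Prime)).injOn) fun p hp => ?_
  have h : Real.log (p : ℕ) ≤ x := hp
  rw [Real.log_le_iff_le_exp (by exact_mod_cast p.2.pos)] at h
  exact Nat.le_floor h

/-- Outside finitely many primes, the central value differs from 1 by O_k(p^{-3/2}). -/
theorem summable_log_centralValue {k : ℕ} (hk : 1 ≤ k) :
    Summable fun p : Nat.Primes => Real.log (centralValue k p) := by
  have h : Summable fun p : Nat.Primes => centralValue k p - 1 := by
    refine Summable.of_norm_bounded_eventually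
      (g := fun p : Nat.Primes => 810 * (k ^ 3 * primeRad p ^ 3))
      ((summable_primeRad_cube.mul_left _).mul_left _) ?_
    filter_upwards [(finite_primes_log_le (2 * logScale k)).compl_mem_cofinite] with p hp
    have hp' : 2 * logScale k < Real.log (p : ℕ) := not_le.1 hp
    have := norm_localFactor_zero_sub_one_le hk p.2.pos hp'
    rw [localFactor_zero_eq_centralValue hk p.2.two_le] at this
    rwa [← Complex.ofReal_one, ← Complex.ofReal_sub, Complex.norm_real] at this
  have := Real.summable_log_one_add_of_summable h
  simpa using this

theorem exp_tsum_log_centralValue {k : ℕ} (hk : 1 ≤ k) :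
    Real.exp (∑' p : Nat.Primes, Real.log (centralValue k p)) = aConst k :=
  Real.rexp_tsum_eq_tprod (fun p : Nat.Primes => centralValue_pos hk p.2.two_le)
    (summable_log_centralValue hk)

theorem aConst_pos {k : ℕ} (hk : 1 ≤ k) : 0 < aConst k := by
  rw [← exp_tsum_log_centralValue hk]
  exact Real.exp_pos _

/-- The logarithm of the arithmetic factor relative to its central value. -/
theorem exists_log_arithFactor {k : ℕ} (hk : 1 ≤ k) :
    (Summable fun p : Nat.Primes => bTerm k p) ∧
    ∃ f : (Fin k ⊕ Fin k → ℂ) → ℂ,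
      CurveHolomorphicOn f {z | ∑ s, ‖z s‖ < 1 / (400 * logScale k)} ∧ f 0 = 0 ∧
      (∀ s, HasDerivAt (fun t : ℂ => f (t • Pi.single s 1)) (-varSign s * bConst k) 0) ∧
      ∀ z : Fin k ⊕ Fin k → ℂ, ∑ s, ‖z s‖ < 1 / (400 * logScale k) →
        HasProd (fun p : Nat.Primes => localFactor k p z) (Complex.exp (f z) * aConst k) ∧
        ‖f z‖ ≤ sumConst * k ∧
        ‖f z - ∑ j, f (Pi.single j (z j))‖ ≤ sumConst := by
  have hL := logScale_ge hk
  set δ := 1 / (400 * logScale k) with hδdef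
  have hδ : 0 < δ := by positivity
  choose g hg hg0 hgb using fun p : Nat.Primes => exists_local_log (k := k) hk p.2.two_le
  have hu : Summable fun p : Nat.Primes => localBound k p :=
    summable_of_sum_le (fun p => localBound_nonneg hk) fun s => sum_localBound_le hk s
  have hv : Summable fun p : Nat.Primes => localMixedBound k p :=
    summable_of_sum_le (fun p => localMixedBound_nonneg hk) fun s => sum_localMixedBound_le hk s
  have hgs : ∀ z : Fin k ⊕ Fin k → ℂ, ∑ s, ‖z s‖ < δ → Summable fun p => g p z := fun z hz =>
    Summable.of_norm_bounded hu fun p => (hgb p z hz).2.1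
  have hsingle : ∀ z : Fin k ⊕ Fin k → ℂ, ∑ s, ‖z s‖ < δ → ∀ j,
      ∑ s, ‖(Pi.single j (z j) : Fin k ⊕ Fin k → ℂ) s‖ < δ := fun z hz j => by
    rw [Finset.sum_eq_single j (fun b _ hb => by simp [hb]) (by simp)]
    simp only [Pi.single_eq_same]
    exact (Finset.single_le_sum (f := fun s => ‖z s‖) (fun _ _ => norm_nonneg _)
      (Finset.mem_univ j)).trans_lt hz
  have hderiv : ∀ s : Fin k ⊕ Fin k,
      HasSum (fun p : Nat.Primes => -varSign s * (bTerm k p : ℂ))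
        (deriv (fun t : ℂ => ∑' p, g p (t • Pi.single s 1)) 0) ∧
      DifferentiableAt ℂ (fun t : ℂ => ∑' p, g p (t • Pi.single s 1)) 0 := fun s => by
    have h1 := fun p : Nat.Primes => hasDerivAt_local_log hk p.2.two_le hδ (hg p) (hg0 p)
      (fun z hz => (hgb p z hz).1) s
    have hle : ∀ (p : Nat.Primes) (t : ℂ), t ∈ ball (0 : ℂ) δ →
        ‖g p (t • Pi.single s 1)‖ ≤ localBound k p := fun p t ht => by
      refine (hgb p _ ?_).2.1
      rw [mem_ball_zero_iff] at ht
      rw [Finset.sum_eq_single s (fun b _ hb => by simp [hb]) (by simp)]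
      rwa [Pi.smul_apply, Pi.single_eq_same, smul_eq_mul, mul_one]
    have h2 := Complex.hasSum_deriv_of_summable_norm hu (fun p => (h1 p).1) isOpen_ball hle
      (mem_ball_self hδ)
    have h3 := Complex.differentiableOn_tsum_of_summable_norm hu (fun p => (h1 p).1) isOpen_ball hle
    simp only [fun p => (h1 p).2] at h2
    exact ⟨h2, h3.differentiableAt (isOpen_ball.mem_nhds (mem_ball_self hδ))⟩
  -- Convergence of the B_k series is a by-product of termwise differentiation of the normally
  -- convergent sum of logarithms, in the first variable.
  have hb : Summable fun p : Nat.Primes => bTerm k p := by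
    have h1 := (hderiv (Sum.inl ⟨0, hk⟩)).1.summable
    simp only [varSign, Sum.elim_inl, neg_neg, one_mul] at h1
    exact Complex.summable_ofReal.1 h1
  refine ⟨hb, fun z => ∑' p, g p z, CurveHolomorphicOn.tsum hu hg fun p z hz => (hgb p z hz).2.1,
    by simp [hg0], fun s => ?_, fun z hz => ⟨?_, ?_, ?_⟩⟩
  · have h1 := (hderiv s).1.unique ((Complex.hasSum_ofReal.2 hb.hasSum).mul_left (-varSign s))
    rw [bConst, ← h1]
    exact (hderiv s).2.hasDerivAt
  · have h1 := ((hgs z hz).hasSum.add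
      (Complex.hasSum_ofReal.2 (summable_log_centralValue hk).hasSum)).cexp
    rw [Complex.exp_add, ← Complex.ofReal_exp, exp_tsum_log_centralValue hk] at h1
    refine h1.congr_fun fun p => ?_
    simp only [Function.comp_apply]
    rw [Complex.exp_add, ← Complex.ofReal_exp, Real.exp_log (centralValue_pos hk p.2.two_le),
      ← localFactor_zero_eq_centralValue hk p.2.two_le, (hgb p z hz).1]
  · exact (tsum_of_norm_bounded hu.hasSum fun p => (hgb p z hz).2.1).trans
      (hu.tsum_le_of_sum_le fun s => sum_localBound_le hk s)
  · have h1 : ∑' p, g p z - ∑ j, ∑' p, g p (Pi.single j (z j)) =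
        ∑' p, (g p z - ∑ j, g p (Pi.single j (z j))) := by
      rw [← Summable.tsum_finsetSum fun j _ => hgs _ (hsingle z hz j)]
      exact ((hgs z hz).tsum_sub (summable_sum fun j _ => hgs _ (hsingle z hz j))).symm
    rw [h1]
    exact (tsum_of_norm_bounded hv.hasSum fun p => (hgb p z hz).2.2).trans
      (hv.tsum_le_of_sum_le fun s => sum_localMixedBound_le hk s)

/-! ### The Taylor expansion and the final bounds. -/

theorem weight_single {ι : Type*} [Fintype ι] [DecidableEq ι] (i : ι) :
    weight (Pi.single i 1 : ι → ℕ) = 1 := by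
  simp [weight]

theorem weight_eq_zero_iff {ι : Type*} [Fintype ι] {α : ι → ℕ} : weight α = 0 ↔ α = 0 := by
  rw [weight, Finset.sum_eq_zero_iff, funext_iff]
  simp

theorem weight_eq_one {ι : Type*} [Fintype ι] [DecidableEq ι] {α : ι → ℕ} (h : weight α = 1) :
    ∃ i, Pi.single i 1 = α := by
  obtain ⟨i, hi⟩ : ∃ i, α i ≠ 0 := by
    by_contra! h0
    rw [weight_eq_zero_iff.2 (funext h0)] at h
    exact zero_ne_one h
  rw [weight, ← Finset.add_sum_erase _ _ (Finset.mem_univ i)] at h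
  have h0 : ∑ j ∈ Finset.univ.erase i, α j = 0 := by omega
  refine ⟨i, funext fun j => ?_⟩
  by_cases hj : j = i
  · subst hj; simp; omega
  · rw [Pi.single_eq_of_ne hj]
    exact (Finset.sum_eq_zero_iff.1 h0 j (Finset.mem_erase.2 ⟨hj, Finset.mem_univ j⟩)).symm

/-- Removing the terms of weight at most one from a convergent power series. -/
theorem hasSum_weight_gt_one {ι : Type*} [Fintype ι] [DecidableEq ι] {T : (ι → ℕ) → ℂ} {x : ℂ}
    (h : HasSum T x) :
    HasSum (fun α : {α : ι → ℕ // 1 < weight α} => T α.1)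
      (x - (T 0 + ∑ i, T (Pi.single i 1))) := by
  set S : Finset (ι → ℕ) := insert 0 (Finset.univ.image fun i => Pi.single i 1) with hS
  have hinj : Function.Injective fun i : ι => (Pi.single i 1 : ι → ℕ) := fun i j hij => by
    by_contra hne
    have := congrFun hij i
    simp [hne] at this
  have h0 : (0 : ι → ℕ) ∉ Finset.univ.image fun i : ι => (Pi.single i 1 : ι → ℕ) := fun h0 => by
    obtain ⟨i, -, hi⟩ := Finset.mem_image.1 h0
    have := weight_single i
    rw [hi, weight_eq_zero_iff.2 rfl] at this
    exact zero_ne_one this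
  have hsum : ∑ α ∈ S, T α = T 0 + ∑ i, T (Pi.single i 1) := by
    rw [hS, Finset.sum_insert h0, Finset.sum_image fun i _ j _ hij => hinj hij]
  have hmem : ∀ α : ι → ℕ, 1 < weight α ↔ α ∉ S := fun α => by
    rw [hS, Finset.mem_insert, Finset.mem_image]
    constructor
    · rintro hα (rfl | ⟨i, -, rfl⟩)
      · rw [weight_eq_zero_iff.2 rfl] at hα
        omega
      · rw [weight_single] at hα
        omega
    · intro hα
      by_contra hle
      have : weight α = 0 ∨ weight α = 1 := by omega
      rcases this with hw | hw
      · exact hα (Or.inl (weight_eq_zero_iff.1 hw))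
      · obtain ⟨i, hi⟩ := weight_eq_one hw
        exact hα (Or.inr ⟨i, Finset.mem_univ i, hi⟩)
  rw [← sub_add_cancel x (T 0 + ∑ i, T (Pi.single i 1)), ← hsum, ← Finset.hasSum_compl_iff,
    hsum] at h
  exact (Equiv.subtypeEquivRight hmem).hasSum_iff.2 h

/-- The Taylor expansion of the logarithm of the arithmetic factor, with coefficient bounds. -/
theorem exists_taylor_coeff {k : ℕ} (hk : 1 ≤ k) :
    ∃ a : (Fin k ⊕ Fin k → ℕ) → ℂ, IsTaylorExpansion k a ∧
      (∀ α, numNonzero α = 1 → ‖a α‖ ≤ sumConst * k * (800 * logScale k) ^ weight α) ∧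
      ∀ α, 1 < numNonzero α →
        ‖a α‖ ≤ sumConst * (800 * numNonzero α * logScale k) ^ weight α := by
  obtain ⟨hb, f, hf, hf0, hfd, hfb⟩ := exists_log_arithFactor hk
  have hL := logScale_ge hk
  have hδ : 0 < 1 / (400 * logScale k) := by positivity
  obtain ⟨a, ⟨ε, hε, ha⟩, ha1, ha2⟩ := exists_coeff_bounds hδ hf
    (fun z hz => (hfb z hz).2.1) fun z hz => (hfb z hz).2.2
  refine ⟨a, ⟨aConst_pos hk, hb, ?_⟩, fun α hα => ?_, fun α hα => ?_⟩
  · have hcoef : ∀ s, a (Pi.single s 1) = -varSign s * bConst k := fun s => by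
      have h1 := (hasDerivAt_line hε ha (Pi.single s 1)).unique (hfd s)
      rw [← h1, Finset.sum_eq_single s (fun b _ hb => by simp [hb]) (by simp)]
      simp
    have hopen : IsOpen {z : Fin k ⊕ Fin k → ℂ | ∑ s, ‖z s‖ < 1 / (400 * logScale k)} :=
      isOpen_lt (by fun_prop) continuous_const
    have h0mem : (0 : Fin k ⊕ Fin k → ℂ) ∈
        {z : Fin k ⊕ Fin k → ℂ | ∑ s, ‖z s‖ < 1 / (400 * logScale k)} := by
      simpa using hδ
    have hcont : Tendsto f (𝓝 0) (𝓝 0) := by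
      have := (hf.1.continuousAt (hopen.mem_nhds h0mem)).tendsto
      rwa [hf0] at this
    have ha0 : a 0 = 0 := by
      have h1 := ha 0 fun i => by simpa using hε
      rw [hf0] at h1
      have h2 := hasSum_single (f := fun α => a α * ∏ i, (0 : Fin k ⊕ Fin k → ℂ) i ^ α i) 0
        fun α hα => by
          obtain ⟨i, hi⟩ := Function.ne_iff.1 hα
          rw [Finset.prod_eq_zero (Finset.mem_univ i) (zero_pow hi), mul_zero]
      simpa using h2.unique h1
    filter_upwards [hopen.mem_nhds h0mem, ball_mem_nhds (0 : Fin k ⊕ Fin k → ℂ) hε,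
      hcont (ball_mem_nhds (0 : ℂ) one_pos)] with z hz hzε hz1
    have hprod := (hfb z hz).1
    have hA : arithFactor k z = Complex.exp (f z) * aConst k := hprod.tprod_eq
    have hne : Complex.exp (f z) * (aConst k : ℂ) ≠ 0 :=
      mul_ne_zero (Complex.exp_ne_zero _) (by exact_mod_cast (aConst_pos hk).ne')
    refine ⟨hprod.multipliable, by rwa [hA], ?_⟩
    -- Near 0 the imaginary part of `f` is below π, so the logarithm of exp(f) a_k is the principal
    -- one.
    have him : |(f z).im| < 1 := by
      have h1 : ‖f z‖ < 1 := by simpa using hz1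
      exact (Complex.abs_im_le_norm _).trans_lt h1
    have hpi := Real.pi_gt_three
    rw [abs_lt] at him
    have hzε' : ∀ i, ‖z i‖ < ε := fun i =>
      (norm_le_pi_norm z i).trans_lt (by simpa using hzε)
    have h1 := hasSum_weight_gt_one (ha z hzε')
    convert h1 using 1
    rw [hA, Complex.log_mul_ofReal _ (aConst_pos hk) _ (Complex.exp_ne_zero _),
      Complex.log_exp (by linarith) (by linarith)]
    have h2 : ∀ s, a (Pi.single s 1) * ∏ i, z i ^ (Pi.single s 1 : Fin k ⊕ Fin k → ℕ) i =
        -varSign s * bConst k * z s := fun s => by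
      rw [hcoef, Finset.prod_eq_single s (fun b _ hb => by simp [hb]) (by simp)]
      simp
    simp only [h2, ha0, zero_mul, zero_add, Fintype.sum_sum_type, varSign, Sum.elim_inl,
      Sum.elim_inr, neg_neg, one_mul, Finset.sum_sub_distrib]
    rw [mul_sub, Finset.mul_sum, Finset.mul_sum]
    simp only [neg_mul, one_mul, Finset.sum_neg_distrib]
    ring
  · refine (ha1 α hα).trans_eq ?_
    congr 2
    field_simp
    norm_num
  · refine (ha2 α hα).trans_eq ?_
    congr 2
    field_simp
    norm_num

theorem numNonzero_pos {ι : Type*} [Fintype ι] {α : ι → ℕ} (h : 1 < weight α) :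
    1 ≤ numNonzero α := by
  by_contra h0
  have h1 : numNonzero α = 0 := by omega
  rw [numNonzero, Finset.card_eq_zero, Finset.filter_eq_empty_iff] at h1
  have h2 : α = 0 := funext fun i => not_not.1 (h1 (Finset.mem_univ i))
  rw [weight_eq_zero_iff.2 h2] at h
  omega

theorem sumConst_pos : 0 < sumConst := by
  rw [sumConst]; positivity

end

end ZetaMoment

theorem mainTheorem3 :
    ∃ a : (k : ℕ) → (Fin k ⊕ Fin k → ℕ) → ℂ,
      (∀ k : ℕ, 1 ≤ k → ZetaMoment.IsTaylorExpansion k (a k)) ∧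
      ∃ lam C : ℝ, 0 < lam ∧ 0 < C ∧ ∃ K : ℕ, ∀ k : ℕ, K ≤ k →
        ∀ α : Fin k ⊕ Fin k → ℕ, 1 < ZetaMoment.weight α →
          (ZetaMoment.numNonzero α = 1 →
            ‖a k α‖ ≤ C *
              (lam ^ ZetaMoment.weight α * Real.log k ^ ZetaMoment.weight α * k +
                lam ^ ZetaMoment.weight α * (ZetaMoment.weight α).factorial *
                  Real.log k ^ (ZetaMoment.weight α - 1) * k)) ∧
          (1 < ZetaMoment.numNonzero α →
            ‖a k α‖ ≤ C *
              (lam ^ ZetaMoment.weight α *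
                  (ZetaMoment.numNonzero α : ℝ) ^ ZetaMoment.weight α *
                  Real.log k ^ ZetaMoment.weight α +
                lam ^ ZetaMoment.weight α * (ZetaMoment.weight α).factorial *
                  Real.log k ^ (ZetaMoment.weight α - 1) *
                  (k : ℝ) ^ ((2 : ℤ) - (ZetaMoment.numNonzero α : ℤ)))) ∧
          ‖a k α‖ ≤ C *
            (lam ^ ZetaMoment.weight α * Real.log k ^ ZetaMoment.weight α *
              ((ZetaMoment.numNonzero α : ℝ) ^ ZetaMoment.weight α *
                  (k : ℝ) ^ ((2 : ℤ) - min (ZetaMoment.numNonzero α : ℤ) 2) +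
                (ZetaMoment.weight α).factorial *
                  (k : ℝ) ^ ((2 : ℤ) - (ZetaMoment.numNonzero α : ℤ)))) := by
  have h : ∀ k : ℕ, ∃ a : (Fin k ⊕ Fin k → ℕ) → ℂ, 1 ≤ k → ZetaMoment.IsTaylorExpansion k a ∧
      (∀ α, ZetaMoment.numNonzero α = 1 →
        ‖a α‖ ≤ ZetaMoment.sumConst * k * (800 * ZetaMoment.logScale k) ^ ZetaMoment.weight α) ∧
      ∀ α, 1 < ZetaMoment.numNonzero α → ‖a α‖ ≤ ZetaMoment.sumConst *
        (800 * ZetaMoment.numNonzero α * ZetaMoment.logScale k) ^ ZetaMoment.weight α := fun k => by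
    by_cases hk : 1 ≤ k
    · obtain ⟨a, ha⟩ := ZetaMoment.exists_taylor_coeff hk
      exact ⟨a, fun _ => ha⟩
    · exact ⟨0, fun h => absurd h hk⟩
  choose a ha using h
  have hC := ZetaMoment.sumConst_pos
  -- For k ≥ e^{16} one has log k + 16 ≤ 2 log k, which turns 800 into 1600.
  refine ⟨a, fun k hk => (ha k hk).1, 1600, ZetaMoment.sumConst, by norm_num, hC,
    ⌈Real.exp 16⌉₊, fun k hk α hα => ?_⟩
  have hke : Real.exp 16 ≤ k := Nat.ceil_le.1 hk
  have hk0 : (0 : ℝ) < k := (Real.exp_pos _).trans_le hke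
  have hk1 : 1 ≤ k := by exact_mod_cast hk0
  have hlog : 16 ≤ Real.log k := (Real.le_log_iff_exp_le hk0).2 hke
  have hL0 := ZetaMoment.logScale_ge hk1
  have hL : 800 * ZetaMoment.logScale k ≤ 1600 * Real.log k := by
    rw [ZetaMoment.logScale]; linarith
  obtain ⟨-, h1, h2⟩ := ha k hk1
  have b1 : ZetaMoment.numNonzero α = 1 → ‖a k α‖ ≤ ZetaMoment.sumConst *
      (1600 ^ ZetaMoment.weight α * Real.log k ^ ZetaMoment.weight α * k) := fun hm => by
    refine (h1 α hm).trans ?_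
    rw [← mul_pow, mul_assoc, mul_comm (k : ℝ)]
    gcongr
  have b2 : 1 < ZetaMoment.numNonzero α → ‖a k α‖ ≤ ZetaMoment.sumConst *
      (1600 ^ ZetaMoment.weight α * (ZetaMoment.numNonzero α : ℝ) ^ ZetaMoment.weight α *
        Real.log k ^ ZetaMoment.weight α) := fun hm => by
    refine (h2 α hm).trans ?_
    rw [← mul_pow, ← mul_pow]
    gcongr ?_ * ?_ ^ _
    calc 800 * (ZetaMoment.numNonzero α : ℝ) * ZetaMoment.logScale k =
          ZetaMoment.numNonzero α * (800 * ZetaMoment.logScale k) := by ring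
      _ ≤ ZetaMoment.numNonzero α * (1600 * Real.log k) := by gcongr
      _ = _ := by ring
  refine ⟨fun hm => (b1 hm).trans ?_, fun hm => (b2 hm).trans ?_, ?_⟩
  · exact mul_le_mul_of_nonneg_left (le_add_of_nonneg_right (by positivity)) hC.le
  · exact mul_le_mul_of_nonneg_left (le_add_of_nonneg_right (by positivity)) hC.le
  -- The combined form agrees with the first terms of the two cases: the power of k is k for m = 1
  -- and 1 for m ≥ 2.
  · rcases (ZetaMoment.numNonzero_pos hα).eq_or_lt with hm | hm
    · refine (b1 hm.symm).trans (mul_le_mul_of_nonneg_left ?_ hC.le)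
      rw [← hm]
      norm_num
      gcongr
      exact le_add_of_nonneg_right (by positivity)
    · refine (b2 hm).trans (mul_le_mul_of_nonneg_left ?_ hC.le)
      have hm' : (2 : ℤ) ≤ (ZetaMoment.numNonzero α : ℤ) := by exact_mod_cast hm
      rw [min_eq_right hm', sub_self, zpow_zero, mul_one, mul_right_comm]
      gcongr
      exact le_add_of_nonneg_right (by positivity)
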